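/- Let $N\in\mathbb{N}$, let $m\in\mathbb{R}$, let $S^1=\mathbb{R}/2\pi\mathbb{Z}$ and $\mathbb{T}^{N+1}=S^1_t\times\mathbb{T}^N_x$, and let $|\xi|$ be the Euclidean norm of $\xi\in\mathbb{Z}^N$. Let $c(t,D_x):C^\infty(\mathbb{T}^{N+1})\to C^\infty(\mathbb{T}^{N+1})$ be a tube-type toroidal pseudodifferential operator of order $m$, that is, a continuous linear operator whose discrete symbol $e^{-i(t\tau+x\cdot\xi)}\,c(t,D_x)\big(e^{i(t\tau+x\cdot\xi)}\big)$, $(\tau,\xi)\in\mathbb{Z}\times\mathbb{Z}^N$, is a function $c(t,\xi)$ of $(t,\xi)$ only, such that for every $j\in\mathbb{Z}_{\ge 0}$ there is $C_j>0$ with $|\partial_t^j c(t,\xi)|\le C_j(1+|\xi|)^m$ for all $t\in S^1$, $\xi\in\mathbb{Z}^N$. Let $P=D_t+c(t,D_x)$ with $D_t=-i\partial_t$. We say that $P$ is globally solvable if its range is closed in $C^\infty(\mathbb{T}^{N+1})$ (with its usual Fréchet topology). Put $c_0(\xi)=\frac1{2\pi}\int_0^{2\pi}c(t,\xi)\,dt$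 and $\mathcal{Z}=\{\xi\in\mathbb{Z}^N: c_0(\xi)\in\mathbb{Z}\}$. For each $\xi$ let $B(\cdot,\xi):\mathbb{R}\to\mathbb{R}$ be any primitive of $b(\cdot,\xi)=\operatorname{Im}c(\cdot,\xi)$. If $\xi\in\mathcal{Z}$, then $B(\cdot,\xi)$ is $2\pi$-periodic, that is, a function on $S^1$, and $t_\xi\in S^1$ denotes any point where it attains its maximum. For distinct $t_1,t_2\in S^1$, $[t_1,t_2]\subset S^1$ is the arc from $t_1$ to $t_2$ in the anticlockwise orientation. For $D>0$ and $\xi\ne 0$: - $P$ satisfies $(\alpha)_D^+$ (respectively $(\alpha)_D^-$) at $\xi$ if for every $t\in[0,2\pi]$ and every open interval $I\subset[t,t+2\pi]$ (respectively $I\subset[t-2\pi,t]$) of length $|I|\ge|\xi|^{-m}$ there is $s\in I$ with $B(t,\xi)-B(s,\xi)\le D\log|\xi|$. - For $\xi\in\mathcal{Z}$, $P$ satisfies $(\beta)_D$ at $\xi$ if for every $t\in S^1\setminus\{t_\xi\}$ at least one of the following holds: (a) every open interval $I\subset[t,t_\xi]$ with $|I|\ge|\xi|^{-m}$ contains a point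 $s$ with $B(t,\xi)-B(s,\xi)\le D\log|\xi|$; (b) every open interval $I\subset[t_\xi,t]$ with $|I|\ge|\xi|^{-m}$ contains a point $s$ with $B(t,\xi)-B(s,\xi)\le D\log|\xi|$. Theorem. $P$ is globally solvable if and only if both of the following conditions hold: 1. There are $C>0$ and $M\in\mathbb{Z}_{\ge 0}$ such that $|\tau+c_0(\xi)|\ge C(1+|\xi|)^{-M}$ for all $\tau\in\mathbb{Z}$ and $\xi\in\mathbb{Z}^N\setminus\mathcal{Z}$. 2. There is $D>0$ such that (i) at every $\xi\in\mathbb{Z}^N\setminus\mathcal{Z}$ with $|\xi|\ge D$, $P$ satisfies $(\alpha)_D^+$ or $(\alpha)_D^-$; and (ii) at every $\xi\in\mathcal{Z}$ with $|\xi|\ge D$, $P$ satisfies $(\beta)_D$. -/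

import Mathlib

open scoped ContDiff

noncomputable section

namespace TubeOperator

/-- The space `C^∞(𝕋^{N+1})`, `𝕋^{N+1} = S¹_t × 𝕋^N_x` and `S¹ = ℝ / 2πℤ`, as the space of the smooth
functions `f(t, x)` on `ℝ × ℝ^N` that are `2π`-periodic in every variable. -/
def smoothSubmodule (N : ℕ) : Submodule ℂ (ℝ × (Fin N → ℝ) → ℂ) where
  carrier := {f | ContDiff ℝ ∞ f ∧ ∀ (k : ℤ) (n : Fin N → ℤ) (t : ℝ) (x : Fin N → ℝ),
    f (t + 2 * Real.pi * k, fun i => x i + 2 * Real.pi * n i) = f (t, x)}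
  add_mem' := by
    rintro f g ⟨hf, hf'⟩ ⟨hg, hg'⟩
    refine ⟨hf.add hg, fun k n t x => ?_⟩
    simp only [Pi.add_apply, hf', hg']
  zero_mem' := ⟨contDiff_const, fun _ _ _ _ => rfl⟩
  smul_mem' := by
    rintro a f ⟨hf, hf'⟩
    refine ⟨hf.const_smul a, fun k n t x => ?_⟩
    simp only [Pi.smul_apply, hf']

/-- The vector space `C^∞(𝕋^{N+1})`. It is a type of its own, so that its only topology is the
one defined below (and not that of pointwise convergence). -/
def SmoothTorus (N : ℕ) : Type := smoothSubmodule N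

variable {N : ℕ}

instance : AddCommGroup (SmoothTorus N) := inferInstanceAs (AddCommGroup (smoothSubmodule N))

instance : Module ℂ (SmoothTorus N) := inferInstanceAs (Module ℂ (smoothSubmodule N))

instance : CoeFun (SmoothTorus N) (fun _ => ℝ × (Fin N → ℝ) → ℂ) := ⟨fun f => f.1⟩

theorem SmoothTorus.contDiff (f : SmoothTorus N) : ContDiff ℝ ∞ (f : ℝ × (Fin N → ℝ) → ℂ) := f.2.1

theorem SmoothTorus.coe_add (f g : SmoothTorus N) :
    ((f + g : SmoothTorus N) : ℝ × (Fin N → ℝ) → ℂ) = (f : ℝ × (Fin N → ℝ) → ℂ) + g := rfl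

theorem SmoothTorus.coe_smul (a : ℂ) (f : SmoothTorus N) :
    ((a • f : SmoothTorus N) : ℝ × (Fin N → ℝ) → ℂ) = a • (f : ℝ × (Fin N → ℝ) → ℂ) := rfl

theorem SmoothTorus.comp_add (f : SmoothTorus N) (k : ℤ) (n : Fin N → ℤ) :
    (fun p : ℝ × (Fin N → ℝ) => f (p + (2 * Real.pi * k, fun i => 2 * Real.pi * n i))) = f := by
  funext p
  exact f.2.2 k n p.1 p.2

theorem SmoothTorus.iteratedFDeriv_add_period (f : SmoothTorus N) (j : ℕ) (k : ℤ) (n : Fin N → ℤ)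
    (p : ℝ × (Fin N → ℝ)) :
    iteratedFDeriv ℝ j f (p + (2 * Real.pi * k, fun i => 2 * Real.pi * n i)) =
      iteratedFDeriv ℝ j f p := by
  rw [← iteratedFDeriv_comp_add_right, f.comp_add]

theorem SmoothTorus.bddAbove_iteratedFDeriv (f : SmoothTorus N) (j : ℕ) :
    BddAbove (Set.range fun p => ‖iteratedFDeriv ℝ j f p‖) := by
  have hcont : Continuous fun p => ‖iteratedFDeriv ℝ j f p‖ :=
    (f.contDiff.continuous_iteratedFDeriv (by exact_mod_cast le_top)).norm
  have hK : IsCompact (Set.Icc (0 : ℝ) (2 * Real.pi) ×ˢ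
      Set.Icc (0 : Fin N → ℝ) (fun _ => 2 * Real.pi)) := isCompact_Icc.prod isCompact_Icc
  obtain ⟨A, hA⟩ := hK.bddAbove_image hcont.continuousOn
  refine ⟨A, ?_⟩
  rintro _ ⟨p, rfl⟩
  have hpi : (0 : ℝ) < 2 * Real.pi := by positivity
  have key : ∀ y : ℝ, y + 2 * Real.pi * ((-⌊y / (2 * Real.pi)⌋ : ℤ) : ℝ) ∈
      Set.Icc (0 : ℝ) (2 * Real.pi) := by
    intro y
    have h1 := Int.floor_le (y / (2 * Real.pi))
    have h2 := (Int.lt_floor_add_one (y / (2 * Real.pi))).le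
    rw [le_div_iff₀ hpi] at h1
    rw [div_le_iff₀ hpi] at h2
    push_cast
    constructor <;> nlinarith
  have h := hA (Set.mem_image_of_mem _
    (show p + (2 * Real.pi * ((-⌊p.1 / (2 * Real.pi)⌋ : ℤ) : ℝ),
        fun i => 2 * Real.pi * ((-⌊p.2 i / (2 * Real.pi)⌋ : ℤ) : ℝ)) ∈ _ from
      ⟨key p.1, fun i => (key (p.2 i)).1, fun i => (key (p.2 i)).2⟩))
  simpa only [f.iteratedFDeriv_add_period j _ (fun i => -⌊p.2 i / (2 * Real.pi)⌋)] using h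

/-- The seminorm `f ↦ sup |∇^j f|` on `C^∞(𝕋^{N+1})`. -/
def derivSeminorm (N j : ℕ) : Seminorm ℂ (SmoothTorus N) :=
  Seminorm.of (fun f => ⨆ p, ‖iteratedFDeriv ℝ j f p‖)
    (by
      intro f g
      refine ciSup_le fun p => ?_
      rw [SmoothTorus.coe_add, iteratedFDeriv_add_apply
        (f.contDiff.contDiffAt.of_le (by exact_mod_cast le_top))
        (g.contDiff.contDiffAt.of_le (by exact_mod_cast le_top))]
      exact (norm_add_le _ _).trans
        (add_le_add (le_ciSup (f.bddAbove_iteratedFDeriv j) p)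
          (le_ciSup (g.bddAbove_iteratedFDeriv j) p)))
    (by
      intro a f
      rw [Real.mul_iSup_of_nonneg (norm_nonneg a)]
      refine iSup_congr fun p => ?_
      rw [SmoothTorus.coe_smul, iteratedFDeriv_const_smul_apply
        (f.contDiff.contDiffAt.of_le (by exact_mod_cast le_top)), norm_smul])

/-- The usual Fréchet topology of `C^∞(𝕋^{N+1})`: uniform convergence of all derivatives. -/
instance : TopologicalSpace (SmoothTorus N) :=
  SeminormFamily.moduleFilterBasis (fun j : ℕ => derivSeminorm N j) |>.topology

theorem withSeminorms_smoothTorus (N : ℕ) :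
    WithSeminorms (fun j : ℕ => derivSeminorm N j) := ⟨rfl⟩

/-- The operator `D_t = -i ∂/∂t` on `C^∞(𝕋^{N+1})`. -/
def Dt (N : ℕ) : SmoothTorus N →ₗ[ℂ] SmoothTorus N where
  toFun f := ⟨fun p => -Complex.I * fderiv ℝ f p (1, 0), by
    refine ⟨contDiff_const.mul ((f.contDiff.fderiv_right (m := ∞) (by simp)).clm_apply
      contDiff_const), fun k n t x => ?_⟩
    have h : fderiv ℝ f ((t, x) + (2 * Real.pi * k, fun i => 2 * Real.pi * n i)) =
        fderiv ℝ f (t, x) := by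
      rw [← fderiv_comp_add_right, f.comp_add]
    exact congrArg (fun L : ℝ × (Fin N → ℝ) →L[ℝ] ℂ => -Complex.I * L (1, 0)) h⟩
  map_add' f g := by
    refine Subtype.ext (funext fun p => ?_)
    change -Complex.I * fderiv ℝ ((f : ℝ × (Fin N → ℝ) → ℂ) + (g : ℝ × (Fin N → ℝ) → ℂ)) p (1, 0) =
      -Complex.I * fderiv ℝ f p (1, 0) + -Complex.I * fderiv ℝ g p (1, 0)
    rw [fderiv_add (f.contDiff.differentiable (by simp) p) (g.contDiff.differentiable (by simp) p)]
    simp only [_root_.add_apply]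
    ring
  map_smul' a f := by
    refine Subtype.ext (funext fun p => ?_)
    change -Complex.I * fderiv ℝ (a • (f : ℝ × (Fin N → ℝ) → ℂ)) p (1, 0) =
      a * (-Complex.I * fderiv ℝ f p (1, 0))
    rw [fderiv_const_smul (f.contDiff.differentiable (by simp) p)]
    simp only [_root_.smul_apply, smul_eq_mul]
    ring

/-- The exponential `e^{i (t τ + x · ξ)}`, an element of `C^∞(𝕋^{N+1})`. -/
def expo (τ : ℤ) (ξ : Fin N → ℤ) : SmoothTorus N :=
  ⟨fun p => Complex.exp (Complex.I * ((p.1 * τ + ∑ i, p.2 i * ξ i : ℝ) : ℂ)), by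
    refine ⟨?_, fun k n t x => ?_⟩
    · refine Complex.contDiff_exp.comp (contDiff_const.mul (Complex.ofRealCLM.contDiff.comp ?_))
      exact (contDiff_fst.mul contDiff_const).add (ContDiff.sum fun i _ =>
        (((contDiff_apply ℝ ℝ i).comp contDiff_snd).mul contDiff_const))
    · refine Complex.exp_eq_exp_iff_exists_int.2 ⟨k * τ + ∑ i, n i * ξ i, ?_⟩
      push_cast
      simp only [add_mul, Finset.sum_add_distrib, mul_add, Finset.mul_sum, Finset.sum_mul]
      have : ∀ i, Complex.I * (2 * (Real.pi : ℂ) * n i * ξ i) =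
          n i * ξ i * (2 * Real.pi * Complex.I) := fun i => by ring
      simp only [this]
      ring⟩

/-- The discrete symbol `e^{-i y η} Q(e^{i y η})` of `Q`, at `y = (t, x)` and `η = (τ, ξ)`. -/
def discreteSymbol (Q : SmoothTorus N →L[ℂ] SmoothTorus N) (p : ℝ × (Fin N → ℝ)) (τ : ℤ)
    (ξ : Fin N → ℤ) : ℂ :=
  Complex.exp (-Complex.I * ((p.1 * τ + ∑ i, p.2 i * ξ i : ℝ) : ℂ)) * Q (expo τ ξ) p

/-- The Euclidean norm `|ξ|` of `ξ ∈ ℤ^N`. -/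
def freqNorm (ξ : Fin N → ℤ) : ℝ := Real.sqrt (∑ i, (ξ i : ℝ) ^ 2)

/-- The continuous linear operator `Q` on `C^∞(𝕋^{N+1})` is a tube-type toroidal pseudodifferential
operator `c(t, D_x)` of order `m` with symbol `c(t, ξ)`: its discrete symbol depends only on
`(t, ξ)`, where it is `c(t, ξ)`, and each `t`-derivative of `c` is `O((1 + |ξ|)^m)`. (It follows
from the first condition that `c(·, ξ)` is smooth and `2π`-periodic.) -/
structure IsTubeType (Q : SmoothTorus N →L[ℂ] SmoothTorus N) (c : ℝ → (Fin N → ℤ) → ℂ)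
    (m : ℝ) : Prop where
  symbol_eq : ∀ (p : ℝ × (Fin N → ℝ)) (τ : ℤ) (ξ : Fin N → ℤ), discreteSymbol Q p τ ξ = c p.1 ξ
  symbol_bound : ∀ j : ℕ, ∃ C > 0, ∀ (t : ℝ) (ξ : Fin N → ℤ),
    ‖iteratedDeriv j (fun s => c s ξ) t‖ ≤ C * (1 + freqNorm ξ) ^ m

/-- The operator `P = D_t + Q`. -/
def opP (Q : SmoothTorus N →L[ℂ] SmoothTorus N) : SmoothTorus N →ₗ[ℂ] SmoothTorus N :=
  Dt N + (Q : SmoothTorus N →ₗ[ℂ] SmoothTorus N)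

/-- Global solvability: the range is closed in `C^∞(𝕋^{N+1})`. -/
def GloballySolvable (P : SmoothTorus N →ₗ[ℂ] SmoothTorus N) : Prop := IsClosed (Set.range P)

/-- The average `c₀(ξ)` of `c(·, ξ)` over a period. -/
def average (c : ℝ → (Fin N → ℤ) → ℂ) (ξ : Fin N → ℤ) : ℂ :=
  (2 * (Real.pi : ℂ))⁻¹ * ∫ t in (0 : ℝ)..(2 * Real.pi), c t ξ

/-- The set `𝒵` of the `ξ` for which `c₀(ξ)` is an integer. -/
def resonantSet (c : ℝ → (Fin N → ℤ) → ℂ) : Set (Fin N → ℤ) :=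
  {ξ | ∃ k : ℤ, average c ξ = k}

/-- Every open interval `I ⊆ [p, q]` of length at least `|ξ|^{-m}` contains a point `s` with
`B(t, ξ) - B(s, ξ) ≤ D log |ξ|`. -/
def OscBound (B : ℝ → (Fin N → ℤ) → ℝ) (m D : ℝ) (ξ : Fin N → ℤ) (t p q : ℝ) : Prop :=
  ∀ u v : ℝ, u < v → Set.Ioo u v ⊆ Set.Icc p q → freqNorm ξ ^ (-m) ≤ v - u →
    ∃ s ∈ Set.Ioo u v, B t ξ - B s ξ ≤ D * Real.log (freqNorm ξ)

/-- Condition `(α)_D^+` at `ξ`, for a primitive `B` of the imaginary part of the symbol. -/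
def AlphaPlus (B : ℝ → (Fin N → ℤ) → ℝ) (m D : ℝ) (ξ : Fin N → ℤ) : Prop :=
  ∀ t ∈ Set.Icc (0 : ℝ) (2 * Real.pi), OscBound B m D ξ t t (t + 2 * Real.pi)

/-- Condition `(α)_D^-` at `ξ`. -/
def AlphaMinus (B : ℝ → (Fin N → ℤ) → ℝ) (m D : ℝ) (ξ : Fin N → ℤ) : Prop :=
  ∀ t ∈ Set.Icc (0 : ℝ) (2 * Real.pi), OscBound B m D ξ t (t - 2 * Real.pi) t

/-- Condition `(β)_D` at `ξ ∈ 𝒵`, where `t₀` is a real representative of the point `t_ξ ∈ S¹`.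
Every point of `S¹ \ {t_ξ}` has exactly one representative `t` in `(t₀, t₀ + 2π)`; the
anticlockwise arc `[t, t_ξ]` is then the image of `[t, t₀ + 2π]`, and `[t_ξ, t]` that of
`[t₀, t]`. -/
def Beta (B : ℝ → (Fin N → ℤ) → ℝ) (m D : ℝ) (ξ : Fin N → ℤ) (t₀ : ℝ) : Prop :=
  ∀ t ∈ Set.Ioo t₀ (t₀ + 2 * Real.pi),
    OscBound B m D ξ t t (t₀ + 2 * Real.pi) ∨ OscBound B m D ξ t t₀ t

end TubeOperator

end

noncomputable section

namespace TubeOperator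

open MeasureTheory

variable {N : ℕ}

/-! ### The frequency lattice -/

theorem freqNorm_nonneg (ξ : Fin N → ℤ) : 0 ≤ freqNorm ξ := Real.sqrt_nonneg _

theorem one_le_one_add_freqNorm (ξ : Fin N → ℤ) : 1 ≤ 1 + freqNorm ξ := by
  linarith [freqNorm_nonneg ξ]

theorem one_add_freqNorm_pos (ξ : Fin N → ℤ) : 0 < 1 + freqNorm ξ := by
  linarith [freqNorm_nonneg ξ]

theorem abs_le_freqNorm (ξ : Fin N → ℤ) (i : Fin N) : |(ξ i : ℝ)| ≤ freqNorm ξ := by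
  refine Real.abs_le_sqrt ?_
  exact Finset.single_le_sum (f := fun i => (ξ i : ℝ) ^ 2) (fun i _ => sq_nonneg _)
    (Finset.mem_univ i)

theorem freqNorm_le_sum_abs (ξ : Fin N → ℤ) : freqNorm ξ ≤ ∑ i, |(ξ i : ℝ)| := by
  refine Real.sqrt_le_iff.2 ⟨Finset.sum_nonneg fun i _ => abs_nonneg _, ?_⟩
  have := Finset.sum_sq_le_sq_sum_of_nonneg (s := Finset.univ) (f := fun i => |(ξ i : ℝ)|)
    (fun i _ => abs_nonneg _)
  simpa only [sq_abs] using this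

theorem one_le_freqNorm {ξ : Fin N → ℤ} (h : 0 < freqNorm ξ) : 1 ≤ freqNorm ξ := by
  have : ∃ i, ξ i ≠ 0 := by
    by_contra! hc
    simp [freqNorm, hc] at h
  obtain ⟨i, hi⟩ := this
  refine le_trans ?_ (abs_le_freqNorm ξ i)
  exact_mod_cast Int.one_le_abs hi

theorem finite_freqNorm_le (R : ℝ) : {ξ : Fin N → ℤ | freqNorm ξ ≤ R}.Finite := by
  refine (Set.finite_Icc (fun _ : Fin N => -⌈R⌉) (fun _ => ⌈R⌉)).subset fun ξ hξ => ?_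
  have h : ∀ i, |ξ i| ≤ ⌈R⌉ := fun i => by
    have := ((abs_le_freqNorm ξ i).trans hξ).trans (Int.le_ceil R)
    exact_mod_cast this
  exact ⟨fun i => (abs_le.1 (h i)).1, fun i => (abs_le.1 (h i)).2⟩

theorem summable_prod_pi {g : ℤ → ℝ} (hg : Summable g) (h0 : 0 ≤ g) (n : ℕ) :
    Summable fun ξ : Fin n → ℤ => ∏ i, g (ξ i) := by
  induction n with
  | zero => exact .of_finite
  | succ n ih =>
    rw [← (Fin.consEquiv fun _ => ℤ).summable_iff]
    have h := hg.mul_of_nonneg ih h0 (fun ξ => Finset.prod_nonneg fun i _ => h0 _)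
    refine h.congr fun x => ?_
    simp [Fin.consEquiv, Fin.prod_univ_succ]

/-- Each `1 + |ξ i|` is at most `1 + |ξ|`, so the terms are dominated by an `N`-fold product of the
convergent one-dimensional series with terms `(1 + |k|)⁻²`. This crude exponent suffices, since
every use has arbitrary polynomial decay available. -/
theorem summable_one_add_freqNorm (N : ℕ) :
    Summable fun ξ : Fin N → ℤ => ((1 + freqNorm ξ) ^ (2 * N))⁻¹ := by
  have h1 : Summable fun k : ℤ => ((1 + |(k : ℝ)|) ^ 2)⁻¹ := by
    have := (Real.summable_one_div_int_pow (p := 2)).2 (by norm_num)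
    refine Summable.of_norm_bounded_eventually this ?_
    filter_upwards [(Set.finite_singleton (0 : ℤ)).compl_mem_cofinite] with k hk
    have hk : (0 : ℝ) < |(k : ℝ)| := by simpa using hk
    rw [Real.norm_of_nonneg (by positivity), one_div, ← sq_abs (k : ℝ)]
    gcongr
    linarith
  refine (summable_prod_pi h1 (fun k => by positivity) N).of_nonneg_of_le
    (fun ξ => by have := freqNorm_nonneg ξ; positivity) fun ξ => ?_
  rw [Finset.prod_inv_distrib]
  refine inv_anti₀ (Finset.prod_pos fun i _ => by positivity) ?_
  calc ∏ i, (1 + |(ξ i : ℝ)|) ^ 2 ≤ ∏ _i : Fin N, (1 + freqNorm ξ) ^ 2 :=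
        Finset.prod_le_prod (fun i _ => by positivity) fun i _ => by
          have := abs_le_freqNorm ξ i
          gcongr
    _ = (1 + freqNorm ξ) ^ (2 * N) := by simp [pow_mul]

/-! ### Seminorms and directional derivatives -/

@[ext]
theorem SmoothTorus.ext {f g : SmoothTorus N} (h : ∀ p, f p = g p) : f = g :=
  Subtype.ext (funext h)

theorem SmoothTorus.sub_apply (f g : SmoothTorus N) (p : ℝ × (Fin N → ℝ)) :
    (f - g : SmoothTorus N) p = f p - g p := rfl

theorem SmoothTorus.sum_apply {ι : Type*} (s : Finset ι) (f : ι → SmoothTorus N)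
    (p : ℝ × (Fin N → ℝ)) : (∑ i ∈ s, f i : SmoothTorus N) p = ∑ i ∈ s, f i p := by
  let e : SmoothTorus N →+ ℂ := ⟨⟨fun f => f p, rfl⟩, fun _ _ => rfl⟩
  exact map_sum e f s

theorem norm_iteratedFDeriv_le (f : SmoothTorus N) (j : ℕ) (p : ℝ × (Fin N → ℝ)) :
    ‖iteratedFDeriv ℝ j f p‖ ≤ derivSeminorm N j f :=
  le_ciSup (f.bddAbove_iteratedFDeriv j) p

theorem derivSeminorm_le (f : SmoothTorus N) (j : ℕ) {A : ℝ}
    (h : ∀ p, ‖iteratedFDeriv ℝ j f p‖ ≤ A) : derivSeminorm N j f ≤ A :=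
  ciSup_le h

theorem norm_le_derivSeminorm_zero (f : SmoothTorus N) (p : ℝ × (Fin N → ℝ)) :
    ‖f p‖ ≤ derivSeminorm N 0 f := by
  simpa using norm_iteratedFDeriv_le f 0 p

/-- The derivative of `f` in the direction `v`. -/
def dirDeriv (v : ℝ × (Fin N → ℝ)) (f : SmoothTorus N) : SmoothTorus N :=
  ⟨fun p => fderiv ℝ f p v, by
    refine ⟨(f.contDiff.fderiv_right (m := ∞) (by simp)).clm_apply contDiff_const,
      fun k n t x => ?_⟩
    have h : fderiv ℝ f ((t, x) + (2 * Real.pi * k, fun i => 2 * Real.pi * n i)) =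
        fderiv ℝ f (t, x) := by
      rw [← fderiv_comp_add_right, f.comp_add]
    exact congrArg (fun L : ℝ × (Fin N → ℝ) →L[ℝ] ℂ => L v) h⟩

theorem dirDeriv_apply (v : ℝ × (Fin N → ℝ)) (f : SmoothTorus N) (p : ℝ × (Fin N → ℝ)) :
    dirDeriv v f p = fderiv ℝ f p v := rfl

theorem Dt_eq (f : SmoothTorus N) : Dt N f = (-Complex.I) • dirDeriv (1, 0) f := rfl

/-! ### Slices in `x` as functions on the torus -/

/-- The normalised Haar measure of the torus. -/
def torusMeasure (N : ℕ) : Measure (UnitAddTorus (Fin N)) :=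
  Measure.pi fun _ => AddCircle.haarAddCircle

instance : IsProbabilityMeasure (torusMeasure N) := by unfold torusMeasure; infer_instance

instance : (torusMeasure N).IsAddLeftInvariant := by unfold torusMeasure; infer_instance

/-- The projection of `ℝ^N` onto the torus. -/
def torusMk (x : Fin N → ℝ) : UnitAddTorus (Fin N) := fun i => (x i : UnitAddCircle)

theorem isOpenQuotientMap_torusMk : IsOpenQuotientMap (torusMk (N := N)) :=
  IsOpenQuotientMap.piMap fun _ => QuotientAddGroup.isOpenQuotientMap_mk

theorem exists_torusMk (y : UnitAddTorus (Fin N)) : ∃ x, torusMk x = y :=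
  isOpenQuotientMap_torusMk.surjective y

/-- The function `x ↦ u(p + (0, 2πx))` on `ℝ^N`. -/
def sliceLift (u : SmoothTorus N) (p : ℝ × (Fin N → ℝ)) : C(Fin N → ℝ, ℂ) :=
  ⟨fun x => u (p.1, fun i => p.2 i + 2 * Real.pi * x i), u.contDiff.continuous.comp (by fun_prop)⟩

theorem sliceLift_factorsThrough (u : SmoothTorus N) (p : ℝ × (Fin N → ℝ)) :
    Function.FactorsThrough (sliceLift u p) (torusMk (N := N)) := by
  intro x x' h
  have h1 : ∀ i, ∃ n : ℤ, x i = x' i + n := fun i => by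
    have h2 : (x i : UnitAddCircle) = x' i := congrFun h i
    rw [← sub_eq_zero, ← AddCircle.coe_sub, AddCircle.coe_eq_zero_iff] at h2
    obtain ⟨n, hn⟩ := h2
    exact ⟨n, by rw [zsmul_one] at hn; linarith⟩
  choose n hn using h1
  have h3 := u.2.2 0 n p.1 (fun i => p.2 i + 2 * Real.pi * x' i)
  simp only [sliceLift, ContinuousMap.coe_mk]
  rw [← h3]
  refine congrArg u.1 (Prod.ext ?_ (funext fun i => ?_))
  · simp
  · simp only [hn i]
    ring

/-- The projection of `ℝ^N` onto the torus as a continuous map. -/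
def torusMkC (N : ℕ) : C(Fin N → ℝ, UnitAddTorus (Fin N)) :=
  ⟨torusMk, isOpenQuotientMap_torusMk.continuous⟩

theorem isQuotientMap_torusMkC : Topology.IsQuotientMap (torusMkC N) :=
  isOpenQuotientMap_torusMk.isQuotientMap

/-- The function `x ↦ u(p + (0, 2πx))` on the torus. -/
def slice (u : SmoothTorus N) (p : ℝ × (Fin N → ℝ)) : C(UnitAddTorus (Fin N), ℂ) :=
  isQuotientMap_torusMkC.lift (sliceLift u p) (sliceLift_factorsThrough u p)

theorem slice_torusMk (u : SmoothTorus N) (p : ℝ × (Fin N → ℝ)) (x : Fin N → ℝ) :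
    slice u p (torusMk x) = u (p.1, fun i => p.2 i + 2 * Real.pi * x i) :=
  ContinuousMap.congr_fun
    (isQuotientMap_torusMkC.lift_comp (sliceLift u p) (sliceLift_factorsThrough u p)) x

theorem norm_slice_le (u : SmoothTorus N) (p : ℝ × (Fin N → ℝ)) (y : UnitAddTorus (Fin N)) :
    ‖slice u p y‖ ≤ derivSeminorm N 0 u := by
  obtain ⟨x, rfl⟩ := exists_torusMk y
  exact norm_le_derivSeminorm_zero _ _

/-- The exponential `e^{i x · ξ}`. -/
def phase (ξ : Fin N → ℤ) (x : Fin N → ℝ) : ℂ :=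
  Complex.exp (Complex.I * ((∑ i, x i * ξ i : ℝ) : ℂ))

theorem norm_phase (ξ : Fin N → ℤ) (x : Fin N → ℝ) : ‖phase ξ x‖ = 1 := by
  rw [phase, mul_comm, Complex.norm_exp_ofReal_mul_I]

theorem mFourier_torusMk (ξ : Fin N → ℤ) (x : Fin N → ℝ) :
    UnitAddTorus.mFourier ξ (torusMk x) = phase ξ (fun i => 2 * Real.pi * x i) := by
  simp only [UnitAddTorus.mFourier, ContinuousMap.coe_mk, torusMk, fourier_coe_apply, phase]
  rw [← Complex.exp_sum]
  congr 1
  push_cast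
  rw [Finset.mul_sum]
  refine Finset.sum_congr rfl fun i _ => ?_
  ring

/-- The Fourier coefficient of frequency `ξ` of `x ↦ u(p + (0, x))`. -/
def sliceCoeff (u : SmoothTorus N) (p : ℝ × (Fin N → ℝ)) (ξ : Fin N → ℤ) : ℂ :=
  ∫ y, UnitAddTorus.mFourier (-ξ) y * slice u p y ∂torusMeasure N

theorem norm_mFourier_apply (ξ : Fin N → ℤ) (y : UnitAddTorus (Fin N)) :
    ‖UnitAddTorus.mFourier ξ y‖ = 1 := by
  obtain ⟨x, rfl⟩ := exists_torusMk y
  rw [mFourier_torusMk, norm_phase]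

theorem integrable_of_continuous (g : C(UnitAddTorus (Fin N), ℂ)) :
    Integrable g (torusMeasure N) := by
  rw [← integrableOn_univ]
  exact g.continuous.continuousOn.integrableOn_compact isCompact_univ

theorem norm_sliceCoeff_le (u : SmoothTorus N) (p : ℝ × (Fin N → ℝ)) (ξ : Fin N → ℤ) :
    ‖sliceCoeff u p ξ‖ ≤ derivSeminorm N 0 u := by
  refine (norm_integral_le_of_norm_le_const (C := derivSeminorm N 0 u)
    (Filter.Eventually.of_forall fun y => ?_)).trans (by simp)
  rw [norm_mul, norm_mFourier_apply, one_mul]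
  exact norm_slice_le u p y

theorem sliceCoeff_add (u v : SmoothTorus N) (p : ℝ × (Fin N → ℝ)) (ξ : Fin N → ℤ) :
    sliceCoeff (u + v) p ξ = sliceCoeff u p ξ + sliceCoeff v p ξ := by
  unfold sliceCoeff
  refine Eq.trans ?_ (integral_add
    (integrable_of_continuous (UnitAddTorus.mFourier (-ξ) * slice u p))
    (integrable_of_continuous (UnitAddTorus.mFourier (-ξ) * slice v p)))
  refine integral_congr_ae (Filter.Eventually.of_forall fun y => ?_)
  obtain ⟨x, rfl⟩ := exists_torusMk y
  simp only [slice_torusMk, SmoothTorus.coe_add, Pi.add_apply]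
  ring

theorem sliceCoeff_smul (a : ℂ) (u : SmoothTorus N) (p : ℝ × (Fin N → ℝ)) (ξ : Fin N → ℤ) :
    sliceCoeff (a • u) p ξ = a * sliceCoeff u p ξ := by
  unfold sliceCoeff
  rw [← integral_const_mul]
  refine integral_congr_ae (Filter.Eventually.of_forall fun y => ?_)
  obtain ⟨x, rfl⟩ := exists_torusMk y
  simp only [slice_torusMk, SmoothTorus.coe_smul, Pi.smul_apply, smul_eq_mul]
  ring

theorem slice_translate (u : SmoothTorus N) (t : ℝ) (h : Fin N → ℝ) (y : UnitAddTorus (Fin N)) :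
    slice u (t, fun i => 2 * Real.pi * h i) y = slice u (t, 0) (torusMk h + y) := by
  obtain ⟨x, rfl⟩ := exists_torusMk y
  have : torusMk h + torusMk x = torusMk (h + x) := rfl
  rw [this, slice_torusMk, slice_torusMk]
  refine congrArg u.1 (Prod.ext rfl (funext fun i => ?_))
  simp only [Pi.add_apply, Pi.zero_apply]
  ring

/-- Invariance of Haar measure. Differentiated in `x`, this identity takes the place of integration
by parts. -/
theorem sliceCoeff_translate (u : SmoothTorus N) (t : ℝ) (x : Fin N → ℝ) (ξ : Fin N → ℤ) :
    sliceCoeff u (t, x) ξ = phase ξ x * sliceCoeff u (t, 0) ξ := by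
  have hx : x = fun i => 2 * Real.pi * (x i / (2 * Real.pi)) := by
    funext i
    field_simp
  set h : Fin N → ℝ := fun i => x i / (2 * Real.pi) with hh
  unfold sliceCoeff
  rw [← integral_const_mul, ← integral_add_left_eq_self
    (fun y => phase ξ x * (UnitAddTorus.mFourier (-ξ) y * slice u (t, 0) y)) (torusMk h)]
  refine integral_congr_ae (Filter.Eventually.of_forall fun y => ?_)
  simp only
  rw [show slice u (t, x) y = slice u (t, 0) (torusMk h + y) by
    rw [← slice_translate, hh, ← hx], ← mul_assoc]
  congr 1
  obtain ⟨z, rfl⟩ := exists_torusMk y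
  have : torusMk h + torusMk z = torusMk (h + z) := rfl
  rw [this, mFourier_torusMk, mFourier_torusMk, phase, phase, phase, ← Complex.exp_add]
  congr 1
  rw [← mul_add, ← Complex.ofReal_add, ← Finset.sum_add_distrib]
  congr 3
  funext i
  simp only [Pi.neg_apply, Pi.add_apply, hh]
  push_cast
  field_simp
  ring

theorem hasDerivAt_sliceCoeff (u : SmoothTorus N) (p v : ℝ × (Fin N → ℝ)) (ξ : Fin N → ℤ)
    (s₀ : ℝ) : HasDerivAt (fun s : ℝ => sliceCoeff u (p + s • v) ξ)
      (sliceCoeff (dirDeriv v u) (p + s₀ • v) ξ) s₀ := by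
  refine (hasDerivAt_integral_of_dominated_loc_of_deriv_le (s := Set.univ) Filter.univ_mem
    (bound := fun _ => derivSeminorm N 0 (dirDeriv v u))
    (F' := fun s y => UnitAddTorus.mFourier (-ξ) y * slice (dirDeriv v u) (p + s • v) y)
    (Filter.Eventually.of_forall fun s => ?_) ?_ ?_ ?_ ?_ ?_).2
  · exact (integrable_of_continuous (UnitAddTorus.mFourier (-ξ) * slice u _)).1
  · exact integrable_of_continuous (UnitAddTorus.mFourier (-ξ) * slice u _)
  · exact (integrable_of_continuous (UnitAddTorus.mFourier (-ξ) * slice (dirDeriv v u) _)).1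
  · refine Filter.Eventually.of_forall fun y s _ => ?_
    rw [norm_mul, norm_mFourier_apply, one_mul]
    exact norm_slice_le _ _ _
  · exact integrable_const _
  · refine Filter.Eventually.of_forall fun y s _ => ?_
    obtain ⟨x, rfl⟩ := exists_torusMk y
    refine HasDerivAt.const_mul _ ?_
    simp only [slice_torusMk, dirDeriv_apply]
    have h1 : ∀ s : ℝ, (((p + s • v).1, fun i => (p + s • v).2 i + 2 * Real.pi * x i) :
        ℝ × (Fin N → ℝ)) = (p + (0, fun i => 2 * Real.pi * x i)) + s • v := fun s => by
      ext <;> simp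
      ring
    simp only [h1]
    have h2 : HasDerivAt (fun s : ℝ => (p + (0, fun i => 2 * Real.pi * x i)) + s • v) v s := by
      simpa using ((hasDerivAt_id s).smul_const v).const_add
        (p + (0, fun i => 2 * Real.pi * x i))
    exact (u.contDiff.differentiable (by simp) _).hasFDerivAt.comp_hasDerivAt s h2

/-! ### Partial Fourier coefficients -/

/-- The partial Fourier coefficient `t ↦ (2π)^{-N} ∫ u(t, x) e^{-i x · ξ} dx`. -/
def mode (u : SmoothTorus N) (ξ : Fin N → ℤ) (t : ℝ) : ℂ := sliceCoeff u (t, 0) ξ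

theorem norm_mode_le (u : SmoothTorus N) (ξ : Fin N → ℤ) (t : ℝ) :
    ‖mode u ξ t‖ ≤ derivSeminorm N 0 u := norm_sliceCoeff_le _ _ _

theorem mode_add (u v : SmoothTorus N) (ξ : Fin N → ℤ) (t : ℝ) :
    mode (u + v) ξ t = mode u ξ t + mode v ξ t := sliceCoeff_add _ _ _ _

theorem mode_smul (a : ℂ) (u : SmoothTorus N) (ξ : Fin N → ℤ) (t : ℝ) :
    mode (a • u) ξ t = a * mode u ξ t := sliceCoeff_smul _ _ _ _

theorem hasDerivAt_mode (u : SmoothTorus N) (ξ : Fin N → ℤ) (t : ℝ) :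
    HasDerivAt (mode u ξ) (mode (dirDeriv (1, 0) u) ξ t) t := by
  have h := hasDerivAt_sliceCoeff u 0 (1, 0) ξ t
  have h1 : ∀ s : ℝ, (0 : ℝ × (Fin N → ℝ)) + s • (1, 0) = (s, 0) := fun s => by ext <;> simp
  simp only [h1] at h
  exact h

theorem iteratedDeriv_mode (u : SmoothTorus N) (ξ : Fin N → ℤ) (j : ℕ) :
    iteratedDeriv j (mode u ξ) = mode ((dirDeriv (1, 0))^[j] u) ξ := by
  induction j with
  | zero => simp
  | succ j ih =>
    rw [iteratedDeriv_succ, ih, Function.iterate_succ_apply']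
    funext t
    exact (hasDerivAt_mode _ ξ t).deriv

/-- The smooth `2π`-periodic functions on the real line. -/
structure IsCirc (g : ℝ → ℂ) : Prop where
  contDiff : ContDiff ℝ ∞ g
  periodic : Function.Periodic g (2 * Real.pi)

theorem isCirc_mode (u : SmoothTorus N) (ξ : Fin N → ℤ) : IsCirc (mode u ξ) := by
  refine ⟨?_, fun t => ?_⟩
  · refine contDiff_of_differentiable_iteratedDeriv fun j _ => ?_
    rw [iteratedDeriv_mode]
    exact fun t => (hasDerivAt_mode _ ξ t).differentiableAt
  · refine integral_congr_ae (Filter.Eventually.of_forall fun y => ?_)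
    obtain ⟨x, rfl⟩ := exists_torusMk y
    simp only [slice_torusMk]
    congr 1
    have := u.2.2 1 0 t (fun i => (0 : Fin N → ℝ) i + 2 * Real.pi * x i)
    simpa using this

theorem hasDerivAt_phase (ξ : Fin N → ℤ) (i : Fin N) :
    HasDerivAt (fun s : ℝ => phase ξ (s • Pi.single i 1)) (Complex.I * ξ i) 0 := by
  have h : ∀ s : ℝ, phase ξ (s • Pi.single i 1) = Complex.exp (Complex.I * ξ i * (s : ℂ)) := by
    intro s
    unfold phase
    congr 1
    rw [Finset.sum_eq_single i (fun k _ hk => by simp [hk]) (by simp)]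
    simp
    ring
  simp only [h]
  have h1 : HasDerivAt (fun s : ℝ => Complex.I * ξ i * (s : ℂ)) (Complex.I * ξ i * 1) 0 :=
    (Complex.ofRealCLM.hasDerivAt (x := (0 : ℝ))).const_mul _
  simpa using h1.cexp

theorem mode_dirDeriv (u : SmoothTorus N) (ξ : Fin N → ℤ) (i : Fin N) (t : ℝ) :
    mode (dirDeriv (0, Pi.single i 1) u) ξ t = Complex.I * ξ i * mode u ξ t := by
  have h := hasDerivAt_sliceCoeff u (t, 0) (0, Pi.single i 1) ξ 0
  have h1 : ∀ s : ℝ, ((t, 0) : ℝ × (Fin N → ℝ)) + s • (0, Pi.single i 1) =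
      (t, s • Pi.single i 1) := fun s => by ext <;> simp
  simp only [h1] at h
  rw [zero_smul] at h
  replace h := h.congr_of_eventuallyEq (Filter.Eventually.of_forall fun s =>
    (sliceCoeff_translate u t (s • Pi.single i 1) ξ).symm)
  have h2 := (hasDerivAt_phase ξ i).mul_const (sliceCoeff u (t, 0) ξ)
  exact h.unique h2

theorem mode_iterate_dirDeriv (u : SmoothTorus N) (ξ : Fin N → ℤ) (i : Fin N) (k : ℕ) (t : ℝ) :
    mode ((dirDeriv (0, Pi.single i 1))^[k] u) ξ t = (Complex.I * ξ i) ^ k * mode u ξ t := by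
  induction k with
  | zero => simp
  | succ k ih => rw [Function.iterate_succ_apply', mode_dirDeriv, ih, pow_succ]; ring

/-- Rapid decay of a family of functions on the circle, with all derivatives. -/
def RapidDecay (g : (Fin N → ℤ) → ℝ → ℂ) : Prop :=
  ∀ j k : ℕ, ∃ C : ℝ, ∀ (ξ : Fin N → ℤ) (t : ℝ),
    ‖iteratedDeriv j (g ξ) t‖ * (1 + freqNorm ξ) ^ k ≤ C

/-- Differentiating `k` times along a coordinate where `|ξ i|` is largest multiplies the coefficient
by `(i ξ i)^k`, and that coordinate is comparable to `|ξ|`. The separate term `derivSeminorm N 0 u`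
takes care of `ξ = 0`. -/
theorem mode_decay (u : SmoothTorus N) (k : ℕ) :
    ∃ C : ℝ, ∀ (ξ : Fin N → ℤ) (t : ℝ), ‖mode u ξ t‖ * (1 + freqNorm ξ) ^ k ≤ C := by
  refine ⟨derivSeminorm N 0 u + ∑ i, (2 * N) ^ k *
    derivSeminorm N 0 ((dirDeriv (0, Pi.single i 1))^[k] u), fun ξ t => ?_⟩
  have hpos : ∀ i ∈ Finset.univ, 0 ≤ (2 * (N : ℝ)) ^ k *
    derivSeminorm N 0 ((dirDeriv (0, Pi.single i 1))^[k] u) := fun i _ => by positivity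
  rcases (freqNorm_nonneg ξ).eq_or_lt with h0 | h0
  · rw [← h0, add_zero, one_pow, mul_one]
    exact (norm_mode_le u ξ t).trans (le_add_of_nonneg_right (Finset.sum_nonneg hpos))
  have h1 := one_le_freqNorm h0
  have hne : (Finset.univ : Finset (Fin N)).Nonempty := by
    by_contra hne
    rw [Finset.not_nonempty_iff_eq_empty] at hne
    simp [freqNorm, hne] at h0
  obtain ⟨i, -, hi⟩ := Finset.exists_max_image Finset.univ (fun i => |(ξ i : ℝ)|) hne
  have h2 : freqNorm ξ ≤ N * |(ξ i : ℝ)| := by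
    refine (freqNorm_le_sum_abs ξ).trans ((Finset.sum_le_sum hi).trans ?_)
    simp
  have h3 : ‖mode u ξ t‖ * (1 + freqNorm ξ) ^ k ≤ (2 * (N : ℝ)) ^ k *
      derivSeminorm N 0 ((dirDeriv (0, Pi.single i 1))^[k] u) := by
    have h4 := norm_mode_le ((dirDeriv (0, Pi.single i 1))^[k] u) ξ t
    rw [mode_iterate_dirDeriv, norm_mul, norm_pow, norm_mul, Complex.norm_I, one_mul] at h4
    have h5 : ‖(ξ i : ℂ)‖ = |(ξ i : ℝ)| := Complex.norm_intCast _
    rw [h5] at h4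
    calc ‖mode u ξ t‖ * (1 + freqNorm ξ) ^ k ≤ ‖mode u ξ t‖ * (2 * N * |(ξ i : ℝ)|) ^ k := by
          have : 1 + freqNorm ξ ≤ 2 * N * |(ξ i : ℝ)| := by linarith
          have := one_add_freqNorm_pos ξ
          gcongr
      _ = (2 * N) ^ k * (|(ξ i : ℝ)| ^ k * ‖mode u ξ t‖) := by rw [mul_pow]; ring
      _ ≤ _ := by gcongr
  refine h3.trans ((Finset.single_le_sum hpos (Finset.mem_univ i)).trans ?_)
  exact le_add_of_nonneg_left (apply_nonneg _ _)

theorem rapidDecay_mode (u : SmoothTorus N) : RapidDecay (mode u) := fun j k => by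
  obtain ⟨C, hC⟩ := mode_decay ((dirDeriv (1, 0))^[j] u) k
  exact ⟨C, fun ξ t => by rw [iteratedDeriv_mode]; exact hC ξ t⟩

theorem summable_of_mul_pow_le {g : (Fin N → ℤ) → ℝ} (h0 : ∀ ξ, 0 ≤ g ξ) {C : ℝ}
    (h : ∀ ξ, g ξ * (1 + freqNorm ξ) ^ (2 * N) ≤ C) : Summable g := by
  refine ((summable_one_add_freqNorm N).mul_left C).of_nonneg_of_le h0 fun ξ => ?_
  rw [← div_eq_mul_inv, le_div_iff₀ (pow_pos (one_add_freqNorm_pos ξ) _)]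
  exact h ξ

theorem hasSum_mode (u : SmoothTorus N) (t : ℝ) (x : Fin N → ℝ) :
    HasSum (fun ξ => mode u ξ t * phase ξ x) (u (t, x)) := by
  have hs : Summable (UnitAddTorus.mFourierCoeff (slice u (t, 0))) := by
    obtain ⟨C, hC⟩ := mode_decay u (2 * N)
    exact Summable.of_norm (summable_of_mul_pow_le (fun ξ => norm_nonneg _) fun ξ => hC ξ t)
  have h := UnitAddTorus.hasSum_mFourier_series_apply_of_summable hs
    (torusMk fun i => x i / (2 * Real.pi))
  have hx : (fun i => 2 * Real.pi * (x i / (2 * Real.pi))) = x := by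
    funext i
    field_simp
  simp only [slice_torusMk, mFourier_torusMk, smul_eq_mul, Pi.zero_apply, zero_add, hx] at h
  exact h

theorem eq_of_mode_eq {u v : SmoothTorus N} (h : ∀ ξ t, mode u ξ t = mode v ξ t) : u = v := by
  ext ⟨t, x⟩
  have h1 := hasSum_mode u t x
  simp only [h] at h1
  exact h1.unique (hasSum_mode v t x)

/-! ### Convergent series in the Fréchet space -/

/-- Summable seminorms allow the tail of the series to be differentiated term by term, so pointwise
convergence already forces convergence in the Fréchet topology. -/
theorem hasSum_of_summable_derivSeminorm {ι : Type*} {w : ι → SmoothTorus N}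
    (h : ∀ j, Summable fun i => derivSeminorm N j (w i)) {u : SmoothTorus N}
    (hu : ∀ p, HasSum (fun i => w i p) (u p)) : HasSum w u := by
  classical
  refine ((withSeminorms_smoothTorus N).tendsto_nhds _ _).2 fun j ε hε => ?_
  have h1 := tendsto_tsum_compl_atTop_zero fun i => derivSeminorm N j (w i)
  filter_upwards [h1.eventually (gt_mem_nhds hε)] with s hs
  refine lt_of_le_of_lt (derivSeminorm_le _ _ fun p => ?_) hs
  have h2 : ((∑ i ∈ s, w i - u : SmoothTorus N) : ℝ × (Fin N → ℝ) → ℂ) =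
      -(fun p => ∑' i : {x // x ∉ s}, w i p) := by
    funext p
    rw [SmoothTorus.sub_apply, SmoothTorus.sum_apply, Pi.neg_apply]
    have h3 := (hu p).summable.sum_add_tsum_compl (s := s)
    rw [(hu p).tsum_eq] at h3
    rw [← h3]
    have : ∑' i : ↑((s : Set ι)ᶜ), w i p = ∑' i : {x // x ∉ s}, w i p := rfl
    rw [← this]
    ring
  rw [h2, iteratedFDeriv_neg, Pi.neg_apply, norm_neg]
  rw [iteratedFDeriv_tsum_apply (N := ⊤) (v := fun k (i : {x // x ∉ s}) => derivSeminorm N k (w i))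
    (fun i => by simpa using (w i).contDiff) (fun k _ => (h k).subtype _)
    (fun k i x _ => norm_iteratedFDeriv_le (w i) k x) (by simp)]
  exact tsum_of_norm_bounded ((h j).subtype _).hasSum fun i => norm_iteratedFDeriv_le (w i) j p

theorem exists_hasSum_of_summable_derivSeminorm {ι : Type*} {w : ι → SmoothTorus N}
    (h : ∀ j, Summable fun i => derivSeminorm N j (w i)) : ∃ u, HasSum w u := by
  have h0 : ∀ p, Summable fun i => w i p := fun p =>
    Summable.of_norm_bounded (h 0) fun i => norm_le_derivSeminorm_zero _ _
  let u : SmoothTorus N := ⟨fun p => ∑' i, w i p, by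
    refine ⟨?_, fun k n t x => tsum_congr fun i => (w i).2.2 k n t x⟩
    have := contDiff_tsum (𝕜 := ℝ) (N := ⊤) (f := fun i => (w i : ℝ × (Fin N → ℝ) → ℂ))
      (v := fun k i => derivSeminorm N k (w i))
      (fun i => by simpa using (w i).contDiff) (fun k _ => h k)
      (fun k i x _ => norm_iteratedFDeriv_le (w i) k x)
    simpa using this⟩
  exact ⟨u, hasSum_of_summable_derivSeminorm h fun p => (h0 p).hasSum⟩

/-- A linear functional dominated by the supremum norm is continuous. -/
theorem continuous_of_norm_le (L : SmoothTorus N →ₗ[ℂ] ℂ)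
    (C : NNReal) (h : ∀ u, ‖L u‖ ≤ C * derivSeminorm N 0 u) : Continuous L := by
  refine WithSeminorms.continuous_normedSpace_rng ℂ (withSeminorms_smoothTorus N) L
    ⟨{0}, C, fun u => ?_⟩
  rw [Finset.sup_singleton]
  exact h u

/-- The evaluation at a point. -/
def evalCLM (p : ℝ × (Fin N → ℝ)) : SmoothTorus N →L[ℂ] ℂ :=
  ⟨⟨⟨fun u => u p, fun _ _ => rfl⟩, fun _ _ => rfl⟩,
    continuous_of_norm_le _ 1 fun u => by
      rw [NNReal.coe_one, one_mul]
      exact norm_le_derivSeminorm_zero u p⟩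

theorem evalCLM_apply (p : ℝ × (Fin N → ℝ)) (u : SmoothTorus N) : evalCLM p u = u p := rfl

/-- The partial Fourier coefficient as a continuous functional. -/
def modeCLM (ξ : Fin N → ℤ) (t : ℝ) : SmoothTorus N →L[ℂ] ℂ :=
  ⟨⟨⟨fun u => mode u ξ t, fun u v => mode_add u v ξ t⟩, fun a u => mode_smul a u ξ t⟩,
    continuous_of_norm_le _ 1 fun u => by
      rw [NNReal.coe_one, one_mul]
      exact norm_mode_le u ξ t⟩

theorem modeCLM_apply (ξ : Fin N → ℤ) (t : ℝ) (u : SmoothTorus N) :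
    modeCLM ξ t u = mode u ξ t := rfl

/-! ### Elementary tensors -/

theorem phase_add_period (ξ : Fin N → ℤ) (x : Fin N → ℝ) (n : Fin N → ℤ) :
    phase ξ (fun i => x i + 2 * Real.pi * n i) = phase ξ x := by
  refine Complex.exp_eq_exp_iff_exists_int.2 ⟨∑ i, n i * ξ i, ?_⟩
  push_cast
  simp only [add_mul, Finset.sum_add_distrib, mul_add, Finset.mul_sum, Finset.sum_mul]
  congr 1
  exact Finset.sum_congr rfl fun i _ => by ring

/-- The linear form `(t, x) ↦ x · ξ`. -/
def phaseForm (ξ : Fin N → ℤ) : ℝ × (Fin N → ℝ) →L[ℝ] ℝ :=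
  ∑ i, (ξ i : ℝ) • (ContinuousLinearMap.proj i).comp (ContinuousLinearMap.snd ℝ ℝ (Fin N → ℝ))

theorem phaseForm_apply (ξ : Fin N → ℤ) (p : ℝ × (Fin N → ℝ)) :
    phaseForm ξ p = ∑ i, p.2 i * ξ i := by
  simp [phaseForm, mul_comm]

theorem norm_phaseForm_le (ξ : Fin N → ℤ) : ‖phaseForm ξ‖ ≤ N * (1 + freqNorm ξ) := by
  have := one_add_freqNorm_pos ξ
  refine ContinuousLinearMap.opNorm_le_bound _ (by positivity) fun p => ?_
  rw [phaseForm_apply]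
  refine (norm_sum_le _ _).trans ?_
  calc ∑ i, ‖p.2 i * ξ i‖ ≤ ∑ _i : Fin N, (1 + freqNorm ξ) * ‖p‖ := by
        refine Finset.sum_le_sum fun i _ => ?_
        rw [norm_mul, mul_comm]
        have h1 : ‖(ξ i : ℝ)‖ ≤ 1 + freqNorm ξ := (abs_le_freqNorm ξ i).trans (by linarith)
        have h2 : ‖p.2 i‖ ≤ ‖p‖ := (norm_le_pi_norm p.2 i).trans (norm_snd_le p)
        gcongr
    _ = _ := by simp [mul_assoc]

theorem phase_eq (ξ : Fin N → ℤ) : (fun p : ℝ × (Fin N → ℝ) => phase ξ p.2) =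
    (fun s : ℝ => Complex.exp (Complex.I * s)) ∘ phaseForm ξ := by
  funext p
  simp only [phase, Function.comp, phaseForm_apply]

theorem contDiff_cexp_I : ContDiff ℝ ∞ fun s : ℝ => Complex.exp (Complex.I * s) :=
  (contDiff_const.mul Complex.ofRealCLM.contDiff).cexp

theorem contDiff_phase (ξ : Fin N → ℤ) :
    ContDiff ℝ ∞ fun p : ℝ × (Fin N → ℝ) => phase ξ p.2 := by
  rw [phase_eq]
  exact contDiff_cexp_I.comp (phaseForm ξ).contDiff

theorem hasDerivAt_cexp_mul (a : ℂ) (t : ℝ) :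
    HasDerivAt (fun s : ℝ => Complex.exp (a * s)) (a * Complex.exp (a * t)) t := by
  have h1 : HasDerivAt (fun s : ℝ => a * (s : ℂ)) (a * 1) t :=
    (Complex.ofRealCLM.hasDerivAt (x := t)).const_mul _
  have := h1.cexp
  rwa [mul_one, mul_comm] at this

theorem iteratedDeriv_cexp_mul (a : ℂ) (k : ℕ) :
    iteratedDeriv k (fun s : ℝ => Complex.exp (a * s)) =
      fun s : ℝ => a ^ k * Complex.exp (a * s) := by
  induction k with
  | zero => simp
  | succ k ih =>
    rw [iteratedDeriv_succ, ih]
    funext t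
    rw [((hasDerivAt_cexp_mul a t).const_mul (a ^ k)).deriv]
    ring

theorem norm_iteratedFDeriv_comp_clm_le {E : Type*} [NormedAddCommGroup E] [NormedSpace ℝ E]
    {g : ℝ → ℂ} (hg : ContDiff ℝ ∞ g) (L : E →L[ℝ] ℝ) (i : ℕ) (p : E) :
    ‖iteratedFDeriv ℝ i (g ∘ L) p‖ ≤ ‖iteratedDeriv i g (L p)‖ * ‖L‖ ^ i := by
  rw [L.iteratedFDeriv_comp_right hg p (by exact_mod_cast le_top)]
  refine (ContinuousMultilinearMap.norm_compContinuousLinearMap_le _ _).trans ?_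
  rw [norm_iteratedFDeriv_eq_norm_iteratedDeriv]
  simp

/-- The function `g(t) e^{i x · ξ}`. -/
def tensor {g : ℝ → ℂ} (hg : IsCirc g) (ξ : Fin N → ℤ) : SmoothTorus N :=
  ⟨fun p => g p.1 * phase ξ p.2, (hg.contDiff.comp contDiff_fst).mul (contDiff_phase ξ),
    fun k n t x => by
      simp only [phase_add_period]
      rw [show t + 2 * Real.pi * k = t + k * (2 * Real.pi) by ring, hg.periodic.int_mul k]⟩

theorem tensor_apply {g : ℝ → ℂ} (hg : IsCirc g) (ξ : Fin N → ℤ) (p : ℝ × (Fin N → ℝ)) :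
    tensor hg ξ p = g p.1 * phase ξ p.2 := rfl

theorem derivSeminorm_tensor_le {g : ℝ → ℂ} (hg : IsCirc g) (ξ : Fin N → ℤ) {j : ℕ} {A : ℝ}
    (hA : ∀ i ≤ j, ∀ t, ‖iteratedDeriv i g t‖ ≤ A) :
    derivSeminorm N j (tensor hg ξ) ≤ 2 ^ j * A * ((N + 1) * (1 + freqNorm ξ)) ^ j := by
  have hA0 : 0 ≤ A := (norm_nonneg _).trans (hA 0 (Nat.zero_le _) 0)
  have hξ := one_le_one_add_freqNorm ξ
  refine derivSeminorm_le _ _ fun p => ?_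
  refine (norm_iteratedFDeriv_mul_le (hg.contDiff.comp contDiff_fst) (contDiff_phase ξ) p
    (n := j) (by exact_mod_cast le_top)).trans ?_
  have h2 : (2 : ℝ) ^ j = ∑ i ∈ Finset.range (j + 1), (j.choose i : ℝ) := by
    exact_mod_cast (Nat.sum_range_choose j).symm
  rw [h2, Finset.sum_mul, Finset.sum_mul]
  refine Finset.sum_le_sum fun i hi => ?_
  have hi : i ≤ j := Nat.lt_succ_iff.1 (Finset.mem_range.1 hi)
  have h3 : ‖iteratedFDeriv ℝ i (g ∘ (Prod.fst : ℝ × (Fin N → ℝ) → ℝ)) p‖ ≤ A := by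
    refine (norm_iteratedFDeriv_comp_clm_le hg.contDiff
      (ContinuousLinearMap.fst ℝ ℝ (Fin N → ℝ)) i p).trans ?_
    have h4 : ‖ContinuousLinearMap.fst ℝ ℝ (Fin N → ℝ)‖ ^ i ≤ 1 :=
      pow_le_one₀ (norm_nonneg _) (ContinuousLinearMap.norm_fst_le ℝ ℝ (Fin N → ℝ))
    calc _ ≤ A * 1 := by
          gcongr
          exact hA i hi _
      _ = A := mul_one A
  have h5 : ‖iteratedFDeriv ℝ (j - i) (fun p : ℝ × (Fin N → ℝ) => phase ξ p.2) p‖ ≤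
      ((N + 1) * (1 + freqNorm ξ)) ^ j := by
    rw [phase_eq]
    refine (norm_iteratedFDeriv_comp_clm_le contDiff_cexp_I _ _ p).trans ?_
    rw [iteratedDeriv_cexp_mul, norm_mul, norm_pow, Complex.norm_I, one_pow, one_mul, mul_comm
      Complex.I, Complex.norm_exp_ofReal_mul_I, one_mul]
    calc ‖phaseForm ξ‖ ^ (j - i) ≤ ((N + 1) * (1 + freqNorm ξ)) ^ (j - i) := by
          gcongr
          exact (norm_phaseForm_le ξ).trans (by gcongr; linarith)
      _ ≤ _ := pow_le_pow_right₀ (by nlinarith [(Nat.cast_nonneg N : (0 : ℝ) ≤ N)])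
          (Nat.sub_le _ _)
  exact mul_le_mul (mul_le_mul_of_nonneg_left h3 (by positivity)) h5 (norm_nonneg _)
    (by positivity)

theorem dirDeriv_tensor {g : ℝ → ℂ} (hg : IsCirc g) (ξ : Fin N → ℤ) (i : Fin N) :
    dirDeriv (0, Pi.single i 1) (tensor hg ξ) = (Complex.I * ξ i) • tensor hg ξ := by
  ext p
  have h1 : HasDerivAt (fun s : ℝ => tensor hg ξ (p + s • (0, Pi.single i 1)))
      (dirDeriv (0, Pi.single i 1) (tensor hg ξ) p) 0 := by
    have h2 : HasDerivAt (fun s : ℝ => p + s • ((0, Pi.single i 1) : ℝ × (Fin N → ℝ)))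
        (0, Pi.single i 1) 0 := by
      simpa using ((hasDerivAt_id (0 : ℝ)).smul_const
        ((0, Pi.single i 1) : ℝ × (Fin N → ℝ))).const_add p
    have h3 := ((tensor hg ξ).contDiff.differentiable (by simp)
      (p + (0 : ℝ) • (0, Pi.single i 1))).hasFDerivAt.comp_hasDerivAt 0 h2
    rw [zero_smul, add_zero] at h3
    exact h3
  have h4 : ∀ s : ℝ, tensor hg ξ (p + s • (0, Pi.single i 1)) =
      phase ξ (s • Pi.single i 1) * tensor hg ξ p := fun s => by
    have : phase ξ (p + s • (0, Pi.single i 1)).2 = phase ξ (s • Pi.single i 1) * phase ξ p.2 := by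
      unfold phase
      rw [← Complex.exp_add, ← mul_add, ← Complex.ofReal_add, ← Finset.sum_add_distrib]
      congr 3
      refine Finset.sum_congr rfl fun k _ => ?_
      simp only [Prod.snd_add, Prod.smul_snd, Pi.add_apply]
      ring
    rw [tensor_apply, tensor_apply, this]
    simp
    ring
  exact h1.unique (((hasDerivAt_phase ξ i).mul_const (tensor hg ξ p)).congr_of_eventuallyEq
    (Filter.Eventually.of_forall h4))

theorem mode_tensor_self {g : ℝ → ℂ} (hg : IsCirc g) (ξ : Fin N → ℤ) (t : ℝ) :
    mode (tensor hg ξ) ξ t = g t := by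
  have : mode (tensor hg ξ) ξ t = ∫ _y, g t ∂torusMeasure N := by
    refine integral_congr_ae (Filter.Eventually.of_forall fun y => ?_)
    obtain ⟨x, rfl⟩ := exists_torusMk y
    simp only [slice_torusMk, mFourier_torusMk, tensor_apply]
    rw [mul_left_comm, phase, phase, ← Complex.exp_add, ← mul_add, ← Complex.ofReal_add,
      ← Finset.sum_add_distrib]
    simp
  simpa using this

/-- Orthogonality by eigenvalues: `∂/∂x_i` multiplies the tensor by `i ξ i` but its `η`-mode by `i η
i`, and these differ for some `i`. -/
theorem mode_tensor_of_ne {g : ℝ → ℂ} (hg : IsCirc g) {ξ η : Fin N → ℤ} (h : ξ ≠ η) (t : ℝ) :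
    mode (tensor hg ξ) η t = 0 := by
  obtain ⟨i, hi⟩ := Function.ne_iff.1 h
  have h1 := mode_dirDeriv (tensor hg ξ) η i t
  rw [dirDeriv_tensor, mode_smul] at h1
  have h2 : (Complex.I * ((ξ i : ℂ) - η i)) * mode (tensor hg ξ) η t = 0 := by linear_combination h1
  refine (mul_eq_zero.1 h2).resolve_left (mul_ne_zero Complex.I_ne_zero (sub_ne_zero.2 ?_))
  exact_mod_cast hi

/-! ### Synthesis -/

theorem IsCirc.exists_bound {g : ℝ → ℂ} (hg : IsCirc g) (j : ℕ) :
    ∃ A, ∀ t, ‖iteratedDeriv j g t‖ ≤ A := by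
  obtain ⟨A, hA⟩ := (isCompact_Icc (a := (0 : ℝ)) (b := 2 * Real.pi)).exists_bound_of_continuousOn
    (hg.contDiff.continuous_iteratedDeriv j (by exact_mod_cast le_top)).continuousOn
  refine ⟨A, fun t => ?_⟩
  have hp : Function.Periodic (iteratedDeriv j g) (2 * Real.pi) := fun s => by
    have := congrFun (iteratedDeriv_comp_add_const j g (2 * Real.pi)) s
    rw [← this]
    congr 1
    funext z
    exact hg.periodic z
  obtain ⟨s, hs, hst⟩ := hp.exists_mem_Ico₀ Real.two_pi_pos t
  rw [hst]
  exact hA s ⟨hs.1, hs.2.le⟩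

theorem rapidDecay_of_tail {g : (Fin N → ℤ) → ℝ → ℂ} (hg : ∀ ξ, IsCirc (g ξ))
    (h : ∀ j k : ℕ, ∃ C R : ℝ, ∀ (ξ : Fin N → ℤ), R ≤ freqNorm ξ → ∀ t,
      ‖iteratedDeriv j (g ξ) t‖ * (1 + freqNorm ξ) ^ k ≤ C) : RapidDecay g := by
  intro j k
  obtain ⟨C, R, hC⟩ := h j k
  choose A hA using fun ξ => (hg ξ).exists_bound j
  obtain ⟨C', hC'⟩ := ((finite_freqNorm_le (N := N) R).image
    fun ξ => A ξ * (1 + freqNorm ξ) ^ k).bddAbove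
  refine ⟨max C C', fun ξ t => ?_⟩
  rcases le_total R (freqNorm ξ) with hR | hR
  · exact (hC ξ hR t).trans (le_max_left _ _)
  · refine le_trans ?_ ((hC' ⟨ξ, hR, rfl⟩).trans (le_max_right _ _))
    have := one_add_freqNorm_pos ξ
    exact mul_le_mul_of_nonneg_right (hA ξ t) (by positivity)

theorem exists_forall_le_bound {g : (Fin N → ℤ) → ℝ → ℂ} (hd : RapidDecay g) (j k : ℕ) :
    ∃ C : ℝ, ∀ i ≤ j, ∀ ξ t, ‖iteratedDeriv i (g ξ) t‖ * (1 + freqNorm ξ) ^ k ≤ C := by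
  choose C hC using fun i => hd i k
  refine ⟨∑ i ∈ Finset.range (j + 1), |C i|, fun i hi ξ t => ?_⟩
  refine (hC i ξ t).trans ((le_abs_self _).trans ?_)
  exact Finset.single_le_sum (f := fun i => |C i|) (fun i _ => abs_nonneg _)
    (Finset.mem_range.2 (Nat.lt_succ_of_le hi))

theorem summable_derivSeminorm_tensor {g : (Fin N → ℤ) → ℝ → ℂ} (hg : ∀ ξ, IsCirc (g ξ))
    (hd : RapidDecay g) (j : ℕ) : Summable fun ξ => derivSeminorm N j (tensor (hg ξ) ξ) := by
  obtain ⟨C, hC⟩ := exists_forall_le_bound hd j (j + 2 * N)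
  refine summable_of_mul_pow_le (fun ξ => apply_nonneg _ _)
    (C := 2 ^ j * C * (N + 1) ^ j) fun ξ => ?_
  have hpos := one_add_freqNorm_pos ξ
  have h1 := derivSeminorm_tensor_le (hg ξ) ξ (j := j)
    (A := C / (1 + freqNorm ξ) ^ (j + 2 * N)) fun i hi t => by
      rw [le_div_iff₀ (by positivity)]
      exact hC i hi ξ t
  calc _ ≤ 2 ^ j * (C / (1 + freqNorm ξ) ^ (j + 2 * N)) * ((N + 1) * (1 + freqNorm ξ)) ^ j *
        (1 + freqNorm ξ) ^ (2 * N) := by gcongr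
    _ = _ := by
      rw [mul_pow, pow_add]
      field_simp

/-- Converse of `rapidDecay_mode`. The convergence in the Fréchet topology is kept because
continuous operators and closed sets are applied to the partial sums later. -/
theorem exists_mode_eq {g : (Fin N → ℤ) → ℝ → ℂ} (hg : ∀ ξ, IsCirc (g ξ))
    (hd : RapidDecay g) : ∃ u : SmoothTorus N, HasSum (fun ξ => tensor (hg ξ) ξ) u ∧
      ∀ ξ t, mode u ξ t = g ξ t := by
  obtain ⟨u, hu⟩ := exists_hasSum_of_summable_derivSeminorm (summable_derivSeminorm_tensor hg hd)
  refine ⟨u, hu, fun ξ t => ?_⟩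
  have h1 := (modeCLM ξ t).hasSum hu
  simp only [modeCLM_apply] at h1
  refine h1.unique ?_
  convert hasSum_single ξ (f := fun η => mode (tensor (hg η) η) ξ t)
    (fun η hη => mode_tensor_of_ne (hg η) hη t) using 1
  exact (mode_tensor_self (hg ξ) ξ t).symm

theorem hasSum_tensor_mode (u : SmoothTorus N) :
    HasSum (fun ξ => tensor (isCirc_mode u ξ) ξ) u := by
  obtain ⟨v, hv, hm⟩ := exists_mode_eq (isCirc_mode u) (rapidDecay_mode u)
  rwa [eq_of_mode_eq hm] at hv

/-! ### Fourier series on the circle -/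

theorem isCirc_cexp (τ : ℤ) : IsCirc fun t => Complex.exp (Complex.I * τ * t) := by
  refine ⟨(contDiff_const.mul Complex.ofRealCLM.contDiff).cexp, fun t => ?_⟩
  refine Complex.exp_eq_exp_iff_exists_int.2 ⟨τ, ?_⟩
  push_cast
  ring

theorem expo_eq_tensor (τ : ℤ) (ξ : Fin N → ℤ) : expo τ ξ = tensor (isCirc_cexp τ) ξ := by
  ext p
  change Complex.exp _ = Complex.exp _ * Complex.exp _
  rw [← Complex.exp_add]
  congr 1
  push_cast
  ring

theorem derivSeminorm_expo_le (τ : ℤ) (ξ : Fin N → ℤ) (j : ℕ) :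
    derivSeminorm N j (expo τ ξ) ≤
      2 ^ j * (1 + |(τ : ℝ)|) ^ j * ((N + 1) * (1 + freqNorm ξ)) ^ j := by
  rw [expo_eq_tensor]
  refine derivSeminorm_tensor_le _ _ fun i hi t => ?_
  rw [iteratedDeriv_cexp_mul, norm_mul, norm_pow, norm_mul, Complex.norm_I, one_mul,
    show Complex.I * τ * t = ((τ * t : ℝ) : ℂ) * Complex.I by push_cast; ring,
    Complex.norm_exp_ofReal_mul_I, mul_one, Complex.norm_intCast]
  calc |(τ : ℝ)| ^ i ≤ (1 + |(τ : ℝ)|) ^ i := by gcongr; linarith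
    _ ≤ _ := pow_le_pow_right₀ (by linarith [abs_nonneg (τ : ℝ)]) hi

/-- A periodic function, viewed as a function of `x` on the torus of dimension `1 + 1`. -/
def liftX {g : ℝ → ℂ} (hg : IsCirc g) : SmoothTorus 1 :=
  ⟨fun p => g (p.2 0), hg.contDiff.comp ((contDiff_apply ℝ ℝ (0 : Fin 1)).comp contDiff_snd),
    fun k n t x => by
      simp only
      rw [show x 0 + 2 * Real.pi * n 0 = x 0 + n 0 * (2 * Real.pi) by ring,
        hg.periodic.int_mul (n 0)]⟩

/-- The symbol describes `Q` on exponentials only. Expanding `g` in a Fourier series that converges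
in the Fréchet space lets continuity carry the formula over to tensors. The series is that of `liftX
hg`, so the decay already proved for modes is reused in dimension one. -/
theorem exists_hasSum_expo {g : ℝ → ℂ} (hg : IsCirc g) (ξ : Fin N → ℤ) :
    ∃ a : (Fin 1 → ℤ) → ℂ, HasSum (fun n => a n • expo (n 0) ξ) (tensor hg ξ) := by
  refine ⟨fun n => mode (liftX hg) n 0, hasSum_of_summable_derivSeminorm (fun j => ?_) fun p => ?_⟩
  · obtain ⟨C, hC⟩ := mode_decay (liftX hg) (j + 2)
    refine summable_of_mul_pow_le (fun ξ => apply_nonneg _ _)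
      (C := 2 ^ j * C * ((N + 1) * (1 + freqNorm ξ)) ^ j) fun n => ?_
    rw [map_smul_eq_mul]
    have h1 := derivSeminorm_expo_le (n 0) ξ j
    have h2 := abs_le_freqNorm n 0
    have h3 := one_add_freqNorm_pos n
    have h4 := one_add_freqNorm_pos ξ
    calc _ ≤ ‖mode (liftX hg) n 0‖ * (2 ^ j * (1 + freqNorm n) ^ j *
          ((N + 1) * (1 + freqNorm ξ)) ^ j) * (1 + freqNorm n) ^ (2 * 1) := by
          refine mul_le_mul_of_nonneg_right (mul_le_mul_of_nonneg_left (h1.trans ?_)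
            (norm_nonneg _)) (by positivity)
          gcongr
      _ = 2 ^ j * (‖mode (liftX hg) n 0‖ * (1 + freqNorm n) ^ (j + 2)) *
          ((N + 1) * (1 + freqNorm ξ)) ^ j := by ring
      _ ≤ _ := by
          gcongr
          exact hC n 0
  · have h := (hasSum_mode (liftX hg) 0 (fun _ => p.1)).mul_right (phase ξ p.2)
    refine (h.congr_fun fun n => ?_)
    change mode (liftX hg) n 0 * expo (n 0) ξ p = _
    rw [expo_eq_tensor, tensor_apply, ← mul_assoc]
    congr 2
    simp only [phase, Fin.sum_univ_one]
    congr 1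
    push_cast
    ring

/-! ### The action of tube-type operators -/

variable {m : ℝ} {Q : SmoothTorus N →L[ℂ] SmoothTorus N} {c : ℝ → (Fin N → ℤ) → ℂ}

theorem IsTubeType.apply_expo (hQ : IsTubeType Q c m) (τ : ℤ) (ξ : Fin N → ℤ)
    (p : ℝ × (Fin N → ℝ)) : Q (expo τ ξ) p = c p.1 ξ * expo τ ξ p := by
  rw [← hQ.symbol_eq p τ ξ, discreteSymbol, mul_right_comm]
  change _ = Complex.exp _ * Complex.exp _ * _
  rw [← Complex.exp_add]
  simp

theorem IsTubeType.isCirc (hQ : IsTubeType Q c m) (ξ : Fin N → ℤ) : IsCirc fun t => c t ξ := by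
  have h : (fun t => c t ξ) = fun t => Q (expo 0 ξ) (t, 0) := by
    funext t
    rw [hQ.apply_expo 0 ξ (t, 0), expo_eq_tensor, tensor_apply]
    simp [phase]
  rw [h]
  refine ⟨(Q (expo 0 ξ)).contDiff.comp (contDiff_id.prodMk contDiff_const), fun t => ?_⟩
  have := (Q (expo 0 ξ)).2.2 1 0 t 0
  simpa using! this

theorem IsCirc.mul {f g : ℝ → ℂ} (hf : IsCirc f) (hg : IsCirc g) : IsCirc fun t => f t * g t :=
  ⟨hf.contDiff.mul hg.contDiff, hf.periodic.mul hg.periodic⟩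

theorem IsTubeType.apply_tensor (hQ : IsTubeType Q c m) {g : ℝ → ℂ} (hg : IsCirc g)
    (ξ : Fin N → ℤ) : Q (tensor hg ξ) = tensor ((hQ.isCirc ξ).mul hg) ξ := by
  obtain ⟨a, ha⟩ := exists_hasSum_expo hg ξ
  ext p
  have h1 := (evalCLM p).hasSum (Q.hasSum ha)
  have h2 := ((evalCLM p).hasSum ha).mul_left (c p.1 ξ)
  simp only [map_smul, evalCLM_apply, hQ.apply_expo, smul_eq_mul] at h1 h2
  have h3 := h1.unique (h2.congr_fun fun n => by ring)
  rw [h3, tensor_apply, tensor_apply]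
  ring

theorem IsTubeType.mode_apply (hQ : IsTubeType Q c m) (u : SmoothTorus N) (ξ : Fin N → ℤ)
    (t : ℝ) : mode (Q u) ξ t = c t ξ * mode u ξ t := by
  have h1 := (modeCLM ξ t).hasSum (Q.hasSum (hasSum_tensor_mode u))
  simp only [modeCLM_apply, hQ.apply_tensor] at h1
  refine h1.unique ?_
  convert hasSum_single ξ (f := fun η => mode (tensor ((hQ.isCirc η).mul (isCirc_mode u η)) η) ξ t)
    (fun η hη => mode_tensor_of_ne _ hη t) using 1
  exact (mode_tensor_self ((hQ.isCirc ξ).mul (isCirc_mode u ξ)) ξ t).symm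

theorem IsTubeType.mode_opP (hQ : IsTubeType Q c m) (u : SmoothTorus N) (ξ : Fin N → ℤ) (t : ℝ) :
    mode (opP Q u) ξ t = -Complex.I * deriv (mode u ξ) t + c t ξ * mode u ξ t := by
  change mode (Dt N u + Q u) ξ t = _
  rw [mode_add, hQ.mode_apply, Dt_eq, mode_smul, (hasDerivAt_mode u ξ t).deriv]

/-! ### The ordinary differential equation on the circle -/

/-- `v` is a smooth periodic solution of `D_t v + a v = g`. -/
structure Solves (a v g : ℝ → ℂ) : Prop where
  isCirc : IsCirc v
  hasDerivAt : ∀ t, HasDerivAt v (Complex.I * (g t - a t * v t)) t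

/-- The primitive of `a` that vanishes at the origin. -/
def prim (a : ℝ → ℂ) (t : ℝ) : ℂ := ∫ s in (0 : ℝ)..t, a s

/-- The integrating factor of `D_t + a`. -/
def intFactor (a : ℝ → ℂ) (t : ℝ) : ℂ := Complex.exp (Complex.I * prim a t)

/-- The mean value of `a` over a period. -/
def circMean (a : ℝ → ℂ) : ℂ := (2 * (Real.pi : ℂ))⁻¹ * prim a (2 * Real.pi)

/-- The monodromy factor of `D_t + a`. -/
def monodromy (a : ℝ → ℂ) : ℂ := Complex.exp (2 * Real.pi * Complex.I * circMean a)

theorem monodromy_ne_zero (a : ℝ → ℂ) : monodromy a ≠ 0 := Complex.exp_ne_zero _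

theorem hasDerivAt_prim {a : ℝ → ℂ} (ha : Continuous a) (t : ℝ) : HasDerivAt (prim a) (a t) t :=
  intervalIntegral.integral_hasDerivAt_right (ha.intervalIntegrable _ _)
    ha.aestronglyMeasurable.stronglyMeasurableAtFilter ha.continuousAt

theorem contDiff_prim {a : ℝ → ℂ} (ha : ContDiff ℝ ∞ a) : ContDiff ℝ ∞ (prim a) := by
  have h : deriv (prim a) = a := funext fun t => (hasDerivAt_prim ha.continuous t).deriv
  rw [contDiff_infty_iff_deriv, h]
  exact ⟨fun t => (hasDerivAt_prim ha.continuous t).differentiableAt, ha⟩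

theorem prim_sub {a : ℝ → ℂ} (ha : Continuous a) (s t : ℝ) :
    prim a t - prim a s = ∫ x in s..t, a x := by
  unfold prim
  rw [intervalIntegral.integral_interval_sub_left (ha.intervalIntegrable _ _)
    (ha.intervalIntegrable _ _)]

theorem prim_two_pi (a : ℝ → ℂ) : prim a (2 * Real.pi) = 2 * Real.pi * circMean a := by
  have : (Real.pi : ℂ) ≠ 0 := by exact_mod_cast Real.pi_ne_zero
  rw [circMean]
  field_simp

theorem prim_add_two_pi {a : ℝ → ℂ} (ha : IsCirc a) (t : ℝ) :
    prim a (t + 2 * Real.pi) = prim a t + 2 * Real.pi * circMean a := by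
  rw [← sub_eq_iff_eq_add', prim_sub ha.contDiff.continuous,
    ha.periodic.intervalIntegral_add_eq t 0, zero_add, ← prim_two_pi]
  rfl

theorem contDiff_intFactor {a : ℝ → ℂ} (ha : ContDiff ℝ ∞ a) : ContDiff ℝ ∞ (intFactor a) :=
  (contDiff_const.mul (contDiff_prim ha)).cexp

theorem intFactor_ne_zero (a : ℝ → ℂ) (t : ℝ) : intFactor a t ≠ 0 := Complex.exp_ne_zero _

theorem hasDerivAt_intFactor {a : ℝ → ℂ} (ha : Continuous a) (t : ℝ) :
    HasDerivAt (intFactor a) (Complex.I * a t * intFactor a t) t := by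
  have := ((hasDerivAt_prim ha t).const_mul Complex.I).cexp
  rwa [mul_comm] at this

theorem intFactor_add_two_pi {a : ℝ → ℂ} (ha : IsCirc a) (t : ℝ) :
    intFactor a (t + 2 * Real.pi) = monodromy a * intFactor a t := by
  rw [intFactor, intFactor, monodromy, ← Complex.exp_add, prim_add_two_pi ha]
  ring_nf

theorem norm_intFactor (a : ℝ → ℂ) (t : ℝ) : ‖intFactor a t‖ = Real.exp (-(prim a t).im) := by
  simp [intFactor, Complex.norm_exp]

theorem sub_eq_prim_im {a : ℝ → ℂ} (ha : Continuous a) {b : ℝ → ℝ}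
    (hb : ∀ t, HasDerivAt b (a t).im t) (s t : ℝ) :
    b t - b s = (prim a t).im - (prim a s).im := by
  have h : ∀ t, HasDerivAt (fun t => b t - (prim a t).im) 0 t := fun t => by
    have h1 : HasDerivAt (fun t => (prim a t).im) (a t).im t :=
      (Complex.imCLM.hasFDerivAt.comp_hasDerivAt t (hasDerivAt_prim ha t))
    exact ((hb t).sub h1).congr_deriv (sub_self _)
  have := is_const_of_deriv_eq_zero (fun t => (h t).differentiableAt) (fun t => (h t).deriv) t s
  linarith

theorem norm_inv_intFactor_mul {a : ℝ → ℂ} (ha : Continuous a) {b : ℝ → ℝ}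
    (hb : ∀ t, HasDerivAt b (a t).im t) (s t : ℝ) :
    ‖(intFactor a t)⁻¹ * intFactor a s‖ = Real.exp (b t - b s) := by
  rw [norm_mul, norm_inv, norm_intFactor, norm_intFactor, ← Real.exp_neg, ← Real.exp_add]
  congr 1
  linarith [sub_eq_prim_im ha hb s t]

/-- Variation of constants. -/
theorem Solves.intFactor_sub {a v g : ℝ → ℂ} (h : Solves a v g) (ha : Continuous a)
    (hg : Continuous g) (s t : ℝ) : intFactor a t * v t - intFactor a s * v s =
      Complex.I * ∫ x in s..t, intFactor a x * g x := by
  have hE : Continuous (intFactor a) :=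
    continuous_iff_continuousAt.2 fun t => (hasDerivAt_intFactor ha t).continuousAt
  rw [← intervalIntegral.integral_const_mul]
  refine (intervalIntegral.integral_eq_sub_of_hasDerivAt (f := fun x => intFactor a x * v x)
    (fun x _ => ?_) (Continuous.intervalIntegrable (by fun_prop) _ _)).symm
  exact ((hasDerivAt_intFactor ha x).mul (h.hasDerivAt x)).congr_deriv (by ring)

/-- Over one period `v` returns to its value while the integrating factor is multiplied by the
monodromy, which leaves the factor `monodromy a - 1`. The backward version leaves `1 - (monodromy
a)⁻¹`; having both allows the better of the two kernels to be used. -/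
theorem Solves.eq_integral_forward {a v g : ℝ → ℂ} (h : Solves a v g) (ha : IsCirc a)
    (hg : IsCirc g) (t : ℝ) : (monodromy a - 1) * v t =
      Complex.I * ∫ x in t..t + 2 * Real.pi, (intFactor a t)⁻¹ * intFactor a x * g x := by
  have h1 := h.intFactor_sub ha.contDiff.continuous hg.contDiff.continuous t (t + 2 * Real.pi)
  rw [intFactor_add_two_pi ha, h.isCirc.periodic t] at h1
  simp only [mul_assoc, intervalIntegral.integral_const_mul]
  have h0 := intFactor_ne_zero a t
  rw [mul_left_comm, ← h1]
  field_simp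

theorem Solves.eq_integral_backward {a v g : ℝ → ℂ} (h : Solves a v g) (ha : IsCirc a)
    (hg : IsCirc g) (t : ℝ) : (1 - (monodromy a)⁻¹) * v t =
      Complex.I * ∫ x in t - 2 * Real.pi..t, (intFactor a t)⁻¹ * intFactor a x * g x := by
  have h1 := h.intFactor_sub ha.contDiff.continuous hg.contDiff.continuous (t - 2 * Real.pi) t
  have h2 : intFactor a (t - 2 * Real.pi) = (monodromy a)⁻¹ * intFactor a t := by
    have := intFactor_add_two_pi ha (t - 2 * Real.pi)
    rw [sub_add_cancel] at this
    rw [this, inv_mul_cancel_left₀ (monodromy_ne_zero a)]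
  rw [h2, h.isCirc.periodic.sub_eq t] at h1
  simp only [mul_assoc, intervalIntegral.integral_const_mul]
  have h0 := intFactor_ne_zero a t
  rw [mul_left_comm, ← h1]
  field_simp

theorem hasDerivAt_inv_intFactor {a : ℝ → ℂ} (ha : Continuous a) (t : ℝ) :
    HasDerivAt (fun t => (intFactor a t)⁻¹) (-(Complex.I * a t) * (intFactor a t)⁻¹) t := by
  have h0 := intFactor_ne_zero a t
  exact ((hasDerivAt_intFactor ha t).inv h0).congr_deriv (by field_simp)

theorem hasDerivAt_inv_intFactor_mul {a g G : ℝ → ℂ} (ha : Continuous a)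
    {κ : ℂ} (hκ : ∀ t, HasDerivAt G (κ * (intFactor a t * g t)) t) (t : ℝ) :
    HasDerivAt (fun t => (intFactor a t)⁻¹ * G t)
      (κ * g t - Complex.I * a t * ((intFactor a t)⁻¹ * G t)) t := by
  have h0 := intFactor_ne_zero a t
  exact ((hasDerivAt_inv_intFactor ha t).mul (hκ t)).congr_deriv (by field_simp; ring)

theorem exists_solves_of_monodromy_ne_one {a g : ℝ → ℂ} (ha : IsCirc a) (hg : IsCirc g)
    (h : monodromy a ≠ 1) : ∃ v, Solves a v g := by
  have h0 : monodromy a - 1 ≠ 0 := sub_ne_zero.2 h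
  have hE := contDiff_intFactor ha.contDiff
  have hEg : ContDiff ℝ ∞ fun x => intFactor a x * g x := hE.mul hg.contDiff
  set F := prim fun x => intFactor a x * g x with hF
  have hFs : ContDiff ℝ ∞ F := contDiff_prim hEg
  have hFd := hasDerivAt_prim hEg.continuous
  -- This is the right-hand side of the forward formula without `(intFactor a t)⁻¹`. It has
  -- derivative `i E g` and is multiplied by the monodromy after a period, just like `E`, so the
  -- quotient is periodic.
  let G : ℝ → ℂ := fun t => (monodromy a - 1)⁻¹ * Complex.I * (F (t + 2 * Real.pi) - F t)
  have hGs : ContDiff ℝ ∞ G :=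
    contDiff_const.mul ((hFs.comp (contDiff_id.add contDiff_const)).sub hFs)
  have hGd : ∀ t, HasDerivAt G (Complex.I * (intFactor a t * g t)) t := fun t => by
    have h1 := (((hFd (t + 2 * Real.pi)).comp_add_const t _).sub (hFd t)).const_mul
      ((monodromy a - 1)⁻¹ * Complex.I)
    refine h1.congr_deriv ?_
    rw [intFactor_add_two_pi ha, hg.periodic t]
    field_simp
  have hGp : ∀ t, G (t + 2 * Real.pi) = monodromy a * G t := fun t => by
    have h1 : F (t + 2 * Real.pi + 2 * Real.pi) - F (t + 2 * Real.pi) =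
        monodromy a * (F (t + 2 * Real.pi) - F t) := by
      rw [prim_sub hEg.continuous, prim_sub hEg.continuous,
        ← intervalIntegral.integral_const_mul,
        ← intervalIntegral.integral_comp_add_right (a := t) (b := t + 2 * Real.pi)
          (fun x => intFactor a x * g x) (2 * Real.pi)]
      refine intervalIntegral.integral_congr fun x _ => ?_
      rw [intFactor_add_two_pi ha, hg.periodic x, mul_assoc]
    simp only [G]
    rw [h1]
    ring
  refine ⟨fun t => (intFactor a t)⁻¹ * G t, ⟨(hE.inv (intFactor_ne_zero a)).mul hGs, fun t => ?_⟩,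
    fun t => ?_⟩
  · have := monodromy_ne_zero a
    rw [hGp, intFactor_add_two_pi ha, mul_inv]
    field_simp
  · exact (hasDerivAt_inv_intFactor_mul ha.contDiff.continuous hGd t).congr_deriv (by ring)

theorem Solves.integral_eq_zero {a v g : ℝ → ℂ} (h : Solves a v g) (ha : IsCirc a)
    (hg : IsCirc g) (h1 : monodromy a = 1) (t : ℝ) :
    ∫ x in t..t + 2 * Real.pi, intFactor a x * g x = 0 := by
  have h2 := h.intFactor_sub ha.contDiff.continuous hg.contDiff.continuous t (t + 2 * Real.pi)
  rw [intFactor_add_two_pi ha, h.isCirc.periodic t, h1, one_mul, sub_self] at h2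
  exact (mul_eq_zero.1 h2.symm).resolve_left Complex.I_ne_zero

theorem exists_solves_of_integral_eq_zero {a g : ℝ → ℂ} (ha : IsCirc a) (hg : IsCirc g)
    (h : monodromy a = 1) {t₀ : ℝ}
    (h0 : ∫ x in t₀..t₀ + 2 * Real.pi, intFactor a x * g x = 0) :
    ∃ v, Solves a v g ∧ v t₀ = 0 := by
  have hE := contDiff_intFactor ha.contDiff
  have hEg : ContDiff ℝ ∞ fun x => intFactor a x * g x := hE.mul hg.contDiff
  set F := prim fun x => intFactor a x * g x with hF
  have hFs : ContDiff ℝ ∞ F := contDiff_prim hEg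
  have hFd := hasDerivAt_prim hEg.continuous
  let G : ℝ → ℂ := fun t => Complex.I * (F t - F t₀)
  have hGs : ContDiff ℝ ∞ G := contDiff_const.mul (hFs.sub contDiff_const)
  have hGd : ∀ t, HasDerivAt G (Complex.I * (intFactor a t * g t)) t := fun t =>
    ((hFd t).sub_const _).const_mul _
  have hper : Function.Periodic (fun x => intFactor a x * g x) (2 * Real.pi) := fun t => by
    change intFactor a (t + 2 * Real.pi) * g (t + 2 * Real.pi) = _
    rw [intFactor_add_two_pi ha, h, one_mul, hg.periodic t]
  have hGp : ∀ t, G (t + 2 * Real.pi) = G t := fun t => by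
    have h1 : F (t + 2 * Real.pi) - F t = 0 := by
      rw [prim_sub hEg.continuous, hper.intervalIntegral_add_eq t t₀, h0]
    simp only [G]
    rw [sub_eq_zero.1 h1]
  refine ⟨fun t => (intFactor a t)⁻¹ * G t, ⟨⟨(hE.inv (intFactor_ne_zero a)).mul hGs, fun t => ?_⟩,
    fun t => ?_⟩, by simp [G]⟩
  · rw [hGp, intFactor_add_two_pi ha, h, one_mul]
  · exact (hasDerivAt_inv_intFactor_mul ha.contDiff.continuous hGd t).congr_deriv (by ring)

/-- A priori bounds for the derivatives of the solutions of `v' = a v + g`. -/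
theorem exists_iteratedDeriv_bound (A : ℕ → ℝ) (J : ℕ) : ∃ C : ℝ, 0 ≤ C ∧
    ∀ (a v g : ℝ → ℂ) (W V H : ℝ), 1 ≤ W → ContDiff ℝ ∞ a → ContDiff ℝ ∞ v → ContDiff ℝ ∞ g →
      (∀ t, deriv v t = a t * v t + g t) → (∀ i t, ‖iteratedDeriv i a t‖ ≤ A i * W) →
      (∀ i ≤ J, ∀ t, ‖iteratedDeriv i g t‖ ≤ H) → (∀ t, ‖v t‖ ≤ V) →
      ∀ i ≤ J, ∀ t, ‖iteratedDeriv i v t‖ ≤ C * W ^ J * (V + H) := by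
  induction J with
  | zero =>
    refine ⟨1, zero_le_one, fun a v g W V H hW _ _ _ _ _ hg hv i hi t => ?_⟩
    obtain rfl : i = 0 := by omega
    have h1 : 0 ≤ H := (norm_nonneg _).trans (hg 0 le_rfl 0)
    simpa using (hv t).trans (by linarith)
  | succ J ih =>
    obtain ⟨C, hC0, hC⟩ := ih
    -- Each differentiation of the equation costs one factor `W`. The summand `C` covers the lower
    -- orders, `2 ^ J` is the sum of the Leibniz coefficients, and the final `1` accounts for the
    -- inhomogeneity.
    refine ⟨C + (2 ^ J * (∑ i ∈ Finset.range (J + 1), |A i|) * C + 1), by positivity,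
      fun a v g W V H hW ha hv hg hd hA hH hV i hi t => ?_⟩
    have hW0 : 0 < W := by linarith
    have hV0 : 0 ≤ V := (norm_nonneg _).trans (hV 0)
    have hH0 : 0 ≤ H := (norm_nonneg _).trans (hH 0 (Nat.zero_le _) 0)
    have hind := hC a v g W V H hW ha hv hg hd hA (fun i hi => hH i (by omega)) hV
    have hWJ : W ^ J ≤ W ^ (J + 1) := pow_le_pow_right₀ hW (Nat.le_succ J)
    rcases Nat.lt_or_ge i (J + 1) with hi' | hi'
    · refine (hind i (by omega) t).trans ?_
      have : C ≤ C + (2 ^ J * (∑ i ∈ Finset.range (J + 1), |A i|) * C + 1) :=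
        le_add_of_nonneg_right (by positivity)
      gcongr
    obtain rfl : i = J + 1 := by omega
    have h1 : iteratedDeriv (J + 1) v = iteratedDeriv J ((fun t => a t * v t) + g) := by
      rw [iteratedDeriv_succ']
      congr 1
      exact funext hd
    have hJ : ((J : ℕ∞) : WithTop ℕ∞) ≤ ∞ := by exact_mod_cast le_top
    have h2 : iteratedDeriv J ((fun t => a t * v t) + g) t =
        iteratedDeriv J (fun t => a t * v t) t + iteratedDeriv J g t :=
      iteratedDeriv_add ((ha.mul hv).contDiffAt.of_le hJ) (hg.contDiffAt.of_le hJ)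
    have h3 : ‖iteratedDeriv J (fun t => a t * v t) t‖ ≤
        ∑ k ∈ Finset.range (J + 1), (J.choose k : ℝ) *
          ((∑ i ∈ Finset.range (J + 1), |A i|) * W * (C * W ^ J * (V + H))) := by
      rw [← norm_iteratedFDeriv_eq_norm_iteratedDeriv]
      refine (norm_iteratedFDeriv_mul_le ha hv t (n := J) hJ).trans
        (Finset.sum_le_sum fun k hk => ?_)
      rw [norm_iteratedFDeriv_eq_norm_iteratedDeriv, norm_iteratedFDeriv_eq_norm_iteratedDeriv,
        mul_assoc]
      have h4 : ‖iteratedDeriv k a t‖ ≤ (∑ i ∈ Finset.range (J + 1), |A i|) * W := by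
        refine (hA k t).trans ?_
        gcongr
        exact (le_abs_self _).trans
          (Finset.single_le_sum (f := fun i => |A i|) (fun i _ => abs_nonneg _) hk)
      have h5 := hind (J - k) (Nat.sub_le _ _) t
      gcongr
    have h6 : (2 : ℝ) ^ J = ∑ i ∈ Finset.range (J + 1), (J.choose i : ℝ) := by
      exact_mod_cast (Nat.sum_range_choose J).symm
    rw [← Finset.sum_mul, ← h6] at h3
    rw [h1, h2]
    have h7 : H ≤ W ^ (J + 1) * (V + H) := by
      have : 1 ≤ W ^ (J + 1) := one_le_pow₀ hW
      nlinarith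
    calc _ ≤ 2 ^ J * ((∑ i ∈ Finset.range (J + 1), |A i|) * W * (C * W ^ J * (V + H))) +
          W ^ (J + 1) * (V + H) :=
          (norm_add_le _ _).trans (add_le_add h3 ((hH J (Nat.le_succ J) t).trans h7))
      _ = (2 ^ J * (∑ i ∈ Finset.range (J + 1), |A i|) * C + 1) * W ^ (J + 1) * (V + H) := by ring
      _ ≤ _ := by
        refine mul_le_mul_of_nonneg_right (mul_le_mul_of_nonneg_right ?_ ?_) ?_
        · linarith
        · positivity
        · positivity

/-! ### Symbol estimates -/

theorem IsTubeType.exists_symbol_bound (hQ : IsTubeType Q c m) : ∃ (M : ℕ) (A : ℕ → ℝ),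
    (∀ j, 0 ≤ A j) ∧ ∀ j t ξ,
      ‖iteratedDeriv j (fun s => c s ξ) t‖ ≤ A j * (1 + freqNorm ξ) ^ M := by
  choose A hA0 hA using hQ.symbol_bound
  refine ⟨⌈m⌉₊, A, fun j => (hA0 j).le, fun j t ξ => (hA j t ξ).trans ?_⟩
  refine mul_le_mul_of_nonneg_left ?_ (hA0 j).le
  rw [← Real.rpow_natCast]
  exact Real.rpow_le_rpow_of_exponent_le (one_le_one_add_freqNorm ξ) (Nat.le_ceil m)

theorem IsTubeType.exists_im_bound (hQ : IsTubeType Q c m) : ∃ C : ℝ, 0 < C ∧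
    ∀ t ξ, |(c t ξ).im| ≤ C * (1 + freqNorm ξ) ^ m := by
  obtain ⟨C, hC0, hC⟩ := hQ.symbol_bound 0
  refine ⟨C, hC0, fun t ξ => (Complex.abs_im_le_norm _).trans ?_⟩
  simpa using hC t ξ

theorem average_eq_circMean (ξ : Fin N → ℤ) : average c ξ = circMean fun t => c t ξ := rfl

theorem monodromy_eq_one_iff (ξ : Fin N → ℤ) :
    monodromy (fun t => c t ξ) = 1 ↔ ξ ∈ resonantSet c := by
  have h0 : (2 * Real.pi * Complex.I : ℂ) ≠ 0 := Complex.two_pi_I_ne_zero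
  rw [monodromy, Complex.exp_eq_one_iff, ← average_eq_circMean]
  refine exists_congr fun n => ?_
  rw [mul_comm (n : ℂ), mul_right_inj' h0]

/-- `e^{2πiz} - 1` is small only if `z` is close to an integer. -/
theorem half_le_norm_or_exists_int (z : ℂ) :
    1 / 2 ≤ ‖Complex.exp (2 * Real.pi * Complex.I * z) - 1‖ ∨
      ∃ n : ℤ, ‖z - n‖ ≤ ‖Complex.exp (2 * Real.pi * Complex.I * z) - 1‖ := by
  set q := Complex.exp (2 * Real.pi * Complex.I * z) with hq
  by_cases h : 1 / 2 ≤ ‖q - 1‖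
  · exact Or.inl h
  refine Or.inr ?_
  have h0 : (2 * Real.pi * Complex.I : ℂ) ≠ 0 := Complex.two_pi_I_ne_zero
  -- Near `1` the logarithm satisfies `‖log q‖ ≤ (3/2) ‖q - 1‖`. Since `log q = 2πi (z - n)` for
  -- some integer `n` and `2π > 3/2`, the claim follows.
  have h1 := Complex.norm_log_one_add_half_le_self (not_le.1 h).le
  rw [add_sub_cancel] at h1
  have h2 : Complex.exp (Complex.log q) = Complex.exp (2 * Real.pi * Complex.I * z) := by
    rw [Complex.exp_log (by rw [hq]; exact Complex.exp_ne_zero _)]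
  obtain ⟨n, hn⟩ := Complex.exp_eq_exp_iff_exists_int.1 h2.symm
  refine ⟨n, ?_⟩
  have h3 : Complex.log q = 2 * Real.pi * Complex.I * (z - n) := by
    linear_combination -hn
  rw [h3, norm_mul] at h1
  have h4 : ‖(2 * Real.pi * Complex.I : ℂ)‖ = 2 * Real.pi := by
    simp [abs_of_pos Real.pi_pos]
  rw [h4] at h1
  nlinarith [Real.pi_gt_three, norm_nonneg (z - n), norm_nonneg (q - 1)]

/-! ### From oscillation on intervals to pointwise bounds -/

theorem abs_sub_le_of_hasDerivAt {b b' : ℝ → ℝ} (hb : ∀ t, HasDerivAt b (b' t) t) {L : ℝ}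
    (hL : ∀ t, |b' t| ≤ L) (s t : ℝ) : |b s - b t| ≤ L * |s - t| :=
  Convex.norm_image_sub_le_of_norm_hasDerivWithin_le (s := Set.univ)
    (fun x _ => (hb x).hasDerivWithinAt) (fun x _ => hL x) convex_univ trivial trivial

theorem rpow_mul_rpow_neg_le {x : ℝ} (hx : 1 ≤ x) (m : ℝ) :
    (1 + x) ^ m * x ^ (-m) ≤ 2 ^ |m| := by
  have hx0 : 0 < x := by linarith
  have h1 : 1 ≤ (1 + x) / x := by rw [le_div_iff₀ hx0]; linarith
  rw [Real.rpow_neg hx0.le, ← div_eq_mul_inv, ← Real.div_rpow (by linarith) hx0.le]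
  calc ((1 + x) / x) ^ m ≤ ((1 + x) / x) ^ |m| :=
        Real.rpow_le_rpow_of_exponent_le h1 (le_abs_self m)
    _ ≤ 2 ^ |m| := by
        refine Real.rpow_le_rpow (by linarith) ?_ (abs_nonneg m)
        rw [div_le_iff₀ hx0]
        linarith

/-- The length `|ξ|^{-m}` is the scale on which `B` is essentially constant: its derivative is `O((1
+ |ξ|)^m)`, so it moves by at most `C * 2 ^ |m|` there. One good point in every such interval
therefore controls every point. -/
theorem OscBound.sub_le {B : ℝ → (Fin N → ℤ) → ℝ} {m D C t p q : ℝ} {ξ : Fin N → ℤ}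
    (h : OscBound B m D ξ t p q) (hB : ∀ s, HasDerivAt (fun s => B s ξ) (c s ξ).im s)
    (hC : ∀ s, |(c s ξ).im| ≤ C * (1 + freqNorm ξ) ^ m) (hC0 : 0 ≤ C) (hξ : 1 ≤ freqNorm ξ)
    (ht : t ∈ Set.Icc p q) {s : ℝ} (hs : s ∈ Set.Icc p q) (hD : 0 ≤ D) :
    B t ξ - B s ξ ≤ D * Real.log (freqNorm ξ) + C * 2 ^ |m| := by
  have hx0 : 0 < freqNorm ξ := by linarith
  set l := freqNorm ξ ^ (-m) with hl
  have hl0 : 0 < l := Real.rpow_pos_of_pos hx0 _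
  have hlog : 0 ≤ D * Real.log (freqNorm ξ) := mul_nonneg hD (Real.log_nonneg hξ)
  have hpow : 0 ≤ (1 + freqNorm ξ) ^ m := by positivity
  have key : ∀ x y : ℝ, |x - y| ≤ l → B x ξ - B y ξ ≤ C * 2 ^ |m| := fun x y hxy => by
    refine (le_abs_self _).trans ((abs_sub_le_of_hasDerivAt hB hC x y).trans ?_)
    calc C * (1 + freqNorm ξ) ^ m * |x - y| ≤ C * (1 + freqNorm ξ) ^ m * l := by gcongr
      _ = C * ((1 + freqNorm ξ) ^ m * l) := by ring
      _ ≤ _ := mul_le_mul_of_nonneg_left (rpow_mul_rpow_neg_le hξ m) hC0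
  rcases lt_or_ge (q - p) l with hlt | hle
  · have h1 := key t s (by
      rw [abs_le]
      constructor <;> linarith [ht.1, ht.2, hs.1, hs.2])
    linarith
  -- A window of length exactly `l` with `s` in its closure, shifted to the left near `q` so as to
  -- stay inside `[p, q]`. If `[p, q]` is shorter than `l`, the case above compares `t` and `s`
  -- directly.
  · obtain ⟨s', hs', h1⟩ := h (min s (q - l)) (min s (q - l) + l) (by linarith)
      (fun x hx => ⟨(le_min hs.1 (by linarith)).trans hx.1.le, by
        linarith [hx.2, min_le_right s (q - l)]⟩) (by linarith)
    have h2 : s ≤ min s (q - l) + l := by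
      rcases min_choice s (q - l) with h | h <;> rw [h]
      · linarith
      · linarith [hs.2]
    have h3 := key s' s (by
      rw [abs_le]
      constructor <;> linarith [hs'.1, hs'.2, min_le_left s (q - l)])
    linarith

/-! ### Bounds for solutions -/

theorem norm_integral_kernel_le {a g : ℝ → ℂ} (ha : Continuous a) {b : ℝ → ℝ}
    (hb : ∀ t, HasDerivAt b (a t).im t) {L S t p q : ℝ} (hpq : p ≤ q) (hlen : q - p ≤ 2 * Real.pi)
    (hL : ∀ s ∈ Set.Icc p q, b t - b s ≤ L) (hg : ∀ t, ‖g t‖ ≤ S) :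
    ‖∫ x in p..q, (intFactor a t)⁻¹ * intFactor a x * g x‖ ≤ 2 * Real.pi * Real.exp L * S := by
  have hS : 0 ≤ S := (norm_nonneg _).trans (hg 0)
  refine (intervalIntegral.norm_integral_le_of_norm_le_const (C := Real.exp L * S)
    fun x hx => ?_).trans ?_
  · rw [Set.uIoc_of_le hpq] at hx
    rw [norm_mul, norm_inv_intFactor_mul ha hb]
    have := hL x ⟨hx.1.le, hx.2⟩
    have := hg x
    gcongr
  · rw [abs_of_nonneg (by linarith)]
    calc Real.exp L * S * (q - p) ≤ Real.exp L * S * (2 * Real.pi) := by gcongr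
      _ = _ := by ring

theorem IsCirc.forall_norm_le {v : ℝ → ℂ} (hv : IsCirc v) {A t₀ : ℝ}
    (h : ∀ t ∈ Set.Ico t₀ (t₀ + 2 * Real.pi), ‖v t‖ ≤ A) (t : ℝ) : ‖v t‖ ≤ A := by
  obtain ⟨s, hs, hst⟩ := hv.periodic.exists_mem_Ico Real.two_pi_pos t t₀
  rw [hst]
  exact h s hs

theorem Solves.norm_le_forward {a v g : ℝ → ℂ} (h : Solves a v g) (ha : IsCirc a) (hg : IsCirc g)
    {b : ℝ → ℝ} (hb : ∀ t, HasDerivAt b (a t).im t) {L S : ℝ}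
    (hL : ∀ t ∈ Set.Icc (0 : ℝ) (2 * Real.pi), ∀ s ∈ Set.Icc t (t + 2 * Real.pi), b t - b s ≤ L)
    (hS : ∀ t, ‖g t‖ ≤ S) {δ : ℝ} (hδ : 0 < δ) (hq : δ ≤ ‖monodromy a - 1‖) (t : ℝ) :
    ‖v t‖ ≤ 2 * Real.pi * Real.exp L * S / δ := by
  have := Real.two_pi_pos
  refine h.isCirc.forall_norm_le (t₀ := 0) (fun t ht => ?_) t
  rw [zero_add] at ht
  have h1 := congrArg norm (h.eq_integral_forward ha hg t)
  rw [norm_mul, norm_mul, Complex.norm_I, one_mul] at h1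
  have h2 := norm_integral_kernel_le ha.contDiff.continuous hb (t := t) (p := t)
    (q := t + 2 * Real.pi) (by linarith) (by linarith) (hL t ⟨ht.1, ht.2.le⟩) hS
  rw [le_div_iff₀ hδ, mul_comm]
  exact (mul_le_mul_of_nonneg_right hq (norm_nonneg _)).trans (h1.le.trans h2)

theorem Solves.norm_le_backward {a v g : ℝ → ℂ} (h : Solves a v g) (ha : IsCirc a) (hg : IsCirc g)
    {b : ℝ → ℝ} (hb : ∀ t, HasDerivAt b (a t).im t) {L S : ℝ}
    (hL : ∀ t ∈ Set.Icc (0 : ℝ) (2 * Real.pi), ∀ s ∈ Set.Icc (t - 2 * Real.pi) t, b t - b s ≤ L)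
    (hS : ∀ t, ‖g t‖ ≤ S) {δ : ℝ} (hδ : 0 < δ) (hq : δ ≤ ‖(monodromy a)⁻¹ - 1‖) (t : ℝ) :
    ‖v t‖ ≤ 2 * Real.pi * Real.exp L * S / δ := by
  have := Real.two_pi_pos
  refine h.isCirc.forall_norm_le (t₀ := 0) (fun t ht => ?_) t
  rw [zero_add] at ht
  have h1 := congrArg norm (h.eq_integral_backward ha hg t)
  rw [norm_mul, norm_mul, Complex.norm_I, one_mul, norm_sub_rev] at h1
  have h2 := norm_integral_kernel_le ha.contDiff.continuous hb (t := t) (p := t - 2 * Real.pi)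
    (q := t) (by linarith) (by linarith) (hL t ⟨ht.1, ht.2.le⟩) hS
  rw [le_div_iff₀ hδ, mul_comm]
  exact (mul_le_mul_of_nonneg_right hq (norm_nonneg _)).trans (h1.le.trans h2)

/-- The solution vanishing at `t₀` also vanishes at `t₀ + 2π`, so its value at `t` is an integral
from either end. For each `t` the side with the bounded kernel is used. -/
theorem exists_solves_norm_le {a g : ℝ → ℂ} (ha : IsCirc a) (hg : IsCirc g)
    (h : monodromy a = 1) {t₀ : ℝ}
    (h0 : ∫ x in t₀..t₀ + 2 * Real.pi, intFactor a x * g x = 0)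
    {b : ℝ → ℝ} (hb : ∀ t, HasDerivAt b (a t).im t) {L : ℝ}
    (hL : ∀ t ∈ Set.Ioo t₀ (t₀ + 2 * Real.pi),
      (∀ s ∈ Set.Icc t (t₀ + 2 * Real.pi), b t - b s ≤ L) ∨ ∀ s ∈ Set.Icc t₀ t, b t - b s ≤ L) :
    ∃ v, Solves a v g ∧ ∀ S, (∀ t, ‖g t‖ ≤ S) → ∀ t, ‖v t‖ ≤ 2 * Real.pi * Real.exp L * S := by
  have hpi := Real.two_pi_pos
  obtain ⟨v, hv, hv0⟩ := exists_solves_of_integral_eq_zero ha hg h h0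
  refine ⟨v, hv, fun S hS t => hv.isCirc.forall_norm_le (t₀ := t₀) (fun t ht => ?_) t⟩
  have hS0 : 0 ≤ S := (norm_nonneg _).trans (hS 0)
  rcases ht.1.eq_or_lt with heq | hlt
  · rw [← heq, hv0, norm_zero]
    positivity
  have hvper : v (t₀ + 2 * Real.pi) = 0 := by rw [hv.isCirc.periodic t₀, hv0]
  have h1 : ∀ p, v p = 0 → v t = Complex.I *
      ∫ x in p..t, (intFactor a t)⁻¹ * intFactor a x * g x := fun p hp => by
    have h2 := hv.intFactor_sub ha.contDiff.continuous hg.contDiff.continuous p t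
    rw [hp, mul_zero, sub_zero] at h2
    simp only [mul_assoc, intervalIntegral.integral_const_mul]
    rw [mul_left_comm, ← h2, inv_mul_cancel_left₀ (intFactor_ne_zero a t)]
  rcases hL t ⟨hlt, ht.2⟩ with h2 | h2
  · rw [h1 _ hvper, intervalIntegral.integral_symm, norm_mul, Complex.norm_I, one_mul, norm_neg]
    exact norm_integral_kernel_le ha.contDiff.continuous hb ht.2.le (by linarith) h2 hS
  · rw [h1 _ hv0, norm_mul, Complex.norm_I, one_mul]
    exact norm_integral_kernel_le ha.contDiff.continuous hb hlt.le (by linarith [ht.2]) h2 hS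

/-! ### Reduction of global solvability to uniform solvability of the modes -/

theorem IsTubeType.solves_mode (hQ : IsTubeType Q c m) (u : SmoothTorus N) (ξ : Fin N → ℤ) :
    Solves (fun t => c t ξ) (mode u ξ) (mode (opP Q u) ξ) := by
  refine ⟨isCirc_mode u ξ, fun t => ?_⟩
  refine (hasDerivAt_mode u ξ t).congr_deriv ?_
  rw [hQ.mode_opP, (hasDerivAt_mode u ξ t).deriv]
  linear_combination mode (dirDeriv (1, 0) u) ξ t * Complex.I_mul_I

theorem IsTubeType.opP_eq_of_solves (hQ : IsTubeType Q c m) {u f : SmoothTorus N}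
    (h : ∀ ξ, Solves (fun t => c t ξ) (mode u ξ) (mode f ξ)) : opP Q u = f := by
  refine eq_of_mode_eq fun ξ t => ?_
  have h1 := ((hQ.solves_mode u ξ).hasDerivAt t).unique ((h ξ).hasDerivAt t)
  have h2 := mul_left_cancel₀ Complex.I_ne_zero h1
  linear_combination h2

/-- Without resonance every mode equation is solvable. With resonance, the compatibility condition
is the kernel of a continuous functional, so it passes from the range to its closure. No uniformity
in `ξ` is needed here. -/
theorem IsTubeType.exists_solves_of_mem_closure (hQ : IsTubeType Q c m) {f : SmoothTorus N}
    (hf : f ∈ closure (Set.range (opP Q))) (ξ : Fin N → ℤ) :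
    ∃ v, Solves (fun t => c t ξ) v (mode f ξ) := by
  by_cases h : monodromy (fun t => c t ξ) = 1
  · have ha := hQ.isCirc ξ
    have hE := (contDiff_intFactor ha.contDiff).continuous
    have hm : ∀ u : SmoothTorus N, Continuous (mode u ξ) := fun u =>
      (isCirc_mode u ξ).contDiff.continuous
    obtain ⟨K, hK⟩ := (isCompact_Icc (a := (0 : ℝ)) (b := 2 * Real.pi)).exists_bound_of_continuousOn
      hE.continuousOn
    have hK0 : 0 ≤ K := (norm_nonneg _).trans (hK 0 ⟨le_rfl, Real.two_pi_pos.le⟩)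
    let L : SmoothTorus N →ₗ[ℂ] ℂ :=
      { toFun := fun u => ∫ x in (0 : ℝ)..0 + 2 * Real.pi, intFactor (fun t => c t ξ) x * mode u ξ x
        map_add' := fun u v => by
          simp only [mode_add, mul_add]
          exact intervalIntegral.integral_add ((hE.mul (hm u)).intervalIntegrable _ _)
            ((hE.mul (hm v)).intervalIntegrable _ _)
        map_smul' := fun z u => by
          simp only [mode_smul, RingHom.id_apply, smul_eq_mul,
            ← intervalIntegral.integral_const_mul]
          refine intervalIntegral.integral_congr fun x _ => ?_
          ring }
    have hL : Continuous L := by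
      refine continuous_of_norm_le L (Real.toNNReal (K * (2 * Real.pi))) fun u => ?_
      refine (intervalIntegral.norm_integral_le_of_norm_le_const
        (C := K * derivSeminorm N 0 u) fun x hx => ?_).trans ?_
      · rw [zero_add, Set.uIoc_of_le Real.two_pi_pos.le] at hx
        rw [norm_mul]
        exact mul_le_mul (hK x ⟨hx.1.le, hx.2⟩) (norm_mode_le u ξ x) (norm_nonneg _) hK0
      · rw [zero_add, sub_zero, abs_of_pos Real.two_pi_pos]
        rw [Real.coe_toNNReal _ (by positivity)]
        exact le_of_eq (by ring)
    have hcl : IsClosed {u | L u = 0} := isClosed_eq hL continuous_const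
    have hsub : Set.range (opP Q) ⊆ {u | L u = 0} := by
      rintro _ ⟨u, rfl⟩
      exact (hQ.solves_mode u ξ).integral_eq_zero ha (isCirc_mode _ ξ) h 0
    obtain ⟨v, hv, -⟩ := exists_solves_of_integral_eq_zero ha (isCirc_mode f ξ) h
      (closure_minimal hsub hcl hf)
    exact ⟨v, hv⟩
  · exact exists_solves_of_monodromy_ne_one (hQ.isCirc ξ) (isCirc_mode f ξ) h

theorem iteratedDeriv_const_mul_circ {a : ℝ → ℂ} (z : ℂ) (j : ℕ) (t : ℝ) :
    ‖iteratedDeriv j (fun s => z * a s) t‖ = ‖z‖ * ‖iteratedDeriv j a t‖ := by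
  rw [iteratedDeriv_const_mul_field, norm_mul]

/-- A sup-norm bound with polynomial loss is enough: the equation bounds the derivatives with
further polynomial loss, and the rapid decay of the modes of `f` absorbs all of it. The finitely
many frequencies below `R` do not affect decay. -/
theorem IsTubeType.globallySolvable_of_uniform (hQ : IsTubeType Q c m)
    (h : ∃ (K : ℕ) (C R : ℝ), 0 ≤ C ∧ ∀ ξ, R ≤ freqNorm ξ → ∀ g, IsCirc g →
      (∃ v, Solves (fun t => c t ξ) v g) → ∃ v, Solves (fun t => c t ξ) v g ∧
        ∀ S, (∀ t, ‖g t‖ ≤ S) → ∀ t, ‖v t‖ ≤ C * (1 + freqNorm ξ) ^ K * S) :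
    GloballySolvable (opP Q) := by
  obtain ⟨K, C, R, hC0, h⟩ := h
  refine isClosed_of_closure_subset fun f hf => ?_
  have h1 : ∀ ξ, ∃ v, Solves (fun t => c t ξ) v (mode f ξ) ∧ (R ≤ freqNorm ξ →
      ∀ S, (∀ t, ‖mode f ξ t‖ ≤ S) → ∀ t, ‖v t‖ ≤ C * (1 + freqNorm ξ) ^ K * S) := fun ξ => by
    have h2 := hQ.exists_solves_of_mem_closure hf ξ
    by_cases hR : R ≤ freqNorm ξ
    · obtain ⟨v, hv, hv'⟩ := h ξ hR _ (isCirc_mode f ξ) h2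
      exact ⟨v, hv, fun _ => hv'⟩
    · obtain ⟨v, hv⟩ := h2
      exact ⟨v, hv, fun hR' => absurd hR' hR⟩
  choose v hv hb using h1
  obtain ⟨M, A, hA0, hA⟩ := hQ.exists_symbol_bound
  have hdecay : RapidDecay v := by
    refine rapidDecay_of_tail (fun ξ => (hv ξ).isCirc) fun j k => ?_
    obtain ⟨C₁, hC₁0, hC₁⟩ := exists_iteratedDeriv_bound A j
    -- The exponent pays for `j` differentiations of the equation (`M * j`), the loss in the assumed
    -- bound (`K`) and the decay wanted (`k`).
    obtain ⟨C₂, hC₂⟩ := exists_forall_le_bound (rapidDecay_mode f) j (M * j + K + k)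
    have hC₂0 : 0 ≤ C₂ := (mul_nonneg (norm_nonneg _)
      (pow_nonneg (one_add_freqNorm_pos _).le _)).trans (hC₂ 0 (Nat.zero_le _) 0 0)
    refine ⟨C₁ * ((C + 1) * C₂), R, fun ξ hξ t => ?_⟩
    have hp := one_add_freqNorm_pos ξ
    have hp1 := one_le_one_add_freqNorm ξ
    set w := 1 + freqNorm ξ with hw
    have hS : ∀ i ≤ j, ∀ t, ‖iteratedDeriv i (mode f ξ) t‖ ≤ C₂ / w ^ (M * j + K + k) :=
      fun i hi t => by
        rw [le_div_iff₀ (by positivity)]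
        exact hC₂ i hi ξ t
    have h2 := hC₁ (fun t => -Complex.I * c t ξ) (v ξ) (fun t => Complex.I * mode f ξ t) (w ^ M)
      (C * w ^ K * (C₂ / w ^ (M * j + K + k))) (C₂ / w ^ (M * j + K + k)) (one_le_pow₀ hp1)
      (contDiff_const.mul (hQ.isCirc ξ).contDiff) (hv ξ).isCirc.contDiff
      (contDiff_const.mul (isCirc_mode f ξ).contDiff)
      (fun t => by rw [((hv ξ).hasDerivAt t).deriv]; ring)
      (fun i t => by
        rw [iteratedDeriv_const_mul_circ, norm_neg, Complex.norm_I, one_mul]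
        exact hA i t ξ)
      (fun i hi t => by
        rw [iteratedDeriv_const_mul_circ, Complex.norm_I, one_mul]
        exact hS i hi t)
      (hb ξ hξ _ fun t => by simpa using hS 0 (Nat.zero_le _) t) j le_rfl t
    have h3 : C₂ / w ^ (M * j + K + k) ≤ w ^ K * (C₂ / w ^ (M * j + K + k)) :=
      le_mul_of_one_le_left (by positivity) (one_le_pow₀ hp1)
    calc _ ≤ C₁ * (w ^ M) ^ j * (C * w ^ K * (C₂ / w ^ (M * j + K + k)) +
          w ^ K * (C₂ / w ^ (M * j + K + k))) * w ^ k := by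
          refine mul_le_mul_of_nonneg_right (h2.trans ?_) (by positivity)
          gcongr
      _ = C₁ * ((C + 1) * C₂) := by
          rw [← pow_mul, pow_add, pow_add]
          field_simp
  obtain ⟨u, -, hu⟩ := exists_mode_eq (fun ξ => (hv ξ).isCirc) hdecay
  refine ⟨u, hQ.opP_eq_of_solves fun ξ => ?_⟩
  rw [show mode u ξ = v ξ from funext (hu ξ)]
  exact hv ξ

/-! ### Sufficiency -/

theorem exp_mul_log_add_le {x D K₀ : ℝ} (hx : 1 ≤ x) :
    Real.exp (D * Real.log x + K₀) ≤ Real.exp K₀ * (1 + x) ^ ⌈D⌉₊ := by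
  have hx0 : 0 < x := by linarith
  rw [Real.exp_add, mul_comm, mul_comm D, ← Real.rpow_def_of_pos hx0]
  refine mul_le_mul_of_nonneg_left ?_ (Real.exp_pos _).le
  rw [← Real.rpow_natCast]
  exact (Real.rpow_le_rpow_of_exponent_le hx (Nat.le_ceil D)).trans
    (Real.rpow_le_rpow hx0.le (by linarith) (Nat.cast_nonneg _))

theorem IsTubeType.globallySolvable_of_conditions (hQ : IsTubeType Q c m)
    {B : ℝ → (Fin N → ℤ) → ℝ} (hB : ∀ ξ t, HasDerivAt (fun s => B s ξ) (c t ξ).im t)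
    {tmax : (Fin N → ℤ) → ℝ}
    (h1 : ∃ C : ℝ, 0 < C ∧ ∃ M : ℕ, ∀ (τ : ℤ) (ξ : Fin N → ℤ), ξ ∉ resonantSet c →
      C * (1 + freqNorm ξ) ^ (-(M : ℝ)) ≤ ‖(τ : ℂ) + average c ξ‖)
    (h2 : ∃ D : ℝ, 0 < D ∧
      (∀ ξ : Fin N → ℤ, ξ ∉ resonantSet c → D ≤ freqNorm ξ →
        AlphaPlus B m D ξ ∨ AlphaMinus B m D ξ) ∧
      (∀ ξ : Fin N → ℤ, ξ ∈ resonantSet c → D ≤ freqNorm ξ → Beta B m D ξ (tmax ξ))) :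
    GloballySolvable (opP Q) := by
  obtain ⟨C, hC0, M, hC⟩ := h1
  obtain ⟨D, hD0, hα, hβ⟩ := h2
  obtain ⟨C₀, hC₀, hb⟩ := hQ.exists_im_bound
  have hpi := Real.two_pi_pos
  -- The two entries match the alternatives of `half_le_norm_or_exists_int`: away from the integers
  -- the monodromy is at distance at least `1/2` from `1`, and near them the Diophantine constant
  -- takes over.
  set δ := min C (1 / 2) with hδ
  have hδ0 : 0 < δ := lt_min hC0 (by norm_num)
  set K₀ := C₀ * 2 ^ |m| with hK₀
  refine hQ.globallySolvable_of_uniform ⟨⌈D⌉₊ + M, 2 * Real.pi * Real.exp K₀ / δ, D,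
    by positivity, fun ξ hξ g hg hsol => ?_⟩
  have hx1 : 1 ≤ freqNorm ξ := one_le_freqNorm (by linarith)
  have hp := one_add_freqNorm_pos ξ
  have hp1 := one_le_one_add_freqNorm ξ
  have ha := hQ.isCirc ξ
  set L := D * Real.log (freqNorm ξ) + K₀ with hL
  have hexp : Real.exp L ≤ Real.exp K₀ * (1 + freqNorm ξ) ^ ⌈D⌉₊ := exp_mul_log_add_le hx1
  have hosc : ∀ {t p q s : ℝ}, OscBound B m D ξ t p q → t ∈ Set.Icc p q → s ∈ Set.Icc p q →
      B t ξ - B s ξ ≤ L := fun h ht hs =>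
    h.sub_le (hB ξ) (fun s => hb s ξ) hC₀.le hx1 ht hs hD0.le
  by_cases hres : ξ ∈ resonantSet c
  · have hq := (monodromy_eq_one_iff ξ).2 hres
    obtain ⟨v₀, hv₀⟩ := hsol
    obtain ⟨v, hv, hvb⟩ := exists_solves_norm_le ha hg hq
      (hv₀.integral_eq_zero ha hg hq (tmax ξ)) (hB ξ) (L := L) fun t ht => by
        refine (hβ ξ hres hξ t ht).imp (fun h s hs => ?_) (fun h s hs => ?_)
        · exact hosc h ⟨le_rfl, ht.2.le⟩ hs
        · exact hosc h ⟨ht.1.le, le_rfl⟩ hs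
    refine ⟨v, hv, fun S hS t => (hvb S hS t).trans ?_⟩
    have hS0 : 0 ≤ S := (norm_nonneg _).trans (hS 0)
    refine mul_le_mul_of_nonneg_right ?_ hS0
    have hδ1 : δ ≤ 1 := (min_le_right _ _).trans (by norm_num)
    calc 2 * Real.pi * Real.exp L
        ≤ 2 * Real.pi * (Real.exp K₀ * (1 + freqNorm ξ) ^ ⌈D⌉₊) := by gcongr
      _ ≤ 2 * Real.pi * (Real.exp K₀ * (1 + freqNorm ξ) ^ (⌈D⌉₊ + M)) := by
          gcongr
          omega
      _ ≤ 2 * Real.pi * (Real.exp K₀ * (1 + freqNorm ξ) ^ (⌈D⌉₊ + M)) / δ := by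
          rw [le_div_iff₀ hδ0]
          exact mul_le_of_le_one_right (by positivity) hδ1
      _ = _ := by ring
  · obtain ⟨v, hv⟩ := hsol
    refine ⟨v, hv, fun S hS t => ?_⟩
    have hS0 : 0 ≤ S := (norm_nonneg _).trans (hS 0)
    set ε := δ * ((1 + freqNorm ξ) ^ M)⁻¹ with hε
    have hε0 : 0 < ε := by positivity
    have hfin : 2 * Real.pi * Real.exp L * S / ε ≤
        2 * Real.pi * Real.exp K₀ / δ * (1 + freqNorm ξ) ^ (⌈D⌉₊ + M) * S := by
      calc _ ≤ 2 * Real.pi * (Real.exp K₀ * (1 + freqNorm ξ) ^ ⌈D⌉₊) * S / ε := by gcongr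
        _ = _ := by
          rw [hε, pow_add]
          field_simp
    have hlow : ∀ z : ℂ, (∀ n : ℤ, C * (1 + freqNorm ξ) ^ (-(M : ℝ)) ≤ ‖z - n‖) →
        ε ≤ ‖Complex.exp (2 * Real.pi * Complex.I * z) - 1‖ := fun z hz => by
      have hinv : ((1 + freqNorm ξ) ^ M)⁻¹ ≤ 1 := inv_le_one_of_one_le₀ (one_le_pow₀ hp1)
      rcases half_le_norm_or_exists_int z with h | ⟨n, hn⟩
      · refine le_trans ?_ h
        calc ε ≤ 1 / 2 * 1 := by
              rw [hε]
              gcongr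
              exact min_le_right _ _
          _ = 1 / 2 := mul_one _
      · refine le_trans ?_ hn
        refine le_trans ?_ (hz n)
        rw [Real.rpow_neg hp.le, Real.rpow_natCast]
        exact mul_le_mul_of_nonneg_right (min_le_left _ _) (by positivity)
    rcases hα ξ hres hξ with h | h
    · refine (hv.norm_le_forward ha hg (hB ξ) (L := L) (fun t ht s hs => ?_) hS hε0 ?_ t).trans hfin
      · exact hosc (h t ht) ⟨le_rfl, by linarith⟩ hs
      · refine hlow _ fun n => ?_
        have := hC (-n) ξ hres
        rw [average_eq_circMean] at this
        rwa [show ((-n : ℤ) : ℂ) + circMean (fun t => c t ξ) = circMean (fun t => c t ξ) - n by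
          push_cast; ring] at this
    · refine (hv.norm_le_backward ha hg (hB ξ) (L := L) (fun t ht s hs => ?_) hS hε0 ?_ t).trans
        hfin
      · exact hosc (h t ht) ⟨by linarith, le_rfl⟩ hs
      -- The inverse monodromy is the exponential belonging to `-c₀`, whose distances to the
      -- integers are those of `c₀`.
      · have h3 := hlow (-circMean fun t => c t ξ) fun n => by
          have := hC n ξ hres
          rw [average_eq_circMean] at this
          rwa [← norm_neg, show -(-circMean (fun t => c t ξ) - (n : ℂ)) =
            n + circMean (fun t => c t ξ) by ring]
        rwa [mul_neg, Complex.exp_neg] at h3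

/-! ### The a priori estimate -/

theorem isCirc_zero : IsCirc fun _ => 0 := ⟨contDiff_const, fun _ => rfl⟩

theorem solves_zero (a : ℝ → ℂ) : Solves a (fun _ => 0) (fun _ => 0) :=
  ⟨isCirc_zero, fun t => by simpa using hasDerivAt_const t (0 : ℂ)⟩

theorem IsCirc.const_mul {g : ℝ → ℂ} (hg : IsCirc g) (z : ℂ) : IsCirc fun t => z * g t :=
  ⟨contDiff_const.mul hg.contDiff, fun t => by simp only [hg.periodic t]⟩

theorem Solves.const_mul {a v g : ℝ → ℂ} (h : Solves a v g) (z : ℂ) :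
    Solves a (fun t => z * v t) (fun t => z * g t) :=
  ⟨h.isCirc.const_mul z, fun t => ((h.hasDerivAt t).const_mul z).congr_deriv (by ring)⟩

theorem IsTubeType.opP_tensor (hQ : IsTubeType Q c m) {v g : ℝ → ℂ} (hg : IsCirc g)
    {ξ : Fin N → ℤ} (h : Solves (fun t => c t ξ) v g) :
    opP Q (tensor h.isCirc ξ) = tensor hg ξ := by
  refine hQ.opP_eq_of_solves fun η => ?_
  by_cases hη : ξ = η
  · subst hη
    rw [funext (mode_tensor_self h.isCirc ξ), funext (mode_tensor_self hg ξ)]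
    exact h
  · rw [funext (mode_tensor_of_ne h.isCirc hη), funext (mode_tensor_of_ne hg hη)]
    exact solves_zero _

theorem IsTubeType.exists_opP_eq_of_rapidDecay (hQ : IsTubeType Q c m)
    (hcl : GloballySolvable (opP Q)) {v g : (Fin N → ℤ) → ℝ → ℂ} (hg : ∀ ξ, IsCirc (g ξ))
    (hd : RapidDecay g) (h : ∀ ξ, Solves (fun t => c t ξ) (v ξ) (g ξ)) :
    ∃ u, ∀ ξ, Solves (fun t => c t ξ) (mode u ξ) (g ξ) := by
  obtain ⟨f, hf, hfm⟩ := exists_mode_eq hg hd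
  have hmem : f ∈ Set.range (opP Q) := by
    refine hcl.mem_of_tendsto hf (Filter.Eventually.of_forall fun s => ?_)
    refine ⟨∑ ξ ∈ s, tensor (h ξ).isCirc ξ, ?_⟩
    rw [map_sum]
    exact Finset.sum_congr rfl fun ξ _ => hQ.opP_tensor (hg ξ) (h ξ)
  obtain ⟨u, rfl⟩ := hmem
  refine ⟨u, fun ξ => ?_⟩
  have := hQ.solves_mode u ξ
  rwa [show mode (opP Q u) ξ = g ξ from funext (hfm ξ)] at this

/-- Gliding hump. If the estimate fails for every `K`, the bad data at frequencies `ξ K`, scaled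
down by `A K * (1 + |ξ K|)^K`, form a rapidly decaying family. Its sum is a limit of elements of the
range, hence has a preimage `u`; but the failure forces the modes of `u` to exceed `1` in modulus at
arbitrarily high frequencies. -/
theorem IsTubeType.exists_a_priori (hQ : IsTubeType Q c m) (hcl : GloballySolvable (opP Q)) :
    ∃ K : ℕ, ∀ ξ : Fin N → ℤ, (K : ℝ) ≤ freqNorm ξ → ∀ (g : ℝ → ℂ) (A : ℝ), IsCirc g →
      (∃ v, Solves (fun t => c t ξ) v g) → (∀ j ≤ K, ∀ t, ‖iteratedDeriv j g t‖ ≤ A) →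
      ∃ v, Solves (fun t => c t ξ) v g ∧ ∀ t, ‖v t‖ ≤ (1 + freqNorm ξ) ^ K * A := by
  by_contra! hcon
  choose ξ hξ g A hg hsol hA hbad using hcon
  choose v hv using hsol
  have hp : ∀ K, 0 < 1 + freqNorm (ξ K) := fun K => one_add_freqNorm_pos _
  have hApos : ∀ K, 0 < A K := fun K => by
    have h0 : 0 ≤ A K := (norm_nonneg _).trans (hA K 0 (Nat.zero_le _) 0)
    refine h0.lt_of_ne fun h => ?_
    have hg0 : g K = fun _ => 0 := funext fun t => by
      have := hA K 0 (Nat.zero_le _) t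
      rw [← h, iteratedDeriv_zero] at this
      exact norm_le_zero_iff.1 this
    obtain ⟨t, ht⟩ := hbad K (fun _ => 0) (by rw [hg0]; exact solves_zero _)
    rw [← h] at ht
    simp at ht
  set z : ℕ → ℂ := fun K => (((A K * (1 + freqNorm (ξ K)) ^ K)⁻¹ : ℝ) : ℂ) with hz
  have hznorm : ∀ K, ‖z K‖ = (A K * (1 + freqNorm (ξ K)) ^ K)⁻¹ := fun K => by
    have := hp K
    have := hApos K
    rw [hz, Complex.norm_real, Real.norm_of_nonneg (by positivity)]
  have hz0 : ∀ K, z K ≠ 0 := fun K => by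
    have := hp K
    have := hApos K
    rw [← norm_pos_iff, hznorm]
    positivity
  classical
  -- The map `K ↦ ξ K` need not be injective, so one index is chosen for each frequency attained.
  let G : (Fin N → ℤ) → ℝ → ℂ := fun η =>
    if h : ∃ K, ξ K = η then fun t => z h.choose * g h.choose t else fun _ => 0
  let V : (Fin N → ℤ) → ℝ → ℂ := fun η =>
    if h : ∃ K, ξ K = η then fun t => z h.choose * v h.choose t else fun _ => 0
  have hGpos : ∀ (η : Fin N → ℤ) (h : ∃ K, ξ K = η),
      G η = fun t => z h.choose * g h.choose t := fun η h => dif_pos h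
  have hGneg : ∀ (η : Fin N → ℤ), (¬ ∃ K, ξ K = η) → G η = fun _ => 0 := fun η h => dif_neg h
  have hG : ∀ η, IsCirc (G η) := fun η => by
    by_cases h : ∃ K, ξ K = η
    · rw [hGpos η h]
      exact (hg _).const_mul _
    · rw [hGneg η h]
      exact isCirc_zero
  have hGV : ∀ η, Solves (fun t => c t η) (V η) (G η) := fun η => by
    by_cases h : ∃ K, ξ K = η
    · rw [hGpos η h, show V η = fun t => z h.choose * v h.choose t from dif_pos h]
      have := (hv h.choose).const_mul (z h.choose)
      rwa [h.choose_spec] at this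
    · rw [hGneg η h, show V η = fun _ => 0 from dif_neg h]
      exact solves_zero _
  have hdecay : RapidDecay G := by
    refine rapidDecay_of_tail hG fun j k => ?_
    -- Beyond this radius a frequency `η` differs from every `ξ K` with `K < max j k`. Its chosen
    -- index is thus at least `j` and `k`, so that `hA` applies to the `j`-th derivative and the
    -- scaling absorbs the weight of exponent `k`.
    refine ⟨1, 1 + ∑ K ∈ Finset.range (max j k), freqNorm (ξ K), fun η hη t => ?_⟩
    by_cases h : ∃ K, ξ K = η
    · have hK : max j k ≤ h.choose := by
        by_contra! hlt
        have := Finset.single_le_sum (f := fun K => freqNorm (ξ K)) (fun i _ => freqNorm_nonneg _)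
          (Finset.mem_range.2 hlt)
        simp only [h.choose_spec] at this
        linarith
      rw [hGpos η h, iteratedDeriv_const_mul_circ, hznorm, h.choose_spec]
      set K := h.choose with hKdef
      have h1 := hA K j ((le_max_left _ _).trans hK) t
      have h2 := one_add_freqNorm_pos η
      have h3 := hApos K
      calc (A K * (1 + freqNorm η) ^ K)⁻¹ * ‖iteratedDeriv j (g K) t‖ * (1 + freqNorm η) ^ k
          ≤ (A K * (1 + freqNorm η) ^ K)⁻¹ * A K * (1 + freqNorm η) ^ K := by
            gcongr
            · exact one_le_one_add_freqNorm η
            · exact (le_max_right _ _).trans hK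
        _ = 1 := by field_simp
    · rw [hGneg η h, iteratedDeriv_const]
      split_ifs <;> simp
  obtain ⟨u, hu⟩ := hQ.exists_opP_eq_of_rapidDecay hcl hG hdecay hGV
  obtain ⟨C, hC⟩ := mode_decay u 1
  obtain ⟨n, hn⟩ := exists_nat_ge C
  have hex : ∃ K, ξ K = ξ n := ⟨n, rfl⟩
  have hsolves := hu (ξ n)
  rw [hGpos (ξ n) hex] at hsolves
  set K := hex.choose with hKdef
  have hKn : ξ K = ξ n := hex.choose_spec
  have h1 := hsolves.const_mul (z K)⁻¹
  simp only [inv_mul_cancel_left₀ (hz0 K)] at h1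
  rw [← hKn] at h1
  obtain ⟨t, ht⟩ := hbad K _ h1
  rw [norm_mul, norm_inv, hznorm, inv_inv, mul_comm (A K)] at ht
  have h2 : 0 < (1 + freqNorm (ξ K)) ^ K * A K := mul_pos (pow_pos (hp K) _) (hApos K)
  have h3 : 1 < ‖mode u (ξ K) t‖ := by
    by_contra! h
    exact absurd ht (not_lt.2 (mul_le_of_le_one_right h2.le h))
  have h4 := hC (ξ K) t
  have h5 : (n : ℝ) ≤ freqNorm (ξ K) := hKn ▸ hξ n
  rw [pow_one] at h4
  nlinarith [hp K]

theorem Solves.eq_of_monodromy_ne_one {a v v' g : ℝ → ℂ} (h : Solves a v g) (h' : Solves a v' g)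
    (ha : IsCirc a) (hg : IsCirc g) (hq : monodromy a ≠ 1) : v = v' := by
  funext t
  have h1 := (h.eq_integral_forward ha hg t).trans (h'.eq_integral_forward ha hg t).symm
  exact mul_left_cancel₀ (sub_ne_zero.2 hq) h1

/-! ### Necessity of the Diophantine condition -/

/-- The periodic solution of `D_t v + a v = (τ + a₀) v`, where `a₀` is the mean value of `a`. -/
def quasimode (a : ℝ → ℂ) (τ : ℤ) (t : ℝ) : ℂ :=
  Complex.exp (Complex.I * ((τ + circMean a) * t - prim a t))

theorem hasDerivAt_quasimode {a : ℝ → ℂ} (ha : Continuous a) (τ : ℤ) (t : ℝ) :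
    HasDerivAt (quasimode a τ) (Complex.I * (τ + circMean a - a t) * quasimode a τ t) t := by
  have h1 : HasDerivAt (fun s : ℝ => (τ + circMean a) * (s : ℂ)) ((τ + circMean a) * 1) t :=
    (Complex.ofRealCLM.hasDerivAt (x := t)).const_mul _
  refine ((h1.sub (hasDerivAt_prim ha t)).const_mul Complex.I).cexp.congr_deriv ?_
  simp only [quasimode]
  rw [mul_comm, mul_one]
  rfl

theorem isCirc_quasimode {a : ℝ → ℂ} (ha : IsCirc a) (τ : ℤ) : IsCirc (quasimode a τ) := by
  refine ⟨(contDiff_const.mul ((contDiff_const.mul Complex.ofRealCLM.contDiff).sub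
    (contDiff_prim ha.contDiff))).cexp, fun t => ?_⟩
  refine Complex.exp_eq_exp_iff_exists_int.2 ⟨τ, ?_⟩
  rw [prim_add_two_pi ha]
  push_cast
  ring

theorem solves_quasimode {a : ℝ → ℂ} (ha : IsCirc a) (τ : ℤ) :
    Solves a (quasimode a τ) fun t => (τ + circMean a) * quasimode a τ t :=
  ⟨isCirc_quasimode ha τ, fun t =>
    (hasDerivAt_quasimode ha.contDiff.continuous τ t).congr_deriv (by ring)⟩

theorem IsCirc.exists_max {v : ℝ → ℂ} (hv : IsCirc v) : ∃ t₀, ∀ t, ‖v t‖ ≤ ‖v t₀‖ := by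
  obtain ⟨t₀, -, ht₀⟩ := (isCompact_Icc (a := (0 : ℝ)) (b := 2 * Real.pi)).exists_isMaxOn
    ⟨0, le_rfl, Real.two_pi_pos.le⟩ hv.contDiff.continuous.norm.continuousOn
  refine ⟨t₀, fun t => hv.forall_norm_le (t₀ := 0) (fun s hs => ?_) t⟩
  rw [zero_add] at hs
  exact ht₀ ⟨hs.1, hs.2.le⟩

theorem exists_pos_le_norm_int_add {z : ℂ} (hz : ∀ n : ℤ, z ≠ n) :
    ∃ d : ℝ, 0 < d ∧ ∀ τ : ℤ, d ≤ ‖(τ : ℂ) + z‖ := by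
  have hcl : IsClosed (Set.range ((↑) : ℤ → ℂ)) := Complex.isClosed_range_intCast
  have hne : (Set.range ((↑) : ℤ → ℂ)).Nonempty := ⟨_, 0, rfl⟩
  have hmem : z ∉ Set.range ((↑) : ℤ → ℂ) := by
    rintro ⟨n, hn⟩
    exact hz n hn.symm
  refine ⟨_, (hcl.notMem_iff_infDist_pos hne).1 hmem, fun τ => ?_⟩
  refine (Metric.infDist_le_dist_of_mem (Set.mem_range_self (-τ))).trans (le_of_eq ?_)
  rw [dist_eq_norm, Int.cast_neg, sub_neg_eq_add, add_comm]

theorem norm_iteratedDeriv_add_const_le {a : ℝ → ℂ} (ha : ContDiff ℝ ∞ a) (z : ℂ) (j : ℕ) (t : ℝ) :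
    ‖iteratedDeriv j (fun s => a s + z) t‖ ≤ ‖iteratedDeriv j a t‖ + ‖z‖ := by
  have h1 : iteratedDeriv j (a + fun _ => z) t =
      iteratedDeriv j a t + iteratedDeriv j (fun _ => z) t :=
    iteratedDeriv_add (ha.contDiffAt.of_le (by exact_mod_cast le_top)) contDiff_const.contDiffAt
  refine (congrArg norm h1).le.trans ((norm_add_le _ _).trans ?_)
  gcongr
  rw [iteratedDeriv_const]
  split_ifs <;> simp

/-- With `l = τ + c₀(ξ)`, the quasimode `v` is the only solution with right-hand side `l v`. Its
derivatives are bounded polynomially by `max |v|`, so the a priori estimate reads `max |v| ≤ |l| *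
polynomial * max |v|`, and `|l|` cannot be too small. -/
theorem IsTubeType.diophantine_of_globallySolvable (hQ : IsTubeType Q c m)
    (hcl : GloballySolvable (opP Q)) :
    ∃ C : ℝ, 0 < C ∧ ∃ M : ℕ, ∀ (τ : ℤ) (ξ : Fin N → ℤ), ξ ∉ resonantSet c →
      C * (1 + freqNorm ξ) ^ (-(M : ℝ)) ≤ ‖(τ : ℂ) + average c ξ‖ := by
  obtain ⟨K, hK⟩ := hQ.exists_a_priori hcl
  obtain ⟨M, A, hA0, hA⟩ := hQ.exists_symbol_bound
  obtain ⟨C₁, hC₁0, hC₁⟩ := exists_iteratedDeriv_bound (fun j => A j + 1) K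
  have hd : ∀ ξ : Fin N → ℤ, ∃ d : ℝ, 0 < d ∧ (ξ ∉ resonantSet c →
      ∀ τ : ℤ, d ≤ ‖(τ : ℂ) + average c ξ‖) := fun ξ => by
    by_cases h : ξ ∈ resonantSet c
    · exact ⟨1, one_pos, fun h' => absurd h h'⟩
    · obtain ⟨d, hd0, hd⟩ := exists_pos_le_norm_int_add (z := average c ξ) fun n hn => h ⟨n, hn⟩
      exact ⟨d, hd0, fun _ => hd⟩
  choose d hd0 hd using hd
  obtain ⟨U, hU⟩ := ((finite_freqNorm_le (N := N) K).image fun ξ => (d ξ)⁻¹).bddAbove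
  -- One constant for three cases: `U` for the finitely many frequencies with `|ξ| ≤ K`, `1` for
  -- `|l| ≥ 1`, and `C₁` for the main case.
  set T := max (max U 1) (C₁ + 1) with hT
  have hT1 : 1 ≤ T := (le_max_right U 1).trans (le_max_left _ _)
  have hT0 : 0 < T := by linarith
  refine ⟨T⁻¹, by positivity, K + M * K, fun τ ξ hres => ?_⟩
  have hp := one_add_freqNorm_pos ξ
  have hp1 := one_le_one_add_freqNorm ξ
  rw [Real.rpow_neg hp.le, Real.rpow_natCast]
  have hinv : ((1 + freqNorm ξ) ^ (K + M * K))⁻¹ ≤ 1 := inv_le_one_of_one_le₀ (one_le_pow₀ hp1)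
  rcases le_total (freqNorm ξ) K with hle | hge
  · have h1 : T⁻¹ ≤ d ξ := by
      rw [inv_le_comm₀ hT0 (hd0 ξ)]
      exact (hU ⟨ξ, hle, rfl⟩).trans ((le_max_left _ _).trans (le_max_left _ _))
    exact (mul_le_of_le_one_right (by positivity) hinv).trans (h1.trans (hd ξ hres τ))
  set l := (τ : ℂ) + average c ξ with hl
  rcases le_total 1 ‖l‖ with h1 | h1
  · refine le_trans ?_ h1
    exact mul_le_one₀ (inv_le_one_of_one_le₀ hT1) (by positivity) hinv
  have ha := hQ.isCirc ξ
  set a : ℝ → ℂ := fun t => c t ξ with ha_def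
  set v := quasimode a τ with hv
  have hvc : IsCirc v := isCirc_quasimode ha τ
  obtain ⟨t₀, ht₀⟩ := hvc.exists_max
  have hv0 : 0 < ‖v t₀‖ := norm_pos_iff.2 (Complex.exp_ne_zero _)
  have hW : 1 ≤ (1 + freqNorm ξ) ^ M := one_le_pow₀ hp1
  have hbound := hC₁ (fun t => Complex.I * (-1 * a t + l)) v (fun _ => 0) _ ‖v t₀‖ 0 hW
    (contDiff_const.mul ((contDiff_const.mul ha.contDiff).add contDiff_const)) hvc.contDiff
    contDiff_const
    (fun t => by
      rw [(hasDerivAt_quasimode ha.contDiff.continuous τ t).deriv, hl, average_eq_circMean]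
      ring)
    (fun i t => by
      rw [iteratedDeriv_const_mul_circ, Complex.norm_I, one_mul]
      refine (norm_iteratedDeriv_add_const_le (contDiff_const.mul ha.contDiff) l i t).trans ?_
      rw [iteratedDeriv_const_mul_circ, norm_neg, norm_one, one_mul, add_mul, one_mul]
      exact add_le_add (hA i t ξ) (h1.trans hW))
    (fun i _ t => by
      rw [iteratedDeriv_const]
      split_ifs <;> simp)
    ht₀
  obtain ⟨v', hv', hb⟩ := hK ξ hge (fun t => l * v t)
    (‖l‖ * (C₁ * ((1 + freqNorm ξ) ^ M) ^ K * (‖v t₀‖ + 0))) (hvc.const_mul l)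
    ⟨v, solves_quasimode ha τ⟩ (fun j hj t => by
      rw [iteratedDeriv_const_mul_circ]
      exact mul_le_mul_of_nonneg_left (hbound j hj t) (norm_nonneg _))
  have hvv : v = v' := (solves_quasimode ha τ).eq_of_monodromy_ne_one hv' ha (hvc.const_mul l)
    fun h => hres ((monodromy_eq_one_iff ξ).1 h)
  have h2 := hb t₀
  rw [← hvv, add_zero] at h2
  have h3 : 1 * ‖v t₀‖ ≤ (‖l‖ * C₁ * (1 + freqNorm ξ) ^ (K + M * K)) * ‖v t₀‖ := by
    rw [one_mul, pow_add, pow_mul]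
    exact h2.trans (le_of_eq (by ring))
  have h4 := le_of_mul_le_mul_right h3 hv0
  rw [← mul_inv, inv_le_iff_one_le_mul₀ (by positivity)]
  refine h4.trans ?_
  calc ‖l‖ * C₁ * (1 + freqNorm ξ) ^ (K + M * K) ≤ ‖l‖ * T * (1 + freqNorm ξ) ^ (K + M * K) := by
        gcongr
        exact (by linarith : C₁ ≤ C₁ + 1).trans (le_max_right _ _)
    _ = _ := by ring

/-! ### Periodic bump functions -/

/-- A smooth `2π`-periodic function, positive exactly on the translates of `(-r, r)`. -/
def bump (r x : ℝ) : ℝ := Real.smoothTransition ((1 - Real.cos r)⁻¹ * Real.cos x +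
  -((1 - Real.cos r)⁻¹ * Real.cos r))

theorem contDiff_bump (r : ℝ) : ContDiff ℝ ∞ (bump r) :=
  Real.smoothTransition.contDiff.comp ((contDiff_const.mul Real.contDiff_cos).add contDiff_const)

theorem bump_nonneg (r x : ℝ) : 0 ≤ bump r x := Real.smoothTransition.nonneg _

theorem one_sub_cos_pos {r : ℝ} (h0 : 0 < r) (h1 : r ≤ 1) : 0 < 1 - Real.cos r := by
  have := Real.cos_lt_cos_of_nonneg_of_le_pi le_rfl (h1.trans (by linarith [Real.pi_gt_three])) h0
  rw [Real.cos_zero] at this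
  linarith

theorem inv_one_sub_cos_le {r : ℝ} (h0 : 0 < r) (h1 : r ≤ 1) :
    (1 - Real.cos r)⁻¹ ≤ 5 * r⁻¹ ^ 2 := by
  have hpi := Real.pi_gt_three
  have h2 := Real.cos_le_one_sub_mul_cos_sq (x := r) (by rw [abs_of_pos h0]; linarith)
  rw [inv_le_iff_one_le_mul₀ (one_sub_cos_pos h0 h1), inv_pow]
  have h3 : Real.pi ^ 2 ≤ 10 := by nlinarith [Real.pi_lt_d2, Real.pi_pos]
  have h4 : 1 / 5 * r ^ 2 ≤ 1 - Real.cos r := by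
    have : 1 / 5 ≤ 2 / Real.pi ^ 2 := by
      rw [div_le_div_iff₀ (by norm_num) (by positivity)]
      linarith
    nlinarith [sq_nonneg r]
  calc (1 : ℝ) = 5 * (r ^ 2)⁻¹ * (1 / 5 * r ^ 2) := by field_simp
    _ ≤ _ := by gcongr

theorem cos_le_cos_of_abs {r x : ℝ} (h0 : 0 ≤ r) (h1 : r ≤ |x|) (h2 : |x| ≤ 2 * Real.pi - r) :
    Real.cos x ≤ Real.cos r := by
  rw [← Real.cos_abs x]
  rcases le_total |x| Real.pi with h | h
  · exact Real.cos_le_cos_of_nonneg_of_le_pi h0 h h1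
  · rw [← Real.cos_two_pi_sub]
    exact Real.cos_le_cos_of_nonneg_of_le_pi h0 (by linarith) (by linarith)

theorem bump_eq_zero {r x : ℝ} (h0 : 0 < r) (hr : r ≤ 1) (h1 : r ≤ |x|)
    (h2 : |x| ≤ 2 * Real.pi - r) : bump r x = 0 := by
  refine Real.smoothTransition.zero_of_nonpos ?_
  have := cos_le_cos_of_abs h0.le h1 h2
  have := inv_nonneg.2 (one_sub_cos_pos h0 hr).le
  nlinarith

theorem smoothTransition_half_le_bump {r x : ℝ} (h0 : 0 < r) (hr : r ≤ 1) (hx : |x| ≤ r / 2) :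
    Real.smoothTransition (1 / 2) ≤ bump r x := by
  refine Real.smoothTransition.monotone ?_
  have hpi := Real.pi_gt_three
  have h1 := one_sub_cos_pos h0 hr
  have h2 : Real.cos (r / 2) ≤ Real.cos x := by
    rw [← Real.cos_abs x]
    exact Real.cos_le_cos_of_nonneg_of_le_pi (abs_nonneg x) (by linarith) hx
  have h3 : Real.cos r = 2 * Real.cos (r / 2) ^ 2 - 1 := by
    rw [← Real.cos_two_mul]
    ring_nf
  have h4 : 0 ≤ Real.cos (r / 2) :=
    Real.cos_nonneg_of_neg_pi_div_two_le_of_le (by linarith) (by linarith)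
  have h5 := Real.cos_le_one (r / 2)
  -- With `y = cos (r/2)` in `[0, 1]`, the left side is `(1 - y)(1 + y)`, and the right side is at
  -- least `y + 1 - 2y² = (1 - y)(1 + 2y)`.
  have h6 : 1 / 2 * (1 - Real.cos r) ≤ Real.cos x - Real.cos r := by nlinarith
  calc (1 / 2 : ℝ) = (1 - Real.cos r)⁻¹ * (1 / 2 * (1 - Real.cos r)) := by field_simp
    _ ≤ (1 - Real.cos r)⁻¹ * (Real.cos x - Real.cos r) := by gcongr
    _ = _ := by ring

theorem exists_smoothTransition_bound (K : ℕ) : ∃ C : ℝ, 0 ≤ C ∧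
    ∀ i ≤ K, ∀ x, ‖iteratedDeriv i Real.smoothTransition x‖ ≤ C := by
  have h : ∀ i : ℕ, ∃ C : ℝ, ∀ x, ‖iteratedDeriv i Real.smoothTransition x‖ ≤ C := fun i => by
    obtain ⟨C, hC⟩ := (isCompact_Icc (a := (0 : ℝ)) (b := 1)).exists_bound_of_continuousOn
      ((Real.smoothTransition.contDiff (n := ⊤)).continuous_iteratedDeriv i
        (by exact_mod_cast le_top)).continuousOn
    refine ⟨max C 1, fun x => ?_⟩
    have hconst : ∀ z : ℝ, ‖z‖ ≤ 1 → ‖iteratedDeriv i (fun _ : ℝ => z) x‖ ≤ max C 1 :=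
      fun z hz => by
        refine le_trans ?_ (le_max_right C 1)
        rw [iteratedDeriv_const]
        split_ifs
        · exact hz
        · simp
    rcases lt_or_ge x 0 with h0 | h0
    · have : Real.smoothTransition =ᶠ[nhds x] fun _ => 0 := by
        filter_upwards [gt_mem_nhds h0] with y hy
        exact Real.smoothTransition.zero_of_nonpos hy.le
      rw [this.iteratedDeriv_eq]
      exact hconst 0 (by simp)
    rcases lt_or_ge 1 x with h1 | h1
    · have : Real.smoothTransition =ᶠ[nhds x] fun _ => 1 := by
        filter_upwards [lt_mem_nhds h1] with y hy
        exact Real.smoothTransition.one_of_one_le hy.le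
      rw [this.iteratedDeriv_eq]
      exact hconst 1 (by simp)
    · exact (hC x ⟨h0, h1⟩).trans (le_max_left _ _)
  choose C hC using h
  refine ⟨∑ i ∈ Finset.range (K + 1), |C i|, Finset.sum_nonneg fun i _ => abs_nonneg _,
    fun i hi x => (hC i x).trans ((le_abs_self _).trans ?_)⟩
  exact Finset.single_le_sum (f := fun i => |C i|) (fun i _ => abs_nonneg _)
    (Finset.mem_range.2 (Nat.lt_succ_of_le hi))

/-- What matters is that shrinking the bump costs only a power of `r⁻¹`. The argument of
`smoothTransition` has derivatives of size at most `(1 - cos r)⁻¹ ≤ 5 / r²`, which the bound for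
derivatives of a composition turns into the stated power. -/
theorem exists_bump_bound (K : ℕ) : ∃ C : ℝ, 0 ≤ C ∧ ∀ r : ℝ, 0 < r → r ≤ 1 → ∀ i ≤ K, ∀ x,
    ‖iteratedDeriv i (bump r) x‖ ≤ C * r⁻¹ ^ (2 * K) := by
  obtain ⟨C, hC0, hC⟩ := exists_smoothTransition_bound K
  refine ⟨K.factorial * C * 5 ^ K, by positivity, fun r h0 h1 i hi x => ?_⟩
  set κ := (1 - Real.cos r)⁻¹ with hκ
  have hκ0 : 0 ≤ κ := inv_nonneg.2 (one_sub_cos_pos h0 h1).le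
  have hD1 : 1 ≤ 5 * r⁻¹ ^ 2 := by
    have : 1 ≤ r⁻¹ ^ 2 := one_le_pow₀ ((one_le_inv₀ h0).2 h1)
    linarith
  have hderiv : deriv (fun x => κ * Real.cos x + -(κ * Real.cos r)) =
      fun x => -κ * Real.sin x := by
    funext y
    rw [(((Real.hasDerivAt_cos y).const_mul κ).add_const _).deriv]
    ring
  have h2 := norm_iteratedFDeriv_comp_le (𝕜 := ℝ) (N := ∞) (g := Real.smoothTransition)
    (f := fun x => κ * Real.cos x + -(κ * Real.cos r)) (n := i)
    Real.smoothTransition.contDiff ((contDiff_const.mul Real.contDiff_cos).add contDiff_const)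
    (by exact_mod_cast le_top) x (C := C) (D := 5 * r⁻¹ ^ 2)
    (fun j hj => by
      rw [norm_iteratedFDeriv_eq_norm_iteratedDeriv]
      exact hC j (hj.trans hi) _)
    (fun j hj _ => by
      obtain ⟨k, rfl⟩ := Nat.exists_eq_add_of_le' hj
      rw [norm_iteratedFDeriv_eq_norm_iteratedDeriv, iteratedDeriv_succ', hderiv,
        iteratedDeriv_const_mul_field, norm_mul, norm_neg, Real.norm_of_nonneg hκ0,
        Real.norm_eq_abs]
      calc κ * |iteratedDeriv k Real.sin x| ≤ κ * 1 := by
            gcongr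
            exact Real.abs_iteratedDeriv_sin_le_one k x
        _ ≤ 5 * r⁻¹ ^ 2 := by rw [mul_one]; exact inv_one_sub_cos_le h0 h1
        _ ≤ _ := le_self_pow₀ hD1 (Nat.succ_ne_zero k))
  rw [norm_iteratedFDeriv_eq_norm_iteratedDeriv] at h2
  refine h2.trans ?_
  calc (i.factorial : ℝ) * C * (5 * r⁻¹ ^ 2) ^ i ≤ K.factorial * C * (5 * r⁻¹ ^ 2) ^ K := by
        have : (i.factorial : ℝ) ≤ K.factorial := by exact_mod_cast Nat.factorial_le hi
        gcongr
    _ = _ := by rw [mul_pow, ← pow_mul]; ring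

/-! ### The phase correction -/

/-- The deviation of the real part of the mean value from the nearest integer. -/
def drift (a : ℝ → ℂ) : ℝ := (circMean a).re - round (circMean a).re

theorem abs_drift_le (a : ℝ → ℂ) : |drift a| ≤ 1 / 2 := abs_sub_round _

/-- A periodic function of modulus one that cancels the oscillation of the integrating factor. -/
def realPhase (a : ℝ → ℂ) (t : ℝ) : ℂ :=
  Complex.exp (-Complex.I * (((prim a t).re : ℂ) - drift a * t))

theorem norm_realPhase (a : ℝ → ℂ) (t : ℝ) : ‖realPhase a t‖ = 1 := by
  rw [realPhase, show -Complex.I * (((prim a t).re : ℂ) - drift a * t) =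
    ((-((prim a t).re - drift a * t) : ℝ) : ℂ) * Complex.I by push_cast; ring,
    Complex.norm_exp_ofReal_mul_I]

/-- Taking real parts, as a continuous linear map into `ℂ`. -/
def reToC : ℂ →L[ℝ] ℂ := Complex.ofRealCLM.comp Complex.reCLM

theorem reToC_apply (z : ℂ) : reToC z = (z.re : ℂ) := rfl

theorem norm_reToC_le : ‖reToC‖ ≤ 1 :=
  ContinuousLinearMap.opNorm_le_bound _ zero_le_one fun z => by
    rw [reToC_apply, Complex.norm_real, one_mul]
    exact Complex.abs_re_le_norm z

theorem norm_iteratedDeriv_re_le {a : ℝ → ℂ} (ha : ContDiff ℝ ∞ a) (j : ℕ) (t : ℝ) :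
    ‖iteratedDeriv j (fun s => ((a s).re : ℂ)) t‖ ≤ ‖iteratedDeriv j a t‖ := by
  rw [← norm_iteratedFDeriv_eq_norm_iteratedDeriv, ← norm_iteratedFDeriv_eq_norm_iteratedDeriv]
  have h1 : (fun s => ((a s).re : ℂ)) = reToC ∘ a := rfl
  rw [h1, reToC.iteratedFDeriv_comp_left ha.contDiffAt (by exact_mod_cast le_top)]
  exact (ContinuousLinearMap.norm_compContinuousMultilinearMap_le _ _).trans
    (mul_le_of_le_one_left (norm_nonneg _) norm_reToC_le)

theorem contDiff_re {a : ℝ → ℂ} (ha : ContDiff ℝ ∞ a) : ContDiff ℝ ∞ fun s => ((a s).re : ℂ) :=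
  reToC.contDiff.comp ha

/-- Over a period, `Re (prim a t) - drift a * t` grows by `2π` times an integer, the nearest one to
the real mean. Rounding to the nearest integer leaves a drift of at most `1/2`, whose oscillation is
harmless on a short bump. -/
theorem isCirc_realPhase {a : ℝ → ℂ} (ha : IsCirc a) : IsCirc (realPhase a) := by
  refine ⟨(contDiff_const.mul ((contDiff_re (contDiff_prim ha.contDiff)).sub
    (contDiff_const.mul Complex.ofRealCLM.contDiff))).cexp, fun t => ?_⟩
  refine Complex.exp_eq_exp_iff_exists_int.2 ⟨-round (circMean a).re, ?_⟩
  have h1 : (prim a (t + 2 * Real.pi)).re = (prim a t).re + 2 * Real.pi * (circMean a).re := by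
    rw [prim_add_two_pi ha]
    simp
  rw [h1, drift]
  push_cast
  ring

theorem hasDerivAt_realPhase {a : ℝ → ℂ} (ha : Continuous a) (t : ℝ) :
    HasDerivAt (realPhase a)
      (-Complex.I * (((a t).re : ℂ) + -drift a) * realPhase a t) t := by
  have h1 : HasDerivAt (fun s : ℝ => (drift a : ℂ) * (s : ℂ)) (drift a * 1) t :=
    (Complex.ofRealCLM.hasDerivAt (x := t)).const_mul _
  have h2 : HasDerivAt (fun s => ((prim a s).re : ℂ)) ((a t).re : ℂ) t :=
    reToC.hasFDerivAt.comp_hasDerivAt t (hasDerivAt_prim ha t)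
  refine ((h2.sub h1).const_mul (-Complex.I)).cexp.congr_deriv ?_
  simp only [realPhase]
  rw [mul_comm, mul_one, ← sub_eq_add_neg]
  rfl

/-- The test function: a bump around `z` with the phase correction. -/
def testFn (a : ℝ → ℂ) (z r : ℝ) (t : ℝ) : ℂ := (bump r (t - z) : ℂ) * realPhase a t

theorem contDiff_ofReal_bump (z r : ℝ) : ContDiff ℝ ∞ fun t => (bump r (t - z) : ℂ) :=
  Complex.ofRealCLM.contDiff.comp ((contDiff_bump r).comp (contDiff_id.sub contDiff_const))

theorem isCirc_testFn {a : ℝ → ℂ} (ha : IsCirc a) (z r : ℝ) : IsCirc (testFn a z r) := by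
  refine ⟨(contDiff_ofReal_bump z r).mul (isCirc_realPhase ha).contDiff, fun t => ?_⟩
  rw [testFn, testFn, (isCirc_realPhase ha).periodic t, bump, bump,
    show t + 2 * Real.pi - z = t - z + 2 * Real.pi by ring, Real.cos_add_two_pi]

theorem testFn_eq_zero {a : ℝ → ℂ} {z r t : ℝ} (h0 : 0 < r) (hr : r ≤ 1) (h1 : r ≤ |t - z|)
    (h2 : |t - z| ≤ 2 * Real.pi - r) : testFn a z r t = 0 := by
  rw [testFn, bump_eq_zero h0 hr h1 h2, Complex.ofReal_zero, zero_mul]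

theorem norm_iteratedDeriv_mul_le_of_le {f g : ℝ → ℂ} (hf : ContDiff ℝ ∞ f) (hg : ContDiff ℝ ∞ g)
    {K : ℕ} {F G : ℝ} (hF : ∀ i ≤ K, ∀ t, ‖iteratedDeriv i f t‖ ≤ F)
    (hG : ∀ i ≤ K, ∀ t, ‖iteratedDeriv i g t‖ ≤ G) {j : ℕ} (hj : j ≤ K) (t : ℝ) :
    ‖iteratedDeriv j (fun s => f s * g s) t‖ ≤ 2 ^ K * (F * G) := by
  have hF0 : 0 ≤ F := (norm_nonneg _).trans (hF 0 (Nat.zero_le _) 0)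
  have hG0 : 0 ≤ G := (norm_nonneg _).trans (hG 0 (Nat.zero_le _) 0)
  rw [← norm_iteratedFDeriv_eq_norm_iteratedDeriv]
  refine (norm_iteratedFDeriv_mul_le hf hg t (n := j) (by exact_mod_cast le_top)).trans ?_
  have h2 : ∑ i ∈ Finset.range (j + 1), (j.choose i : ℝ) = 2 ^ j := by
    exact_mod_cast Nat.sum_range_choose j
  calc _ ≤ ∑ i ∈ Finset.range (j + 1), (j.choose i : ℝ) * (F * G) := by
        refine Finset.sum_le_sum fun i hi => ?_
        have hi : i ≤ j := Nat.lt_succ_iff.1 (Finset.mem_range.1 hi)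
        rw [norm_iteratedFDeriv_eq_norm_iteratedDeriv, norm_iteratedFDeriv_eq_norm_iteratedDeriv,
          mul_assoc]
        have := hF i (hi.trans hj) t
        have := hG (j - i) ((Nat.sub_le _ _).trans hj) t
        gcongr
    _ = 2 ^ j * (F * G) := by rw [← Finset.sum_mul, h2]
    _ ≤ _ := by
      gcongr
      norm_num

/-- The phase solves a homogeneous linear equation whose coefficient is bounded by the symbol and
the drift, so `exists_iteratedDeriv_bound` gives polynomial growth in `|ξ|`; the bump contributes
the power of `r⁻¹`. -/
theorem IsTubeType.exists_testFn_bound (hQ : IsTubeType Q c m) (K : ℕ) : ∃ (C : ℝ) (P : ℕ),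
    0 ≤ C ∧ ∀ (ξ : Fin N → ℤ) (z r : ℝ), 0 < r → r ≤ 1 → ∀ j ≤ K, ∀ t,
      ‖iteratedDeriv j (testFn (fun t => c t ξ) z r) t‖ ≤
        C * (1 + freqNorm ξ) ^ P * r⁻¹ ^ (2 * K) := by
  obtain ⟨M, A, hA0, hA⟩ := hQ.exists_symbol_bound
  obtain ⟨C₁, hC₁0, hC₁⟩ := exists_iteratedDeriv_bound (fun j => A j + 1) K
  obtain ⟨C₂, hC₂0, hC₂⟩ := exists_bump_bound K
  refine ⟨2 ^ K * (C₂ * C₁), M * K, by positivity, fun ξ z r h0 h1 j hj t => ?_⟩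
  have ha := hQ.isCirc ξ
  have hp1 := one_le_one_add_freqNorm ξ
  have hW : 1 ≤ (1 + freqNorm ξ) ^ M := one_le_pow₀ hp1
  set a : ℝ → ℂ := fun t => c t ξ with ha_def
  have hphase := hC₁ (fun t => -Complex.I * (((a t).re : ℂ) + -drift a)) (realPhase a)
    (fun _ => 0) _ 1 0 hW
    (contDiff_const.mul ((contDiff_re ha.contDiff).add contDiff_const))
    (isCirc_realPhase ha).contDiff contDiff_const
    (fun t => by rw [(hasDerivAt_realPhase ha.contDiff.continuous t).deriv, add_zero])
    (fun i t => by
      rw [iteratedDeriv_const_mul_circ, norm_neg, Complex.norm_I, one_mul]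
      refine (norm_iteratedDeriv_add_const_le (contDiff_re ha.contDiff) _ i t).trans ?_
      rw [add_mul, one_mul, norm_neg, Complex.norm_real]
      refine add_le_add ((norm_iteratedDeriv_re_le ha.contDiff i t).trans (hA i t ξ)) ?_
      exact (abs_drift_le a).trans (by linarith))
    (fun i _ t => by
      rw [iteratedDeriv_const]
      split_ifs <;> simp)
    (fun t => (norm_realPhase a t).le)
  have hbump : ∀ i ≤ K, ∀ t, ‖iteratedDeriv i (fun t => (bump r (t - z) : ℂ)) t‖ ≤
      C₂ * r⁻¹ ^ (2 * K) := fun i hi t => by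
    have h2 : (fun t => (bump r (t - z) : ℂ)) = Complex.ofRealLI ∘ fun t => bump r (t - z) := rfl
    have h3 : ContDiff ℝ ∞ fun t => bump r (t - z) :=
      (contDiff_bump r).comp (contDiff_id.sub contDiff_const)
    rw [← norm_iteratedFDeriv_eq_norm_iteratedDeriv, h2,
      Complex.ofRealLI.norm_iteratedFDeriv_comp_left h3.contDiffAt
        (by exact_mod_cast le_top), norm_iteratedFDeriv_eq_norm_iteratedDeriv,
      iteratedDeriv_comp_sub_const]
    exact hC₂ r h0 h1 i hi _
  refine (norm_iteratedDeriv_mul_le_of_le (contDiff_ofReal_bump z r) (isCirc_realPhase ha).contDiff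
    hbump hphase hj t).trans (le_of_eq ?_)
  rw [← pow_mul]
  ring

/-- The only oscillation left in `s` is `exp(i drift (s - z))`; everything else is a nonnegative
weight and a unimodular constant. -/
theorem inv_intFactor_mul_testFn {a : ℝ → ℂ} (ha : Continuous a) {b : ℝ → ℝ}
    (hb : ∀ t, HasDerivAt b (a t).im t) (z r t s : ℝ) :
    (intFactor a t)⁻¹ * intFactor a s * testFn a z r s =
      Complex.exp (((-(prim a t).re + drift a * z : ℝ) : ℂ) * Complex.I) *
        (((Real.exp (b t - b s) * bump r (s - z) : ℝ) : ℂ) *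
          Complex.exp (((drift a * (s - z) : ℝ) : ℂ) * Complex.I)) := by
  rw [sub_eq_prim_im ha hb s t, testFn, realPhase, intFactor, intFactor, ← Complex.exp_neg]
  have h1 : ∀ x, prim a x = ((prim a x).re : ℂ) + (prim a x).im * Complex.I := fun x =>
    (Complex.re_add_im _).symm
  rw [Complex.ofReal_mul, Complex.ofReal_exp]
  have h2 : ∀ A B C D E F x : ℂ, A + B + C = D + E + F → Complex.exp A * Complex.exp B *
      (x * Complex.exp C) = Complex.exp D * (Complex.exp E * x * Complex.exp F) := by
    intro A B C D E F x h
    calc _ = Complex.exp (A + B + C) * x := by rw [Complex.exp_add, Complex.exp_add]; ring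
      _ = _ := by rw [h, Complex.exp_add, Complex.exp_add]; ring
  refine h2 _ _ _ _ _ _ _ ?_
  rw [h1 t, h1 s]
  simp only [Complex.add_re, Complex.add_im, Complex.ofReal_re, Complex.ofReal_im, Complex.mul_re,
    Complex.mul_im, Complex.I_re, Complex.I_im]
  push_cast
  linear_combination ((prim a s).im - (prim a t).im : ℂ) * Complex.I_mul_I

/-- On the bump the remaining angle is at most `1/2`, so its cosine is at least `1/2` and the real
part of the integrand cannot cancel. The bump is at least `smoothTransition (1/2)` on an interval of
length `r`, which gives the constant. -/
theorem le_norm_integral_testFn {a : ℝ → ℂ} (ha : IsCirc a) {b : ℝ → ℝ}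
    (hb : ∀ t, HasDerivAt b (a t).im t) {z r t p q Λ : ℝ} (h0 : 0 < r) (hr : r ≤ 1)
    (hp : p ≤ z - r) (hq : z + r ≤ q) (hpq : q - p ≤ 2 * Real.pi) (hΛ0 : 0 ≤ Λ)
    (hΛ : ∀ s ∈ Set.Ioo (z - r) (z + r), Λ ≤ Real.exp (b t - b s)) :
    Λ * (r * (Real.smoothTransition (1 / 2) / 2)) ≤
      ‖∫ s in p..q, (intFactor a t)⁻¹ * intFactor a s * testFn a z r s‖ := by
  have hbc : Continuous b := continuous_iff_continuousAt.2 fun t => (hb t).continuousAt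
  have hbump : Continuous (bump r) := (contDiff_bump r).continuous
  simp only [inv_intFactor_mul_testFn ha.contDiff.continuous hb]
  rw [intervalIntegral.integral_const_mul, norm_mul, Complex.norm_exp_ofReal_mul_I, one_mul]
  refine le_trans ?_ (Complex.abs_re_le_norm _)
  refine le_trans ?_ (le_abs_self _)
  have hcont : Continuous fun s => ((Real.exp (b t - b s) * bump r (s - z) : ℝ) : ℂ) *
      Complex.exp (((drift a * (s - z) : ℝ) : ℂ) * Complex.I) := by fun_prop
  have hre := Complex.reCLM.intervalIntegral_comp_comm (μ := volume) (hcont.intervalIntegrable p q)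
  simp only [Complex.reCLM_apply] at hre
  rw [← hre]
  have hre2 : ∀ s, (((Real.exp (b t - b s) * bump r (s - z) : ℝ) : ℂ) *
      Complex.exp (((drift a * (s - z) : ℝ) : ℂ) * Complex.I)).re =
      Real.exp (b t - b s) * bump r (s - z) * Real.cos (drift a * (s - z)) := fun s => by
    rw [Complex.re_ofReal_mul, Complex.exp_ofReal_mul_I_re]
  simp only [hre2]
  have hχ : 0 < Real.smoothTransition (1 / 2) := Real.smoothTransition.pos_of_pos (by norm_num)
  have hmono : ∫ s in p..q, Λ / 2 * bump r (s - z) ≤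
      ∫ s in p..q, Real.exp (b t - b s) * bump r (s - z) * Real.cos (drift a * (s - z)) := by
    refine intervalIntegral.integral_mono_on (by linarith)
      (Continuous.intervalIntegrable (by fun_prop) _ _)
      (Continuous.intervalIntegrable (by fun_prop) _ _) fun s hs => ?_
    rcases lt_or_ge |s - z| r with hlt | hge
    · have h1 := hΛ s (by rw [abs_lt] at hlt; constructor <;> linarith [hlt.1, hlt.2])
      have h2 : 1 / 2 ≤ Real.cos (drift a * (s - z)) := by
        refine le_trans ?_ (Real.one_sub_sq_div_two_le_cos)
        have h3 : |drift a * (s - z)| ≤ 1 / 2 * 1 := by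
          rw [abs_mul]
          exact mul_le_mul (abs_drift_le a) (hlt.le.trans hr) (abs_nonneg _) (by norm_num)
        have h4 := sq_abs (drift a * (s - z))
        nlinarith [abs_nonneg (drift a * (s - z))]
      have h5 := bump_nonneg r (s - z)
      calc Λ / 2 * bump r (s - z) = Λ * bump r (s - z) * (1 / 2) := by ring
        _ ≤ _ := by gcongr
    · rw [bump_eq_zero h0 hr hge]
      · simp
      -- As `[p, q]` contains `[z - r, z + r]` and has length at most `2π`, it does not meet the
      -- interior of any other periodic copy of the bump.
      · rw [abs_le]
        constructor <;> linarith [hs.1, hs.2]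
  refine le_trans ?_ hmono
  rw [intervalIntegral.integral_const_mul]
  have hsub : ∫ s in (z - r / 2)..(z + r / 2), bump r (s - z) ≤ ∫ s in p..q, bump r (s - z) := by
    refine intervalIntegral.integral_mono_interval (by linarith) (by linarith) (by linarith)
      (Filter.Eventually.of_forall fun s => bump_nonneg r _)
      (Continuous.intervalIntegrable (by fun_prop) _ _)
  have hlow : r * Real.smoothTransition (1 / 2) ≤
      ∫ s in (z - r / 2)..(z + r / 2), bump r (s - z) := by
    have h1 : ∫ _s in (z - r / 2)..(z + r / 2), Real.smoothTransition (1 / 2) ≤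
        ∫ s in (z - r / 2)..(z + r / 2), bump r (s - z) := by
      refine intervalIntegral.integral_mono_on (by linarith)
        (Continuous.intervalIntegrable (by fun_prop) _ _)
        (Continuous.intervalIntegrable (by fun_prop) _ _) fun s hs => ?_
      refine smoothTransition_half_le_bump h0 hr ?_
      rw [abs_le]
      constructor <;> linarith [hs.1, hs.2]
    rw [intervalIntegral.integral_const, smul_eq_mul] at h1
    refine le_trans (le_of_eq ?_) h1
    ring
  calc Λ * (r * (Real.smoothTransition (1 / 2) / 2)) =
        Λ / 2 * (r * Real.smoothTransition (1 / 2)) := by ring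
    _ ≤ _ := by
      gcongr
      exact hlow.trans hsub

/-! ### Necessity of the oscillation conditions -/

/-- A bad interval has length at least `|ξ|^{-m}`, so a bump centred at its midpoint has a radius
with `r⁻¹` polynomial in `|ξ|`. On its support the kernel is at least `|ξ|^D`. -/
theorem exists_of_not_oscBound {B : ℝ → (Fin N → ℤ) → ℝ} {D t p q : ℝ} {ξ : Fin N → ℤ}
    (h : ¬ OscBound B m D ξ t p q) (hξ : 1 ≤ freqNorm ξ) : ∃ z r : ℝ, 0 < r ∧ r ≤ 1 ∧
      p ≤ z - r ∧ z + r ≤ q ∧ r⁻¹ ≤ 2 * (1 + freqNorm ξ) ^ ⌈|m|⌉₊ ∧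
      ∀ s ∈ Set.Ioo (z - r) (z + r),
        Real.exp (D * Real.log (freqNorm ξ)) ≤ Real.exp (B t ξ - B s ξ) := by
  unfold OscBound at h
  push Not at h
  obtain ⟨u, v, huv, hsub, hlen, hosc⟩ := h
  have hcl : Set.Icc u v ⊆ Set.Icc p q := by
    rw [← closure_Ioo huv.ne]
    exact closure_minimal hsub isClosed_Icc
  have hpu : p ≤ u := (hcl ⟨le_rfl, huv.le⟩).1
  have hvq : v ≤ q := (hcl ⟨huv.le, le_rfl⟩).2
  set r := min ((v - u) / 2) 1 with hr
  have hr0 : 0 < r := lt_min (by linarith) one_pos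
  have hr2 : r ≤ (v - u) / 2 := min_le_left _ _
  have hx0 : 0 < freqNorm ξ := by linarith
  have hp1 := one_le_one_add_freqNorm ξ
  have hpow : (1 : ℝ) ≤ (1 + freqNorm ξ) ^ ⌈|m|⌉₊ := one_le_pow₀ hp1
  refine ⟨(u + v) / 2, r, hr0, min_le_right _ _, by linarith, by linarith, ?_, fun s hs => ?_⟩
  · rw [inv_le_comm₀ hr0 (by positivity), hr]
    refine le_min ?_ (inv_le_one_of_one_le₀ (by linarith))
    have h1 : ((1 + freqNorm ξ) ^ ⌈|m|⌉₊)⁻¹ ≤ freqNorm ξ ^ (-m) := by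
      rw [Real.rpow_neg hx0.le]
      refine inv_anti₀ (Real.rpow_pos_of_pos hx0 _) ?_
      rw [← Real.rpow_natCast]
      exact (Real.rpow_le_rpow_of_exponent_le hξ ((le_abs_self m).trans (Nat.le_ceil _))).trans
        (Real.rpow_le_rpow hx0.le (by linarith) (Nat.cast_nonneg _))
    rw [mul_inv]
    linarith
  · refine Real.exp_le_exp.2 (hosc s ⟨?_, ?_⟩).le
    · linarith [hs.1]
    · linarith [hs.2]

/-- A single `D` serves as exponent and as threshold, as in the oscillation conditions: `D ≥ n + 1`
gives `x^D ≥ x * x^n`, and `x ≥ D > |C| * 2^n` absorbs the constant. -/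
theorem exists_threshold (C R : ℝ) (n : ℕ) : ∃ D : ℝ, 0 < D ∧ R ≤ D ∧ ∀ x : ℝ, D ≤ x →
    C * (1 + x) ^ n < Real.exp (D * Real.log x) := by
  set D := max R (n + 1 + |C| * 2 ^ n) with hD
  have hD1 : n + 1 + |C| * 2 ^ n ≤ D := le_max_right _ _
  have hpos : 0 ≤ |C| * 2 ^ n := by positivity
  have hn : (0 : ℝ) ≤ n := Nat.cast_nonneg n
  refine ⟨D, by linarith, le_max_left _ _, fun x hx => ?_⟩
  have hx1 : 1 ≤ x := by linarith
  have hx0 : 0 < x := by linarith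
  rw [mul_comm D, ← Real.rpow_def_of_pos hx0]
  have hxn : 0 < x ^ n := by positivity
  calc C * (1 + x) ^ n ≤ |C| * (2 * x) ^ n := by
        gcongr
        · exact le_abs_self C
        · linarith
    _ = |C| * 2 ^ n * x ^ n := by rw [mul_pow]; ring
    _ < x * x ^ n := by
        gcongr
        linarith
    _ = x ^ ((n + 1 : ℕ) : ℝ) := by rw [Real.rpow_natCast]; ring
    _ ≤ x ^ D := Real.rpow_le_rpow_of_exponent_le hx1 (by push_cast; linarith)

theorem norm_monodromy (a : ℝ → ℂ) :
    ‖monodromy a‖ = Real.exp (-(2 * Real.pi * (circMean a).im)) := by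
  rw [monodromy, Complex.norm_exp]
  congr 1
  simp

/-- If a condition fails at `ξ`, the kernel exceeds `Λ = |ξ|^D` on some bump. The solutions are then
larger, relative to the data, by about `Λ` up to polynomial factors of fixed degree, which
contradicts the a priori estimate for large `D`. -/
theorem IsTubeType.alpha_beta_of_globallySolvable (hQ : IsTubeType Q c m)
    {B : ℝ → (Fin N → ℤ) → ℝ} (hB : ∀ ξ t, HasDerivAt (fun s => B s ξ) (c t ξ).im t)
    {tmax : (Fin N → ℤ) → ℝ} (htmax : ∀ ξ ∈ resonantSet c, ∀ t, B t ξ ≤ B (tmax ξ) ξ)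
    (hcl : GloballySolvable (opP Q)) :
    ∃ D : ℝ, 0 < D ∧
      (∀ ξ : Fin N → ℤ, ξ ∉ resonantSet c → D ≤ freqNorm ξ →
        AlphaPlus B m D ξ ∨ AlphaMinus B m D ξ) ∧
      (∀ ξ : Fin N → ℤ, ξ ∈ resonantSet c → D ≤ freqNorm ξ → Beta B m D ξ (tmax ξ)) := by
  obtain ⟨K, hK⟩ := hQ.exists_a_priori hcl
  obtain ⟨C, P, hC0, hC⟩ := hQ.exists_testFn_bound K
  have hpi := Real.two_pi_pos
  set η := Real.smoothTransition (1 / 2) / 2 with hη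
  have hη0 : 0 < η := half_pos (Real.smoothTransition.pos_of_pos (by norm_num))
  set P₀ := ⌈|m|⌉₊ with hP₀
  -- The factor `4` is dictated by `(β)`: two bumps in the data and two values of the solution. The
  -- `2 * K + 1` powers of `2 * (1 + |ξ|)^P₀` bound `r⁻¹`, with `2 * K` from derivatives of the bump
  -- and one from its integral.
  obtain ⟨D, hD0, hDR, hD⟩ := exists_threshold (4 * η⁻¹ * (C * 2 ^ (2 * K + 1))) (max K 1)
    (K + P + P₀ * (2 * K + 1))
  have hDK : (K : ℝ) ≤ D := (le_max_left _ _).trans hDR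
  have hD1 : 1 ≤ D := (le_max_right _ _).trans hDR
  have key : ∀ ξ : Fin N → ℤ, D ≤ freqNorm ξ → ∀ Λ : ℝ,
      Λ = Real.exp (D * Real.log (freqNorm ξ)) → Λ ≤ 4 * η⁻¹ * ((1 + freqNorm ξ) ^ K *
        (C * (1 + freqNorm ξ) ^ P * (2 * (1 + freqNorm ξ) ^ P₀) ^ (2 * K)) *
        (2 * (1 + freqNorm ξ) ^ P₀)) → False := by
    rintro ξ hξ Λ rfl h
    refine absurd h (not_le.2 (lt_of_eq_of_lt ?_ (hD _ hξ)))
    rw [mul_pow, ← pow_mul, pow_add, pow_add]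
    ring
  have htest : ∀ (ξ : Fin N → ℤ) (z r : ℝ), 0 < r → r ≤ 1 → r⁻¹ ≤ 2 * (1 + freqNorm ξ) ^ P₀ →
      ∀ j ≤ K, ∀ t, ‖iteratedDeriv j (testFn (fun t => c t ξ) z r) t‖ ≤
        C * (1 + freqNorm ξ) ^ P * (2 * (1 + freqNorm ξ) ^ P₀) ^ (2 * K) :=
    fun ξ z r h0 h1 hr j hj t => (hC ξ z r h0 h1 j hj t).trans (by
      have := one_add_freqNorm_pos ξ
      gcongr)
  refine ⟨D, hD0, fun ξ hres hξ => ?_, fun ξ hres hξ => ?_⟩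
  · by_contra! hcon
    have hx1 : 1 ≤ freqNorm ξ := hD1.trans hξ
    have hp := one_add_freqNorm_pos ξ
    have ha := hQ.isCirc ξ
    have hq : monodromy (fun t => c t ξ) ≠ 1 := fun h => hres ((monodromy_eq_one_iff ξ).1 h)
    set a : ℝ → ℂ := fun t => c t ξ with ha_def
    set Λ := Real.exp (D * Real.log (freqNorm ξ)) with hΛ
    set w := 1 + freqNorm ξ with hw
    set T := C * w ^ P * (2 * w ^ P₀) ^ (2 * K) with hT
    have hT0 : 0 ≤ T := by positivity
    have main : ∀ (z r t p q : ℝ) (ζ : ℂ), 0 < r → r ≤ 1 → p ≤ z - r → z + r ≤ q →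
        q - p ≤ 2 * Real.pi → r⁻¹ ≤ 2 * w ^ P₀ →
        (∀ s ∈ Set.Ioo (z - r) (z + r), Λ ≤ Real.exp (B t ξ - B s ξ)) → ‖ζ‖ ≤ 2 →
        (∀ v, Solves a v (testFn a z r) → ζ * v t =
          Complex.I * ∫ x in p..q, (intFactor a t)⁻¹ * intFactor a x * testFn a z r x) →
        False := by
      intro z r t p q ζ h0 h1 hpz hzq hpq hr hosc hζ hsol
      have hg := isCirc_testFn ha z r
      obtain ⟨v, hv, hvb⟩ := hK ξ (hDK.trans hξ) (testFn a z r) T hg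
        (exists_solves_of_monodromy_ne_one ha hg hq) (htest ξ z r h0 h1 hr)
      have h2 := le_norm_integral_testFn ha (hB ξ) h0 h1 hpz hzq hpq (Real.exp_pos _).le hosc
      have h3 := congrArg norm (hsol v hv)
      rw [norm_mul, norm_mul, Complex.norm_I, one_mul] at h3
      rw [← h3] at h2
      have h4 : Λ * (r * η) ≤ 2 * (w ^ K * T) :=
        h2.trans (mul_le_mul hζ (hvb t) (norm_nonneg _) zero_le_two)
      refine key ξ hξ Λ rfl ?_
      calc Λ = Λ * (r * η) * (η⁻¹ * r⁻¹) := by field_simp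
        _ ≤ 2 * (w ^ K * T) * (η⁻¹ * (2 * w ^ P₀)) := by gcongr
        _ ≤ 4 * (w ^ K * T) * (η⁻¹ * (2 * w ^ P₀)) := by
            gcongr
            norm_num
        _ = _ := by ring
    -- Both `(α)` conditions fail, so either formula may be used. The sign of `Im c₀` selects the
    -- one whose factor, `q - 1` or `1 - q⁻¹`, has modulus at most `2`.
    rcases le_total 0 (circMean a).im with him | him
    · have h1 := hcon.1
      unfold AlphaPlus at h1
      push Not at h1
      obtain ⟨t, -, hosc⟩ := h1
      obtain ⟨z, r, h0, hr1, hpz, hzq, hr, hΛ'⟩ := exists_of_not_oscBound hosc hx1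
      refine main z r t t (t + 2 * Real.pi) (monodromy a - 1) h0 hr1 hpz hzq (by linarith) hr hΛ' ?_
        fun v hv => hv.eq_integral_forward ha (isCirc_testFn ha z r) t
      refine (norm_sub_le _ _).trans ?_
      have : ‖monodromy a‖ ≤ 1 := by
        rw [norm_monodromy, Real.exp_le_one_iff]
        exact neg_nonpos.2 (by positivity)
      rw [norm_one]
      linarith
    · have h1 := hcon.2
      unfold AlphaMinus at h1
      push Not at h1
      obtain ⟨t, -, hosc⟩ := h1
      obtain ⟨z, r, h0, hr1, hpz, hzq, hr, hΛ'⟩ := exists_of_not_oscBound hosc hx1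
      refine main z r t (t - 2 * Real.pi) t (1 - (monodromy a)⁻¹) h0 hr1 hpz hzq (by linarith) hr
        hΛ' ?_ fun v hv => hv.eq_integral_backward ha (isCirc_testFn ha z r) t
      refine (norm_sub_le _ _).trans ?_
      have : ‖(monodromy a)⁻¹‖ ≤ 1 := by
        rw [norm_inv, norm_monodromy, ← Real.exp_neg, Real.exp_le_one_iff, neg_neg]
        exact mul_nonpos_of_nonneg_of_nonpos hpi.le him
      rw [norm_one]
      linarith
  · intro t ht
    by_contra! hcon
    have hx1 : 1 ≤ freqNorm ξ := hD1.trans hξ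
    have hp := one_add_freqNorm_pos ξ
    have ha := hQ.isCirc ξ
    have hq : monodromy (fun t => c t ξ) = 1 := (monodromy_eq_one_iff ξ).2 hres
    set a : ℝ → ℂ := fun t => c t ξ with ha_def
    set Λ := Real.exp (D * Real.log (freqNorm ξ)) with hΛ
    have hΛ0 : 0 < Λ := Real.exp_pos _
    set w := 1 + freqNorm ξ with hw
    set T := C * w ^ P * (2 * w ^ P₀) ^ (2 * K) with hT
    have hT0 : 0 ≤ T := by positivity
    set t₀ := tmax ξ with ht₀
    obtain ⟨z₁, r₁, h₁0, h₁1, hpz₁, hzq₁, hr₁, hΛ₁⟩ := exists_of_not_oscBound hcon.1 hx1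
    obtain ⟨z₂, r₂, h₂0, h₂1, hpz₂, hzq₂, hr₂, hΛ₂⟩ := exists_of_not_oscBound hcon.2 hx1
    have hE := (contDiff_intFactor ha.contDiff).continuous
    set κ : ℝ → ℂ := fun x => (intFactor a t)⁻¹ * intFactor a x with hκ
    have hκc : Continuous κ := continuous_const.mul hE
    set g₁ := testFn a z₁ r₁ with hg₁
    set g₂ := testFn a z₂ r₂ with hg₂
    have hg₁c : IsCirc g₁ := isCirc_testFn ha z₁ r₁
    have hg₂c : IsCirc g₂ := isCirc_testFn ha z₂ r₂
    have hint : ∀ {g : ℝ → ℂ}, IsCirc g → ∀ p q : ℝ,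
        IntervalIntegrable (fun x => κ x * g x) volume p q := fun hg p q =>
      (hκc.mul hg.contDiff.continuous).intervalIntegrable p q
    set I₁ := ∫ x in t₀..t₀ + 2 * Real.pi, κ x * g₁ x with hI₁
    set I₂ := ∫ x in t₀..t₀ + 2 * Real.pi, κ x * g₂ x with hI₂
    have hb₁ : Λ * (r₁ * η) ≤ ‖I₁‖ := le_norm_integral_testFn ha (hB ξ) h₁0 h₁1
      (by linarith [ht.1]) (by linarith) (by linarith) hΛ0.le hΛ₁
    have hb₂ : Λ * (r₂ * η) ≤ ‖I₂‖ := le_norm_integral_testFn ha (hB ξ) h₂0 h₂1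
      (by linarith) (by linarith [ht.2]) (by linarith) hΛ0.le hΛ₂
    have hn₁ : 0 < ‖I₁‖ := lt_of_lt_of_le (by positivity) hb₁
    have hn₂ : 0 < ‖I₂‖ := lt_of_lt_of_le (by positivity) hb₂
    have hI₁0 : I₁ ≠ 0 := norm_pos_iff.1 hn₁
    have hI₂0 : I₂ ≠ 0 := norm_pos_iff.1 hn₂
    have hinv : ∀ {r x : ℝ}, 0 < r → 0 < x → r⁻¹ ≤ 2 * w ^ P₀ → Λ * (r * η) ≤ x →
        x⁻¹ ≤ Λ⁻¹ * (η⁻¹ * (2 * w ^ P₀)) := fun {r x} h0 hx hr h => by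
      calc x⁻¹ ≤ (Λ * (r * η))⁻¹ := inv_anti₀ (by positivity) h
        _ = Λ⁻¹ * (η⁻¹ * r⁻¹) := by rw [mul_inv, mul_inv]; ring
        _ ≤ _ := by gcongr
    have hi₁ := hinv h₁0 hn₁ hr₁ hb₁
    have hi₂ := hinv h₂0 hn₂ hr₂ hb₂
    -- The bump `g₁` lies in the arc after `t`, `g₂` in the arc before it. The weights make the
    -- integral over the circle vanish, so the equation is solvable, while the part over `[t₀, t]`
    -- equals `-1`. Since `I₁` and `I₂` are large, `g` is small, of order `Λ⁻¹` up to polynomial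
    -- factors.
    set g : ℝ → ℂ := fun x => I₁⁻¹ * g₁ x + -I₂⁻¹ * g₂ x with hg
    have hgc : IsCirc g := ⟨(hg₁c.const_mul _).contDiff.add (hg₂c.const_mul _).contDiff,
      (hg₁c.const_mul _).periodic.add (hg₂c.const_mul _).periodic⟩
    have hsplit : ∀ p q : ℝ, ∫ x in p..q, κ x * g x =
        I₁⁻¹ * (∫ x in p..q, κ x * g₁ x) + -I₂⁻¹ * ∫ x in p..q, κ x * g₂ x := fun p q => by
      rw [← intervalIntegral.integral_const_mul, ← intervalIntegral.integral_const_mul,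
        ← intervalIntegral.integral_add ((hint hg₁c p q).const_mul _)
          ((hint hg₂c p q).const_mul _)]
      refine intervalIntegral.integral_congr fun x _ => ?_
      simp only [hg]
      ring
    have hpull : ∀ p q : ℝ, ∫ x in p..q, intFactor a x * g x =
        intFactor a t * ∫ x in p..q, κ x * g x := fun p q => by
      rw [← intervalIntegral.integral_const_mul]
      refine intervalIntegral.integral_congr fun x _ => ?_
      simp only [hκ]
      field_simp [intFactor_ne_zero a t]
    have hzero : ∫ x in t₀..t₀ + 2 * Real.pi, intFactor a x * g x = 0 := by
      rw [hpull, hsplit, ← hI₁, ← hI₂, inv_mul_cancel₀ hI₁0, neg_mul, inv_mul_cancel₀ hI₂0]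
      ring
    have hz₁ : ∫ x in t₀..t, κ x * g₁ x = 0 := by
      refine (intervalIntegral.integral_congr (g := fun _ => 0) fun x hx => ?_).trans (by simp)
      rw [Set.uIcc_of_le ht.1.le] at hx
      have : g₁ x = 0 := testFn_eq_zero h₁0 h₁1
        (le_abs.2 (Or.inr (by linarith [hx.2]))) (by
          rw [abs_le]
          constructor <;> linarith [hx.1, hx.2])
      simp only [this, mul_zero]
    have hz₂ : ∫ x in t..t₀ + 2 * Real.pi, κ x * g₂ x = 0 := by
      refine (intervalIntegral.integral_congr (g := fun _ => 0) fun x hx => ?_).trans (by simp)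
      rw [Set.uIcc_of_le ht.2.le] at hx
      have : g₂ x = 0 := testFn_eq_zero h₂0 h₂1
        (le_abs.2 (Or.inl (by linarith [hx.1]))) (by
          rw [abs_le]
          constructor <;> linarith [hx.1, hx.2])
      simp only [this, mul_zero]
    have hhalf : ∫ x in t₀..t, κ x * g x = -1 := by
      have h1 : ∫ x in t₀..t, κ x * g₂ x = I₂ := by
        have := intervalIntegral.integral_add_adjacent_intervals (hint hg₂c t₀ t)
          (hint hg₂c t (t₀ + 2 * Real.pi))
        rwa [hz₂, add_zero] at this
      rw [hsplit, hz₁, h1, neg_mul, inv_mul_cancel₀ hI₂0]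
      ring
    obtain ⟨v₀, hv₀, -⟩ := exists_solves_of_integral_eq_zero ha hgc hq hzero
    have hgb : ∀ j ≤ K, ∀ x, ‖iteratedDeriv j g x‖ ≤
        2 * (Λ⁻¹ * (η⁻¹ * (2 * w ^ P₀))) * T := fun j hj x => by
      have hjn : ((j : ℕ∞) : WithTop ℕ∞) ≤ ∞ := by exact_mod_cast le_top
      have h1 : iteratedDeriv j ((fun x => I₁⁻¹ * g₁ x) + fun x => -I₂⁻¹ * g₂ x) x =
          iteratedDeriv j (fun x => I₁⁻¹ * g₁ x) x + iteratedDeriv j (fun x => -I₂⁻¹ * g₂ x) x :=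
        iteratedDeriv_add ((hg₁c.const_mul _).contDiff.contDiffAt.of_le hjn)
          ((hg₂c.const_mul _).contDiff.contDiffAt.of_le hjn)
      refine (congrArg norm h1).le.trans ((norm_add_le _ _).trans ?_)
      rw [iteratedDeriv_const_mul_circ, iteratedDeriv_const_mul_circ, norm_neg, norm_inv, norm_inv]
      have h2 := htest ξ z₁ r₁ h₁0 h₁1 hr₁ j hj x
      have h3 := htest ξ z₂ r₂ h₂0 h₂1 hr₂ j hj x
      calc _ ≤ Λ⁻¹ * (η⁻¹ * (2 * w ^ P₀)) * T + Λ⁻¹ * (η⁻¹ * (2 * w ^ P₀)) * T :=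
            add_le_add (mul_le_mul hi₁ h2 (norm_nonneg _) (by positivity))
              (mul_le_mul hi₂ h3 (norm_nonneg _) (by positivity))
        _ = _ := by ring
    obtain ⟨v, hv, hvb⟩ := hK ξ (hDK.trans hξ) g _ hgc ⟨v₀, hv₀⟩ hgb
    have h1 := hv.intFactor_sub ha.contDiff.continuous hgc.contDiff.continuous t₀ t
    rw [hpull, hhalf] at h1
    have h2 : v t - (intFactor a t)⁻¹ * intFactor a t₀ * v t₀ = -Complex.I := by
      have h0 := intFactor_ne_zero a t
      have h3 : intFactor a t * (v t - (intFactor a t)⁻¹ * intFactor a t₀ * v t₀) =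
          intFactor a t * -Complex.I := by
        calc _ = intFactor a t * v t - intFactor a t₀ * v t₀ := by field_simp
          _ = _ := by rw [h1]; ring
      exact mul_left_cancel₀ h0 h3
    -- This is where the choice of `t₀` as a maximum of `B` enters. It follows that every solution
    -- has modulus at least `1/2` at `t` or at `t₀`, so no choice of solution can satisfy the a
    -- priori bound.
    have h3 : ‖(intFactor a t)⁻¹ * intFactor a t₀‖ ≤ 1 := by
      rw [norm_inv_intFactor_mul ha.contDiff.continuous (hB ξ), Real.exp_le_one_iff]
      linarith [htmax ξ hres t]
    have h4 : 1 ≤ ‖v t‖ + ‖v t₀‖ := by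
      have h5 := congrArg norm h2
      rw [norm_neg, Complex.norm_I] at h5
      rw [← h5]
      refine (norm_sub_le _ _).trans (add_le_add le_rfl ?_)
      rw [norm_mul]
      exact mul_le_of_le_one_left (norm_nonneg _) h3
    have h5 : 1 ≤ 2 * (w ^ K * (2 * (Λ⁻¹ * (η⁻¹ * (2 * w ^ P₀))) * T)) := by
      linarith [hvb t, hvb t₀]
    refine key ξ hξ Λ rfl ?_
    calc Λ = Λ * 1 := (mul_one Λ).symm
      _ ≤ Λ * (2 * (w ^ K * (2 * (Λ⁻¹ * (η⁻¹ * (2 * w ^ P₀))) * T))) := by gcongr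
      _ = 4 * η⁻¹ * (w ^ K * T * (2 * w ^ P₀)) * (Λ * Λ⁻¹) := by ring
      _ = _ := by rw [mul_inv_cancel₀ hΛ0.ne', mul_one]

end TubeOperator

end

theorem theorem1 {N : ℕ} (m : ℝ)
    (Q : TubeOperator.SmoothTorus N →L[ℂ] TubeOperator.SmoothTorus N)
    (c : ℝ → (Fin N → ℤ) → ℂ) (hQ : TubeOperator.IsTubeType Q c m)
    (B : ℝ → (Fin N → ℤ) → ℝ)
    (hB : ∀ (ξ : Fin N → ℤ) (t : ℝ), HasDerivAt (fun s => B s ξ) (c t ξ).im t)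
    (tmax : (Fin N → ℤ) → ℝ)
    (htmax : ∀ ξ ∈ TubeOperator.resonantSet c, ∀ t : ℝ, B t ξ ≤ B (tmax ξ) ξ) :
    TubeOperator.GloballySolvable (TubeOperator.opP Q) ↔
      (∃ C : ℝ, 0 < C ∧ ∃ M : ℕ, ∀ (τ : ℤ) (ξ : Fin N → ℤ), ξ ∉ TubeOperator.resonantSet c →
        C * (1 + TubeOperator.freqNorm ξ) ^ (-(M : ℝ)) ≤ ‖(τ : ℂ) + TubeOperator.average c ξ‖) ∧
      (∃ D : ℝ, 0 < D ∧
        (∀ ξ : Fin N → ℤ, ξ ∉ TubeOperator.resonantSet c → D ≤ TubeOperator.freqNorm ξ →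
          TubeOperator.AlphaPlus B m D ξ ∨ TubeOperator.AlphaMinus B m D ξ) ∧
        (∀ ξ : Fin N → ℤ, ξ ∈ TubeOperator.resonantSet c → D ≤ TubeOperator.freqNorm ξ →
          TubeOperator.Beta B m D ξ (tmax ξ))) :=
  ⟨fun h => ⟨hQ.diophantine_of_globallySolvable h,
      hQ.alpha_beta_of_globallySolvable hB htmax h⟩,
    fun h => hQ.globallySolvable_of_conditions hB h.1 h.2⟩
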